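/- **The 27 full groups and the 8 quarter groups.** A (three-dimensional) *space group* is a discrete cocompact group of isometries of $\mathbb{R}^3$ (orientation-reversing isometries allowed). It is *irreducible* if there is no direction which it preserves up to sign, that is, no $v\neq 0$ such that the linear part of every element maps $v$ to $v$ or $-v$. Two space groups are *of the same type* if they are conjugate by an affine bijection of $\mathbb{R}^3$ (mirror images are thus not distinguished). *The lattice.* Let $D_3^*=\mathbb{Z}^3\cup\big(\mathbb{Z}^3+(\tfrac12,\tfrac12,\tfrac12)\big)$ be the body-centred cubic (bcc) lattice. It is the union of the four cosets $[k]=\{(x,y,z)\in D_3^*: x+y+z\equiv \tfrac k2 \pmod 2\}$, $k=0,1,2,3$, of the lattice $D_3=[0]=\{(x,y,z)\in\mathbb{Z}^3: x+y+z \text{ even}\}$. The cells of the Delaunay complex of $D_3^*$ are tetrahedra with one vertex $v_k$ in each coset $[k]$; the *sign* of such a cell is its handedness, i.e. $+$ or $-$ according to whether $\det(v_1-v_0,v_2-v_0,v_3-v_0)$ is positive or negative. Every symmetry $g$ of $D_3^*$ (isometry with $g(D_3^*)=D_3^*$) permutes the cosets, $g[k]=[\pi(k)]$, and either fixes the signs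 of all Delaunay cells or changes them all; so $g$ induces exactly one *signed permutation* $\pm\pi$. Let $G_{16}$ be the group of signed permutations so induced by all symmetries of $D_3^*$, and for $H\le G_{16}$ let the *full group* $F_H$ consist of all symmetries of $D_3^*$ that induce an element of $H$. *The marked lines.* Through each point $(x,y,z)\in D_3^*$ mark a line, whose direction is - for $x,y,z\in\mathbb{Z}$: $(1,1,1)$ if $x\equiv y\equiv z$; $(-1,1,1)$ if $y\not\equiv z\equiv x$; $(1,-1,1)$ if $z\not\equiv x\equiv y$; $(1,1,-1)$ if $x\not\equiv y\equiv z$; - for $x,y,z\in\mathbb{Z}+\tfrac12$: $(1,1,1)$ if $x\equiv y\equiv z$; $(-1,1,1)$ if $z\not\equiv x\equiv y$; $(1,-1,1)$ if $x\not\equiv y\equiv z$; $(1,1,-1)$ if $y\not\equiv z\equiv x$ (all congruences modulo $2$). Let $N_2$ be the group of symmetries of $D_3^*$ that permute the marked lines, let $G_8$ be the group of permutations of the four cosets induced by $N_2$, and for $K\le G_8$ let the *quarter group* $Q_K$ consist of all elements of $N_2$ that induce an element of $K$. Let $N_1$ be the group of all symmetries of $D_3^*$, and for $i=1,2$ let $T_i$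 be the odd subgroup of $N_i$, i.e. the subgroup generated by its elements of order $3$. Then: 1. $G_{16}$ has order $16$ and equals $\{\pm1\}\times D$, where $D$ is the dihedral group of order $8$ generated by the permutations $(0\,1\,2\,3)$ and $(1\,3)$. All elements of $N_2$ preserve the signs of the Delaunay cells, and $G_8=D$ is dihedral of order $8$. 2. For $i=1,2$, the normalizer of $T_i$ in the group of all isometries of $\mathbb{R}^3$ is $N_i$. The kernel of the map $N_1\to G_{16}$ is $T_1$ and the kernel of the map $N_2\to G_8$ is $T_2$; so $N(T_1)/T_1\cong G_{16}$ and $N(T_2)/T_2\cong G_8$. 3. $G_{16}$ has exactly $27$ conjugacy classes of subgroups, $G_8$ has exactly $8$, and there are exactly $35$ types of irreducible space groups. All the groups $F_H$ $(H\le G_{16})$ and $Q_K$ $(K\le G_8)$ are irreducible space groups, and mapping the $G_{16}$-conjugacy class of $H$ to the type of $F_H$ and the $G_8$-conjugacy class of $K$ to the type of $Q_K$ gives a well-defined bijection from the disjoint union of the set of conjugacy classes of subgroups of $G_{16}$ and the set of conjugacy classes of subgroups of $G_8$ onto the set of types of irreducible space groups. -/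

import Mathlib

/-- Euclidean three-space. -/
abbrev E3 : Type := EuclideanSpace ℝ (Fin 3)

/-- The group of isometries of Euclidean three-space. -/
abbrev Isom3 : Type := E3 ≃ᵃⁱ[ℝ] E3

/-! ### Space groups, irreducibility, equivalence -/

/-- A three-dimensional crystallographic (space) group: a discrete cocompact group of isometries.
Any compact region contains only finitely many images of a given point (counted with the group
elements producing them), and the images of some compact region cover space. -/
structure IsSpaceGroup (G : Subgroup Isom3) : Prop where
  discrete : ∀ (p : E3) (C : Set E3), IsCompact C → {g : Isom3 | g ∈ G ∧ g p ∈ C}.Finite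
  cocompact : ∃ C : Set E3, IsCompact C ∧ ∀ q : E3, ∃ g ∈ G, ∃ p ∈ C, g p = q

/-- `G` is irreducible: there is no direction which `G` preserves up to sign. -/
def IsIrreducibleGroup (G : Subgroup Isom3) : Prop :=
  ¬ ∃ v : E3, v ≠ 0 ∧ ∀ g ∈ G, g.linearIsometryEquiv v = v ∨ g.linearIsometryEquiv v = -v

/-- Irreducible space groups, as actual groups of isometries. -/
abbrev IrreducibleSpaceGroup : Type :=
  {G : Subgroup Isom3 // IsSpaceGroup G ∧ IsIrreducibleGroup G}

/-- Two groups of isometries are equivalent if some affine bijection of space conjugates one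
onto the other. -/
def AffinelyEquivalent (G G' : Subgroup Isom3) : Prop :=
  ∃ φ : E3 ≃ᵃ[ℝ] E3,
    (fun g : Isom3 => φ * g.toAffineEquiv * φ⁻¹) '' (G : Set Isom3) =
      (fun g : Isom3 => g.toAffineEquiv) '' (G' : Set Isom3)

theorem AffinelyEquivalent.refl (G : Subgroup Isom3) : AffinelyEquivalent G G :=
  ⟨1, by simp⟩

theorem AffinelyEquivalent.symm {G G' : Subgroup Isom3} (h : AffinelyEquivalent G G') :
    AffinelyEquivalent G' G := by
  obtain ⟨φ, hφ⟩ := h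
  refine ⟨φ⁻¹, ?_⟩
  have h1 : (fun g : Isom3 => φ⁻¹ * g.toAffineEquiv * φ⁻¹⁻¹) '' (G' : Set Isom3) =
      (fun a => φ⁻¹ * a * φ) '' ((fun g : Isom3 => g.toAffineEquiv) '' (G' : Set Isom3)) := by
    simp [Set.image_image]
  rw [h1, ← hφ, Set.image_image]
  refine Set.image_congr fun g _ => ?_
  group

theorem AffinelyEquivalent.trans {G G' G'' : Subgroup Isom3} (h : AffinelyEquivalent G G')
    (h' : AffinelyEquivalent G' G'') : AffinelyEquivalent G G'' := by
  obtain ⟨φ, hφ⟩ := h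
  obtain ⟨ψ, hψ⟩ := h'
  refine ⟨ψ * φ, ?_⟩
  have h1 : (fun g : Isom3 => ψ * g.toAffineEquiv * ψ⁻¹) '' (G' : Set Isom3) =
      (fun a => ψ * a * ψ⁻¹) '' ((fun g : Isom3 => g.toAffineEquiv) '' (G' : Set Isom3)) := by
    simp [Set.image_image]
  rw [← hψ, h1, ← hφ, Set.image_image]
  refine Set.image_congr fun g _ => ?_
  group

/-- Affine equivalence on irreducible space groups. -/
instance irreducibleSpaceGroupSetoid : Setoid IrreducibleSpaceGroup where
  r G G' := AffinelyEquivalent G.1 G'.1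
  iseqv := ⟨fun G => AffinelyEquivalent.refl G.1, AffinelyEquivalent.symm,
    AffinelyEquivalent.trans⟩

/-- The types of irreducible space groups: irreducible space groups up to affine equivalence. -/
abbrev IrreducibleSpaceGroupType : Type := Quotient irreducibleSpaceGroupSetoid

/-! ### Conjugacy classes of subgroups -/

/-- Conjugacy of subgroups of a group. -/
def subgroupConjSetoid (Γ : Type*) [Group Γ] : Setoid (Subgroup Γ) where
  r H K := ∃ γ : Γ, H.map (MulAut.conj γ).toMonoidHom = K
  iseqv := by
    refine ⟨fun H => ⟨1, ?_⟩, ?_, ?_⟩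
    · ext x; simp
    · rintro H K ⟨γ, rfl⟩
      refine ⟨γ⁻¹, ?_⟩
      rw [Subgroup.map_map]
      ext x; simp [Subgroup.mem_map, mul_assoc]
    · rintro H K L ⟨γ, rfl⟩ ⟨δ, rfl⟩
      refine ⟨δ * γ, ?_⟩
      rw [Subgroup.map_map]
      ext x; simp [Subgroup.mem_map, mul_assoc]

/-- The conjugacy classes of subgroups of a group. -/
abbrev SubgroupConjClass (Γ : Type*) [Group Γ] : Type _ := Quotient (subgroupConjSetoid Γ)

/-- The conjugacy class of a subgroup. -/
def subgroupConjClass {Γ : Type*} [Group Γ] (H : Subgroup Γ) : SubgroupConjClass Γ :=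
  Quotient.mk (subgroupConjSetoid Γ) H

/-! ### The body-centred cubic lattice and its four cosets -/

/-- Congruence of real numbers modulo `2`. -/
def CongTwo (a b : ℝ) : Prop := ∃ n : ℤ, a - b = 2 * n

/-- All three coordinates are integers. -/
def IsIntPoint (p : E3) : Prop := ∀ i, ∃ n : ℤ, p i = n

/-- All three coordinates are integers plus one half. -/
def IsHalfPoint (p : E3) : Prop := ∀ i, ∃ n : ℤ, p i - 1 / 2 = n

/-- The body-centred cubic lattice `D₃*`. -/
def bcc : Set E3 := {p | IsIntPoint p ∨ IsHalfPoint p}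

/-- The coset `[k]` of the face-centred cubic lattice
`D₃ = {(x, y, z) ∈ ℤ³ | x + y + z even} = [0]`: the points of `D₃*` with
`x + y + z ≡ k / 2 (mod 2)`. -/
def bccCoset (k : Fin 4) : Set E3 :=
  {p | p ∈ bcc ∧ CongTwo (p 0 + p 1 + p 2) (((k : ℕ) : ℝ) / 2)}

/-- The symmetries of the bcc lattice. -/
def bccSymm : Subgroup Isom3 where
  carrier := {g | g '' bcc = bcc}
  mul_mem' {a b} ha hb := by
    simp only [Set.mem_ofPred_eq] at *
    rw [AffineIsometryEquiv.coe_mul, Set.image_comp, hb, ha]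
  one_mem' := by simp
  inv_mem' {a} ha := by
    simp only [Set.mem_ofPred_eq] at *
    conv_lhs => rw [← ha]
    rw [← Set.image_comp, ← AffineIsometryEquiv.coe_mul]
    simp

/-- `v 0, v 1, v 2, v 3` are the vertices, indexed by their colours, of a cell (tetrahedron) of the
Delaunay complex of the bcc lattice: they lie on a sphere that has no lattice point in its
interior. -/
def IsDelaunayCell (v : Fin 4 → E3) : Prop :=
  (∀ k, v k ∈ bccCoset k) ∧ AffineIndependent ℝ v ∧
    ∃ (c : E3) (r : ℝ), (∀ k, dist (v k) c = r) ∧ ∀ p ∈ bcc, r ≤ dist p c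

/-- The sign of a labelled tetrahedron, that is, its handedness: two Delaunay cells have the same
sign exactly if some orientation-preserving motion carries one to the other, respecting colours. -/
noncomputable def cellSign (v : Fin 4 → E3) : ℤˣ :=
  if 0 < (Matrix.of fun i j : Fin 3 => v i.succ j - v 0 j).det then 1 else -1

/-- Signed permutations of the four colours `0, 1, 2, 3`. -/
abbrev SignedPerm : Type := Equiv.Perm (Fin 4) × ℤˣ

/-- `g` permutes the four cosets by `π`. -/
def InducesPerm (g : Isom3) (π : Equiv.Perm (Fin 4)) : Prop :=
  ∀ k, g '' bccCoset k = bccCoset (π k)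

/-- `g` permutes the four cosets by `σ.1`, and it fixes (`σ.2 = 1`) or changes (`σ.2 = -1`) the
signs of all Delaunay cells. The image under `g` of a cell `v` has the vertex `g (v k)` of colour
`π k`, hence the relabelling by the inverse of `π`. -/
def InducesSigned (g : Isom3) (σ : SignedPerm) : Prop :=
  InducesPerm g σ.1 ∧
    ∀ v : Fin 4 → E3, IsDelaunayCell v →
      cellSign (fun k => g (v (σ.1⁻¹ k))) = σ.2 * cellSign v

theorem InducesPerm.one : InducesPerm 1 1 := by intro k; simp

theorem InducesPerm.mul {g h : Isom3} {π ρ : Equiv.Perm (Fin 4)} (hg : InducesPerm g π)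
    (hh : InducesPerm h ρ) : InducesPerm (g * h) (π * ρ) := by
  intro k
  rw [AffineIsometryEquiv.coe_mul, Set.image_comp, hh, hg, Equiv.Perm.mul_apply]

theorem InducesPerm.inv {g : Isom3} {π : Equiv.Perm (Fin 4)} (hg : InducesPerm g π) :
    InducesPerm g⁻¹ π⁻¹ := by
  intro k
  have h := hg (π⁻¹ k)
  rw [show π (π⁻¹ k) = k by simp] at h
  rw [← h, ← Set.image_comp, ← AffineIsometryEquiv.coe_mul]
  simp

/-- A lattice symmetry carries Delaunay cells to Delaunay cells. -/
theorem IsDelaunayCell.image {g : Isom3} (hb : g ∈ bccSymm) {π : Equiv.Perm (Fin 4)}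
    (hg : InducesPerm g π) {v : Fin 4 → E3} (hv : IsDelaunayCell v) :
    IsDelaunayCell (fun k => g (v (π⁻¹ k))) := by
  obtain ⟨h1, h2, c, r, h3, h4⟩ := hv
  refine ⟨fun k => ?_, ?_, g c, r, fun k => ?_, fun p hp => ?_⟩
  · have h := Set.mem_image_of_mem g (h1 (π⁻¹ k))
    rwa [hg, show π (π⁻¹ k) = k by simp] at h
  · have h := (h2.comp_embedding (π⁻¹ : Equiv.Perm (Fin 4)).toEmbedding)
    exact h.map' g.toAffineEquiv.toAffineMap g.injective
  · rw [g.dist_map]; exact h3 _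
  · have hb' : g '' bcc = bcc := hb
    rw [← hb'] at hp
    obtain ⟨q, hq, rfl⟩ := hp
    rw [g.dist_map]; exact h4 q hq

theorem InducesSigned.one : InducesSigned 1 1 :=
  ⟨InducesPerm.one, fun v _ => by simp⟩

theorem InducesSigned.mul {g h : Isom3} (hhb : h ∈ bccSymm) {σ τ : SignedPerm}
    (hg : InducesSigned g σ) (hh : InducesSigned h τ) : InducesSigned (g * h) (σ * τ) := by
  refine ⟨hg.1.mul hh.1, fun v hv => ?_⟩
  have h1 := hg.2 _ (hv.image hhb hh.1)
  rw [hh.2 v hv] at h1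
  simpa [mul_assoc] using h1

theorem InducesSigned.inv {g : Isom3} (hgb : g ∈ bccSymm) {σ : SignedPerm}
    (hg : InducesSigned g σ) : InducesSigned g⁻¹ σ⁻¹ := by
  refine ⟨hg.1.inv, fun v hv => ?_⟩
  have h1 := hg.2 _ (hv.image (inv_mem hgb) hg.1.inv)
  have h2 : (fun k => g (g⁻¹ (v ((σ.1⁻¹)⁻¹ (σ.1⁻¹ k))))) = v := by
    funext k
    rw [← Function.comp_apply (f := g), ← AffineIsometryEquiv.coe_mul]
    simp
  change cellSign (fun k => g (g⁻¹ (v ((σ.1⁻¹)⁻¹ (σ.1⁻¹ k))))) = _ at h1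
  rw [h2] at h1
  rw [h1]
  simp [← mul_assoc]

/-- `G₁₆`: the group of signed permutations induced by all symmetries of the bcc lattice. -/
def G16 : Subgroup SignedPerm where
  carrier := {σ | ∃ g ∈ bccSymm, InducesSigned g σ}
  mul_mem' := by
    rintro σ τ ⟨g, hg, hgσ⟩ ⟨h, hh, hhτ⟩
    exact ⟨g * h, mul_mem hg hh, hgσ.mul hh hhτ⟩
  one_mem' := ⟨1, one_mem _, InducesSigned.one⟩
  inv_mem' := by
    rintro σ ⟨g, hg, hgσ⟩
    exact ⟨g⁻¹, inv_mem hg, hgσ.inv hg⟩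

/-- The full group of `H ≤ G₁₆`: all symmetries of the bcc lattice that induce a signed
permutation belonging to `H`. -/
def fullGroup (H : Subgroup G16) : Subgroup Isom3 where
  carrier := {g | g ∈ bccSymm ∧ ∃ σ ∈ H, InducesSigned g σ}
  mul_mem' := by
    rintro g h ⟨hg, σ, hσ, hgσ⟩ ⟨hh, τ, hτ, hhτ⟩
    exact ⟨mul_mem hg hh, σ * τ, mul_mem hσ hτ, hgσ.mul hh hhτ⟩
  one_mem' := ⟨one_mem _, 1, one_mem _, InducesSigned.one⟩
  inv_mem' := by
    rintro g ⟨hg, σ, hσ, hgσ⟩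
    exact ⟨inv_mem hg, σ⁻¹, inv_mem hσ, hgσ.inv hg⟩

/-! ### The lattice with its marked diagonal lines -/

/-- The rule assigning to each point `(x, y, z)` of the bcc lattice the direction of the marked
diagonal line through it. -/
def HasLineDirection (p d : E3) : Prop :=
  (IsIntPoint p ∧
    ((CongTwo (p 0) (p 1) ∧ CongTwo (p 1) (p 2) ∧ d = !₂[1, 1, 1]) ∨
     (¬ CongTwo (p 1) (p 2) ∧ CongTwo (p 2) (p 0) ∧ d = !₂[-1, 1, 1]) ∨
     (¬ CongTwo (p 2) (p 0) ∧ CongTwo (p 0) (p 1) ∧ d = !₂[1, -1, 1]) ∨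
     (¬ CongTwo (p 0) (p 1) ∧ CongTwo (p 1) (p 2) ∧ d = !₂[1, 1, -1]))) ∨
  (IsHalfPoint p ∧
    ((CongTwo (p 0) (p 1) ∧ CongTwo (p 1) (p 2) ∧ d = !₂[1, 1, 1]) ∨
     (¬ CongTwo (p 2) (p 0) ∧ CongTwo (p 0) (p 1) ∧ d = !₂[-1, 1, 1]) ∨
     (¬ CongTwo (p 0) (p 1) ∧ CongTwo (p 1) (p 2) ∧ d = !₂[1, -1, 1]) ∨
     (¬ CongTwo (p 1) (p 2) ∧ CongTwo (p 2) (p 0) ∧ d = !₂[1, 1, -1])))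

/-- The set of marked diagonal lines. -/
def markedLines : Set (Set E3) :=
  {ℓ | ∃ p d : E3, HasLineDirection p d ∧ ℓ = {q | ∃ t : ℝ, q = p + t • d}}

/-- The symmetries of the bcc lattice with its marked lines: the symmetries of the lattice that
permute the marked lines. -/
def markedSymm : Subgroup Isom3 where
  carrier := {g | g ∈ bccSymm ∧ (fun ℓ => g '' ℓ) '' markedLines = markedLines}
  mul_mem' := by
    rintro g h ⟨hg, hg'⟩ ⟨hh, hh'⟩
    refine ⟨mul_mem hg hh, ?_⟩
    have h1 : (fun ℓ : Set E3 => (g * h : Isom3) '' ℓ) =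
        (fun ℓ : Set E3 => g '' ℓ) ∘ (fun ℓ : Set E3 => h '' ℓ) := by
      funext ℓ
      rw [AffineIsometryEquiv.coe_mul, Set.image_comp, Function.comp_apply]
    rw [h1, Set.image_comp, hh', hg']
  one_mem' := ⟨one_mem _, by simp⟩
  inv_mem' := by
    rintro g ⟨hg, hg'⟩
    refine ⟨inv_mem hg, ?_⟩
    have h1 : (fun ℓ : Set E3 => (g⁻¹ : Isom3) '' ℓ) ∘ (fun ℓ : Set E3 => g '' ℓ) = id := by
      funext ℓ
      rw [Function.comp_apply, ← Set.image_comp, ← AffineIsometryEquiv.coe_mul]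
      simp
    conv_lhs => rw [← hg']
    rw [← Set.image_comp, h1, Set.image_id]

/-- `G₈`: the group of permutations of the four cosets induced by the symmetries of the bcc
lattice with its marked lines. -/
def G8 : Subgroup (Equiv.Perm (Fin 4)) where
  carrier := {π | ∃ g ∈ markedSymm, InducesPerm g π}
  mul_mem' := by
    rintro π ρ ⟨g, hg, hgπ⟩ ⟨h, hh, hhρ⟩
    exact ⟨g * h, mul_mem hg hh, hgπ.mul hhρ⟩
  one_mem' := ⟨1, one_mem _, InducesPerm.one⟩
  inv_mem' := by
    rintro π ⟨g, hg, hgπ⟩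
    exact ⟨g⁻¹, inv_mem hg, hgπ.inv⟩

/-- The quarter group of `K ≤ G₈`: all symmetries of the bcc lattice with its marked lines that
induce a permutation belonging to `K`. -/
def quarterGroup (K : Subgroup G8) : Subgroup Isom3 where
  carrier := {g | g ∈ markedSymm ∧ ∃ π ∈ K, InducesPerm g π}
  mul_mem' := by
    rintro g h ⟨hg, π, hπ, hgπ⟩ ⟨hh, ρ, hρ, hhρ⟩
    exact ⟨mul_mem hg hh, π * ρ, mul_mem hπ hρ, hgπ.mul hhρ⟩
  one_mem' := ⟨one_mem _, 1, one_mem _, InducesPerm.one⟩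
  inv_mem' := by
    rintro g ⟨hg, π, hπ, hgπ⟩
    exact ⟨inv_mem hg, π⁻¹, inv_mem hπ, hgπ.inv⟩

/-! ### The dihedral group and odd subgroups -/

/-- The dihedral group of order `8` of permutations of `{0, 1, 2, 3}` generated by the four-cycle
`(0 1 2 3)` and the transposition `(1 3)`. -/
def dihedralPerms : Subgroup (Equiv.Perm (Fin 4)) :=
  Subgroup.closure {finRotate 4, Equiv.swap 1 3}

/-- The odd subgroup of a group of isometries: the subgroup generated by its elements of
order `3`. -/
noncomputable def oddSubgroup (G : Subgroup Isom3) : Subgroup Isom3 :=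
  Subgroup.closure {g | g ∈ G ∧ orderOf g = 3}

/-! The invariant behind the classification is the odd subgroup T of an irreducible space group G.
Conjugation by an affine bijection preserves orders, so it carries odd subgroups to odd subgroups,
and G normalizes its own T. Up to affine equivalence only T₁ and T₂ occur. Hence G lies between some
T_i and its normalizer N_i and amounts to a subgroup of the finite quotient N_i/T_i
(`exists_eq_liftGroup`). Conversely, an affine bijection matching two such groups carries T_i to
itself. It is a similarity because the linear parts of T_i contain the tetrahedral rotations
(`norm_sq_of_tetrahedral`), and an isometry because it respects the shortest translations
(`exists_isom_of_affineConj`); so it lies in N_i, and affine equivalence becomes conjugacy in the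
quotient. The two families are disjoint since T₁ contains half-turns and T₂ has no involution.

The explicit groups are handled in doubled coordinates. A symmetry of the bcc lattice is a signed
permutation of the coordinates followed by a lattice translation. It acts on the cosets by k ↦ ± k +
c, where ± is the product of the signs and c the doubled coordinate sum modulo 4 of the translation;
the parity of the coordinate permutation makes the sign of the cells independent of this. The marked
directions depend only on doubled coordinates modulo 4, so the marked symmetries come from finite
checks (`mem_markedSymm_iff`). Elements of order 3 die in the quotients, which are 2-groups, and the
kernels are generated by such elements; this identifies the T_i.

For completeness, Bieberbach's commutator argument (`near_fixed`) shows that an irreducible space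
group has a finite group of linear parts and a full translation lattice, whence integral traces. Up
to sign the linear parts form a finite rotation group without invariant line; integrality of the
traces yields an element of order 3, then two such elements whose product is a half-turn, that is,
the tetrahedral rotations in an orthonormal frame (`exists_frame`). After rescaling, the
translations lie between 2ℤ³ and ℤ³, contain no unit vector and are invariant under cyclic shifts:
the lattice is primitive, body-centred or face-centred. A suitable origin puts `rho` and either
`delta` or `screw` into the group (`exists_delta_or_screw`), so it contains T₁, possibly after
halving, or T₂; `le_of_oddSubgroup_le` then bounds it by the normalizer.

The conjugacy classes of subgroups are counted by encoding subsets of a numbered group as binary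
numbers and checking that a given list contains all subgroups. -/

/-! ### Signed permutations of the coordinates and translations -/

/-- The isometry whose linear part is the signed permutation of the coordinates given by `s`
and `e`, and which carries the origin to `t`. -/
noncomputable def sgnIso (s : Equiv.Perm (Fin 3)) (e : Fin 3 → ℤˣ) (t : E3) : Isom3 :=
  AffineIsometryEquiv.constVAdd ℝ E3 t *
   (LinearIsometryEquiv.toAffineIsometryEquiv
    ({ toFun := fun p : E3 => (WithLp.toLp 2 fun i => ((e i : ℤ) : ℝ) * p (s i) : E3)
       invFun := fun p : E3 => (WithLp.toLp 2 fun i =>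
          ((e (s.symm i) : ℤ) : ℝ) * p (s.symm i) : E3)
       map_add' := fun p q => by ext i; simp [mul_add]
       map_smul' := fun c p => by ext i; simp [mul_left_comm]
       left_inv := fun p => by ext i; simp [← mul_assoc, ← Int.cast_mul, ← Units.val_mul]
       right_inv := fun p => by ext i; simp [← mul_assoc, ← Int.cast_mul, ← Units.val_mul]
       norm_map' := fun p => by
        rw [EuclideanSpace.norm_eq, EuclideanSpace.norm_eq,
          ← Equiv.sum_comp s (fun i => ‖p i‖ ^ 2)]
        congr 1
        refine Finset.sum_congr rfl fun i _ => ?_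
        rcases Int.units_eq_one_or (e i) with h | h <;> simp [h] } : E3 ≃ₗᵢ[ℝ] E3))

theorem sgnIso_apply (s : Equiv.Perm (Fin 3)) (e : Fin 3 → ℤˣ) (t p : E3) (i : Fin 3) :
    sgnIso s e t p i = ((e i : ℤ) : ℝ) * p (s i) + t i := by
  simp [sgnIso, add_comm]

theorem isom_apply (g : Isom3) (p : E3) : g p = g.linearIsometryEquiv p + g 0 := by
  simpa using g.map_vadd 0 p

theorem linear_apply (g : Isom3) (p : E3) : g.linearIsometryEquiv p = g p - g 0 := by
  rw [isom_apply]; simp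

theorem sgnIso_zero (s : Equiv.Perm (Fin 3)) (e : Fin 3 → ℤˣ) (t : E3) :
    sgnIso s e t 0 = t := by
  ext i; simp [sgnIso_apply]

theorem sgnIso_linear (s : Equiv.Perm (Fin 3)) (e : Fin 3 → ℤˣ) (t p : E3) (i : Fin 3) :
    (sgnIso s e t).linearIsometryEquiv p i = ((e i : ℤ) : ℝ) * p (s i) := by
  rw [linear_apply, sgnIso_zero]; simp [sgnIso_apply]

theorem linear_mul (g h : Isom3) :
    (g * h).linearIsometryEquiv = g.linearIsometryEquiv * h.linearIsometryEquiv := rfl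

theorem linear_inv (g : Isom3) : (g⁻¹).linearIsometryEquiv = g.linearIsometryEquiv⁻¹ := rfl

theorem isom_mul_apply (g h : Isom3) (p : E3) : (g * h) p = g (h p) := rfl

theorem isom_inv_apply_self (g : Isom3) (p : E3) : g⁻¹ (g p) = p := g.symm_apply_apply p

theorem isom_apply_inv_self (g : Isom3) (p : E3) : g (g⁻¹ p) = p := g.apply_symm_apply p

/-- The translation by `t`. -/
noncomputable def transl (t : E3) : Isom3 := AffineIsometryEquiv.constVAdd ℝ E3 t

theorem transl_apply (t p : E3) : transl t p = t + p := rfl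

theorem transl_linear (t p : E3) : (transl t).linearIsometryEquiv p = p := by
  simp [linear_apply, transl_apply]

theorem transl_eq_sgnIso (t : E3) : transl t = sgnIso 1 1 t := by
  ext p i; simp [transl_apply, sgnIso_apply, add_comm]

theorem transl_mul (t u : E3) : transl t * transl u = transl (t + u) := by
  ext p i; simp [isom_mul_apply, transl_apply, add_assoc]

theorem transl_zero : transl 0 = 1 := by
  ext p i; simp [transl_apply]

theorem transl_inv (t : E3) : (transl t)⁻¹ = transl (-t) := by
  rw [inv_eq_iff_mul_eq_one, transl_mul]; simp [transl_zero]

theorem conj_transl (g : Isom3) (t : E3) :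
    g * transl t * g⁻¹ = transl (g.linearIsometryEquiv t) := by
  rw [mul_inv_eq_iff_eq_mul]
  ext p : 1
  rw [isom_mul_apply, isom_mul_apply, transl_apply, transl_apply, isom_apply g (t + p), map_add,
    isom_apply g p, add_assoc]

theorem transl_mul_sgnIso (u : E3) (s : Equiv.Perm (Fin 3)) (e : Fin 3 → ℤˣ) (t : E3) :
    transl u * sgnIso s e t = sgnIso s e (u + t) := by
  ext p i; simp [isom_mul_apply, transl_apply, sgnIso_apply]; ring

theorem sgnIso_mul (s s' : Equiv.Perm (Fin 3)) (e e' : Fin 3 → ℤˣ) (t t' : E3) :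
    sgnIso s e t * sgnIso s' e' t' =
      sgnIso (s' * s) (fun i => e i * e' (s i)) (sgnIso s e t t') := by
  ext p i
  simp only [isom_mul_apply, sgnIso_apply, Equiv.Perm.mul_apply, Units.val_mul, Int.cast_mul]
  ring

theorem linear_ext {g h : Isom3} (h0 : g 0 = h 0)
    (hl : ∀ j, g.linearIsometryEquiv (EuclideanSpace.single j 1) =
      h.linearIsometryEquiv (EuclideanSpace.single j 1)) : g = h := by
  ext p : 1
  rw [isom_apply g, isom_apply h, h0]
  congr 1
  have : g.linearIsometryEquiv.toLinearEquiv.toLinearMap =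
      h.linearIsometryEquiv.toLinearEquiv.toLinearMap :=
    (EuclideanSpace.basisFun (Fin 3) ℝ).toBasis.ext fun j => by simpa using hl j
  exact congrArg (fun f : E3 →ₗ[ℝ] E3 => f p) this

theorem eq_transl_of_linear {g : Isom3} (h : ∀ p, g.linearIsometryEquiv p = p) :
    g = transl (g 0) := by
  ext p : 1
  rw [isom_apply, h, transl_apply, add_comm]

/-- An isometry whose linear part carries the basis vectors to basis vectors up to sign is given
by a signed permutation of the coordinates. -/
theorem exists_sgnIso_of_basis (g : Isom3)
    (h : ∀ j, ∃ i, ∃ e : ℤˣ, g.linearIsometryEquiv (EuclideanSpace.single j 1) =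
      ((e : ℤ) : ℝ) • EuclideanSpace.single i (1 : ℝ)) :
    ∃ s e, g = sgnIso s e (g 0) := by
  choose f e hf using h
  -- Orthogonal basis vectors have orthogonal images, so two of them cannot land on the same
  -- coordinate axis.
  have hinj : Function.Injective f := by
    intro j k hjk
    by_contra hne
    have h1 := g.linearIsometryEquiv.inner_map_map (EuclideanSpace.single j 1)
      (EuclideanSpace.single k (1 : ℝ))
    rw [hf, hf, hjk] at h1
    rcases Int.units_eq_one_or (e j) with hj | hj <;>
      rcases Int.units_eq_one_or (e k) with hk | hk <;>
        simp [hj, hk, EuclideanSpace.inner_single_left, hne] at h1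
  let τ : Equiv.Perm (Fin 3) := Equiv.ofBijective f (Finite.injective_iff_bijective.1 hinj)
  refine ⟨τ.symm, fun i => e (τ.symm i), linear_ext (by rw [sgnIso_zero]) fun j => ?_⟩
  rw [hf]
  ext i
  rw [sgnIso_linear]
  by_cases hij : i = f j
  · subst hij
    have : τ.symm (f j) = j := τ.symm_apply_apply j
    simp [this]
  · have : τ.symm i ≠ j := fun h => hij (by rw [← h]; exact (τ.apply_symm_apply i).symm)
    simp [this, hij]

/-! ### Half-integral coordinates -/

/-- The point with halfPt-integral coordinates `P i / 2`. -/
noncomputable def halfPt (P : Fin 3 → ℤ) : E3 := WithLp.toLp 2 fun i => (P i : ℝ) / 2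

@[simp] theorem halfPt_apply (P : Fin 3 → ℤ) (i : Fin 3) : halfPt P i = (P i : ℝ) / 2 := rfl

theorem halfPt_injective : Function.Injective halfPt := fun P Q h => by
  funext i
  have := congrArg (fun p : E3 => p i) h
  simp only [halfPt_apply] at this
  exact_mod_cast (div_left_inj' (two_ne_zero)).1 this

theorem halfPt_add (P Q : Fin 3 → ℤ) : halfPt P + halfPt Q = halfPt (P + Q) := by
  ext i; simp [add_div]

theorem halfPt_sub (P Q : Fin 3 → ℤ) : halfPt P - halfPt Q = halfPt (P - Q) := by
  ext i; simp [sub_div]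

/-- All coordinates have the same parity. -/
def SamePar (P : Fin 3 → ℤ) : Prop := (P 0 - P 1) % 2 = 0 ∧ (P 1 - P 2) % 2 = 0

theorem SamePar.add {P Q : Fin 3 → ℤ} (hP : SamePar P) (hQ : SamePar Q) : SamePar (P + Q) := by
  unfold SamePar at *; simp only [Pi.add_apply]; lia

theorem SamePar.sub {P Q : Fin 3 → ℤ} (hP : SamePar P) (hQ : SamePar Q) : SamePar (P - Q) := by
  unfold SamePar at *; simp only [Pi.sub_apply]; lia

theorem samePar_iff (P : Fin 3 → ℤ) : SamePar P ↔ ∀ i j, (P i - P j) % 2 = 0 := by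
  simp only [SamePar, Fin.forall_fin_succ, Fin.isValue]
  simp
  lia

theorem isIntPoint_halfPt_iff (P : Fin 3 → ℤ) : IsIntPoint (halfPt P) ↔ ∀ i, P i % 2 = 0 := by
  refine forall_congr' fun i => ⟨?_, fun h => ?_⟩
  · rintro ⟨n, hn⟩
    rw [halfPt_apply] at hn
    have h1 : (P i : ℝ) = n * 2 := by linarith
    have : P i = n * 2 := by exact_mod_cast h1
    lia
  · obtain ⟨k, hk⟩ : ∃ k, P i = 2 * k := ⟨P i / 2, by lia⟩
    exact ⟨k, by rw [halfPt_apply, hk]; push_cast; ring⟩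

theorem isHalfPoint_halfPt_iff (P : Fin 3 → ℤ) : IsHalfPoint (halfPt P) ↔ ∀ i, P i % 2 = 1 := by
  refine forall_congr' fun i => ⟨?_, fun h => ?_⟩
  · rintro ⟨n, hn⟩
    rw [halfPt_apply] at hn
    have h1 : (P i : ℝ) - 1 = n * 2 := by linarith
    have : P i - 1 = n * 2 := by exact_mod_cast h1
    lia
  · obtain ⟨k, hk⟩ : ∃ k, P i = 2 * k + 1 := ⟨P i / 2, by lia⟩
    exact ⟨k, by rw [halfPt_apply, hk]; push_cast; ring⟩

theorem halfPt_mem_bcc_iff (P : Fin 3 → ℤ) : halfPt P ∈ bcc ↔ SamePar P := by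
  change IsIntPoint _ ∨ IsHalfPoint _ ↔ _
  rw [isIntPoint_halfPt_iff, isHalfPoint_halfPt_iff]
  simp only [SamePar, Fin.forall_fin_succ, Fin.isValue]
  simp
  lia

theorem mem_bcc_iff (p : E3) : p ∈ bcc ↔ ∃ P, SamePar P ∧ p = halfPt P := by
  constructor
  · intro h
    have : ∃ P, p = halfPt P := by
      rcases h with h | h
      · choose P hP using h
        exact ⟨fun i => 2 * P i, by ext i; simp [hP]⟩
      · choose P hP using h
        refine ⟨fun i => 2 * P i + 1, ?_⟩
        ext i; have := hP i; simp only [halfPt_apply]; push_cast; linarith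
    obtain ⟨P, rfl⟩ := this
    exact ⟨P, (halfPt_mem_bcc_iff P).1 h, rfl⟩
  · rintro ⟨P, hP, rfl⟩
    exact (halfPt_mem_bcc_iff P).2 hP

theorem congTwo_halfPt_iff (P : Fin 3 → ℤ) (i j : Fin 3) :
    CongTwo (halfPt P i) (halfPt P j) ↔ (P i - P j) % 4 = 0 := by
  constructor
  · rintro ⟨n, hn⟩
    rw [halfPt_apply, halfPt_apply, ← sub_div, div_eq_iff two_ne_zero] at hn
    have : P i - P j = 2 * n * 2 := by exact_mod_cast hn
    lia
  · intro h
    obtain ⟨k, hk⟩ : ∃ k, P i = P j + 4 * k := ⟨(P i - P j) / 4, by lia⟩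
    exact ⟨k, by rw [halfPt_apply, halfPt_apply, hk]; push_cast; ring⟩

/-- Signed permutations of integer vectors. -/
def sgnVec (s : Equiv.Perm (Fin 3)) (e : Fin 3 → ℤˣ) (P : Fin 3 → ℤ) : Fin 3 → ℤ :=
  fun i => e i * P (s i)

theorem sgnIso_halfPt (s : Equiv.Perm (Fin 3)) (e : Fin 3 → ℤˣ) (T P : Fin 3 → ℤ) :
    sgnIso s e (halfPt T) (halfPt P) = halfPt (sgnVec s e P + T) := by
  ext i
  simp only [sgnIso_apply, halfPt_apply, sgnVec, Pi.add_apply]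
  push_cast
  ring

theorem SamePar.signedPerm {P : Fin 3 → ℤ} (hP : SamePar P) (s : Equiv.Perm (Fin 3))
    (e : Fin 3 → ℤˣ) : SamePar (sgnVec s e P) := by
  rw [samePar_iff] at *
  intro i j
  have h := hP (s i) (s j)
  unfold sgnVec
  rcases Int.units_eq_one_or (e i) with h1 | h1 <;>
    rcases Int.units_eq_one_or (e j) with h2 | h2 <;> rw [h1, h2] <;> push_cast <;> lia

/-! ### The symmetries of the bcc lattice -/

theorem norm_sq_eq (p : E3) : ‖p‖ ^ 2 = p 0 ^ 2 + p 1 ^ 2 + p 2 ^ 2 := by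
  rw [EuclideanSpace.norm_sq_eq, Fin.sum_univ_three]; simp

theorem exists_basis_of_int {P : Fin 3 → ℤ} {c : ℝ} {p : E3}
    (hp : ∀ i, p i = c * P i) (h : P 0 ^ 2 + P 1 ^ 2 + P 2 ^ 2 = 1) :
    ∃ i, ∃ e : ℤˣ, p = ((e : ℤ) : ℝ) • EuclideanSpace.single i c := by
  have hb : ∀ i, P i = -1 ∨ P i = 0 ∨ P i = 1 := by
    have : ∀ i, P i ^ 2 ≤ 1 := by
      intro i
      have := sq_nonneg (P 0)
      have := sq_nonneg (P 1)
      have := sq_nonneg (P 2)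
      fin_cases i <;> simp only [Fin.zero_eta, Fin.mk_one, Fin.reduceFinMk] <;> linarith
    intro i
    have h1 : P i ≤ 1 := by nlinarith [this i]
    have h2 : -1 ≤ P i := by nlinarith [this i]
    lia
  have key : ∀ i (e : ℤˣ), (∀ j, P j = if j = i then (e : ℤ) else 0) →
      p = ((e : ℤ) : ℝ) • EuclideanSpace.single i c := by
    intro i e he
    ext j
    rw [hp, he]
    by_cases hj : j = i <;> simp [hj, mul_comm]
  rcases hb 0 with h0 | h0 | h0 <;> rcases hb 1 with h1 | h1 | h1 <;>
    rcases hb 2 with h2 | h2 | h2 <;> simp only [h0, h1, h2] at h <;> norm_num at h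
  · exact ⟨0, -1, key _ _ fun j => by fin_cases j <;> simp [h0, h1, h2]⟩
  · exact ⟨1, -1, key _ _ fun j => by fin_cases j <;> simp [h0, h1, h2]⟩
  · exact ⟨2, -1, key _ _ fun j => by fin_cases j <;> simp [h0, h1, h2]⟩
  · exact ⟨2, 1, key _ _ fun j => by fin_cases j <;> simp [h0, h1, h2]⟩
  · exact ⟨1, 1, key _ _ fun j => by fin_cases j <;> simp [h0, h1, h2]⟩
  · exact ⟨0, 1, key _ _ fun j => by fin_cases j <;> simp [h0, h1, h2]⟩

/-- In doubled coordinates the squared norm is 4, while three odd squares have an odd sum; so the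
point is integral. This makes every linear part of a lattice symmetry a signed permutation. -/
theorem exists_basis_of_mem_bcc {p : E3} (hp : p ∈ bcc) (h : ‖p‖ = 1) :
    ∃ i, ∃ e : ℤˣ, p = ((e : ℤ) : ℝ) • EuclideanSpace.single i (1 : ℝ) := by
  obtain ⟨P, hP, rfl⟩ := (mem_bcc_iff p).1 hp
  have h1 := norm_sq_eq (halfPt P)
  rw [h] at h1
  simp only [halfPt_apply] at h1
  have h2 : P 0 ^ 2 + P 1 ^ 2 + P 2 ^ 2 = 4 := by
    have : (P 0 : ℝ) ^ 2 + P 1 ^ 2 + P 2 ^ 2 = 4 := by linarith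
    exact_mod_cast this
  obtain ⟨ha, hb⟩ := hP
  have h0 : P 0 % 2 = 0 := by
    by_contra hodd
    obtain ⟨a, ha'⟩ : ∃ a, P 0 = 2 * a + 1 := ⟨P 0 / 2, by lia⟩
    obtain ⟨b, hb'⟩ : ∃ a, P 1 = 2 * a + 1 := ⟨P 1 / 2, by lia⟩
    obtain ⟨c, hc'⟩ : ∃ a, P 2 = 2 * a + 1 := ⟨P 2 / 2, by lia⟩
    rw [ha', hb', hc'] at h2
    ring_nf at h2
    lia
  obtain ⟨a, ha'⟩ : ∃ a, P 0 = 2 * a := ⟨P 0 / 2, by lia⟩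
  obtain ⟨b, hb'⟩ : ∃ a, P 1 = 2 * a := ⟨P 1 / 2, by lia⟩
  obtain ⟨c, hc'⟩ : ∃ a, P 2 = 2 * a := ⟨P 2 / 2, by lia⟩
  refine exists_basis_of_int (P := ![a, b, c]) (fun i => ?_) ?_
  · fin_cases i <;> simp [ha', hb', hc']
  · simp only [ha', hb', hc'] at h2
    simp
    linarith

theorem sgnIso_mem_bccSymm (s : Equiv.Perm (Fin 3)) (e : Fin 3 → ℤˣ) {T : Fin 3 → ℤ}
    (hT : SamePar T) : sgnIso s e (halfPt T) ∈ bccSymm := by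
  have hsub : ∀ s e T, SamePar T → ∀ p ∈ bcc, sgnIso s e (halfPt T) p ∈ bcc := by
    intro s e T hT p hp
    obtain ⟨P, hP, rfl⟩ := (mem_bcc_iff p).1 hp
    rw [sgnIso_halfPt, halfPt_mem_bcc_iff]
    exact (hP.signedPerm s e).add hT
  refine Set.Subset.antisymm ?_ fun p hp => ?_
  · rintro _ ⟨p, hp, rfl⟩
    exact hsub s e T hT p hp
  · obtain ⟨P, hP, rfl⟩ := (mem_bcc_iff p).1 hp
    refine ⟨halfPt (sgnVec s.symm (fun i => e (s.symm i)) (P - T)), ?_, ?_⟩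
    · exact (halfPt_mem_bcc_iff _).2 ((hP.sub hT).signedPerm _ _)
    · rw [sgnIso_halfPt]
      congr 1
      funext i
      simp [sgnVec, ← mul_assoc, ← Units.val_mul]

theorem single_mem_bcc (j : Fin 3) : EuclideanSpace.single j (1 : ℝ) ∈ bcc := by
  refine Or.inl fun i => ⟨if i = j then 1 else 0, ?_⟩
  by_cases h : i = j <;> simp [h]

theorem bcc_sub {p q : E3} (hp : p ∈ bcc) (hq : q ∈ bcc) : p - q ∈ bcc := by
  obtain ⟨P, hP, rfl⟩ := (mem_bcc_iff p).1 hp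
  obtain ⟨Q, hQ, rfl⟩ := (mem_bcc_iff q).1 hq
  rw [halfPt_sub, halfPt_mem_bcc_iff]
  exact hP.sub hQ

theorem mem_bccSymm_iff (g : Isom3) :
    g ∈ bccSymm ↔ ∃ s e T, SamePar T ∧ g = sgnIso s e (halfPt T) := by
  constructor
  · intro h
    have hm : ∀ p ∈ bcc, g p ∈ bcc := fun p hp => by
      have h' : g '' bcc = bcc := h
      rw [← h']; exact ⟨p, hp, rfl⟩
    have h0 : (0 : E3) ∈ bcc := Or.inl fun i => ⟨0, by simp⟩
    obtain ⟨T, hT, h0T⟩ := (mem_bcc_iff _).1 (hm 0 h0)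
    obtain ⟨s, e, hse⟩ := exists_sgnIso_of_basis g fun j => by
      apply exists_basis_of_mem_bcc
      · rw [linear_apply]
        exact bcc_sub (hm _ (single_mem_bcc j)) (hm 0 h0)
      · rw [LinearIsometryEquiv.norm_map]; simp
    exact ⟨s, e, T, hT, by rw [← h0T]; exact hse⟩
  · rintro ⟨s, e, T, hT, rfl⟩
    exact sgnIso_mem_bccSymm s e hT

/-! ### The permutations of the cosets and the signs of the cells -/

/-- The affine permutation `k ↦ ± k + c` of the colours. -/
def dihPerm (E : ℤˣ) (c : ZMod 4) : Equiv.Perm (Fin 4) :=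
  ({ toFun := fun k => ((E : ℤ) : ZMod 4) * k + c
     invFun := fun k => ((E : ℤ) : ZMod 4) * (k - c)
     left_inv := by intro k; revert E c k; decide
     right_inv := by intro k; revert E c k; decide } : Equiv.Perm (ZMod 4))

theorem dihPerm_apply (E : ℤˣ) (c k : ZMod 4) :
    dihPerm E c k = ((E : ℤ) : ZMod 4) * k + c := rfl

/-- The sum of the coordinates modulo `4`. -/
def coordSum (P : Fin 3 → ℤ) : ZMod 4 := ((P 0 + P 1 + P 2 : ℤ) : ZMod 4)

theorem coordSum_add (P Q : Fin 3 → ℤ) : coordSum (P + Q) = coordSum P + coordSum Q := by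
  simp only [coordSum, Pi.add_apply]; push_cast; ring

/-- Equal parity is what makes this work: -a + b + c ≡ -(a + b + c) modulo 4 because b + c is even,
and likewise for two sign changes. -/
theorem SamePar.coordSum_sgnVec {P : Fin 3 → ℤ} (hP : SamePar P) (s : Equiv.Perm (Fin 3))
    (e : Fin 3 → ℤˣ) :
    coordSum (sgnVec s e P) = (((∏ i, e i : ℤˣ) : ℤ) : ZMod 4) * coordSum P := by
  have h1 : P 0 + P 1 + P 2 = P (s 0) + P (s 1) + P (s 2) := by
    rw [← Fin.sum_univ_three P, ← Fin.sum_univ_three (fun i => P (s i)), Equiv.sum_comp]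
  rw [samePar_iff] at hP
  have h2 := hP (s 0) (s 1)
  have h3 := hP (s 1) (s 2)
  unfold coordSum sgnVec
  rw [h1, Fin.prod_univ_three, ← Int.cast_mul, ZMod.intCast_eq_intCast_iff_dvd_sub]
  generalize P (s 0) = a at *
  generalize P (s 1) = b at *
  generalize P (s 2) = c at *
  rcases Int.units_eq_one_or (e 0) with h0 | h0 <;>
  rcases Int.units_eq_one_or (e 1) with h1 | h1 <;>
  rcases Int.units_eq_one_or (e 2) with h2 | h2 <;> rw [h0, h1, h2] <;>
    norm_num <;> lia

theorem halfPt_mem_bccCoset_iff (P : Fin 3 → ℤ) (k : ZMod 4) :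
    halfPt P ∈ bccCoset k ↔ SamePar P ∧ coordSum P = k := by
  change halfPt P ∈ bcc ∧ _ ↔ _
  rw [halfPt_mem_bcc_iff]
  refine and_congr_right fun _ => ?_
  have hk : k = ((k.val : ℤ) : ZMod 4) := by
    revert k; decide
  have e1 : CongTwo (halfPt P 0 + halfPt P 1 + halfPt P 2) ((k.val : ℝ) / 2) ↔
      ∃ n : ℤ, P 0 + P 1 + P 2 - (k.val : ℤ) = 4 * n := by
    refine exists_congr fun n => ?_
    simp only [halfPt_apply]
    constructor
    · intro h
      have : (P 0 : ℝ) + P 1 + P 2 - (k.val : ℝ) = 4 * n := by linarith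
      exact_mod_cast this
    · intro h
      have : (P 0 : ℝ) + P 1 + P 2 - (k.val : ℝ) = 4 * n := by exact_mod_cast h
      linarith
  have e2 : coordSum P = k ↔ ((k.val : ℤ) : ZMod 4) = ((P 0 + P 1 + P 2 : ℤ) : ZMod 4) := by
    rw [← hk, eq_comm]; rfl
  rw [e2, ZMod.intCast_eq_intCast_iff_dvd_sub]
  exact e1

theorem mem_bccCoset_iff (p : E3) (k : ZMod 4) :
    p ∈ bccCoset k ↔ ∃ P, SamePar P ∧ coordSum P = k ∧ p = halfPt P := by
  constructor
  · intro h
    obtain ⟨P, hP, rfl⟩ := (mem_bcc_iff p).1 h.1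
    exact ⟨P, hP, ((halfPt_mem_bccCoset_iff P k).1 h).2, rfl⟩
  · rintro ⟨P, hP, h, rfl⟩
    exact (halfPt_mem_bccCoset_iff P k).2 ⟨hP, h⟩

theorem sgnIso_inducesPerm (s : Equiv.Perm (Fin 3)) (e : Fin 3 → ℤˣ) {T : Fin 3 → ℤ}
    (hT : SamePar T) :
    InducesPerm (sgnIso s e (halfPt T)) (dihPerm (∏ i, e i) (coordSum T)) := by
  have key : ∀ P, SamePar P → coordSum (sgnVec s e P + T) =
      dihPerm (∏ i, e i) (coordSum T) (coordSum P) := by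
    intro P hP
    rw [coordSum_add, hP.coordSum_sgnVec, dihPerm_apply]
  intro k
  refine Set.Subset.antisymm ?_ fun p hp => ?_
  · rintro _ ⟨p, hp, rfl⟩
    obtain ⟨P, hP, hk, rfl⟩ := (mem_bccCoset_iff p k).1 hp
    rw [sgnIso_halfPt]
    refine (halfPt_mem_bccCoset_iff _ _).2 ?_
    exact ⟨(hP.signedPerm s e).add hT, by rw [key P hP, hk]⟩
  · have h1 : sgnIso s e (halfPt T) '' bcc = bcc := sgnIso_mem_bccSymm s e hT
    have h2 : p ∈ sgnIso s e (halfPt T) '' bcc := by rw [h1]; exact hp.1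
    obtain ⟨q, hq, rfl⟩ := h2
    obtain ⟨P, hP, rfl⟩ := (mem_bcc_iff q).1 hq
    refine ⟨halfPt P, ?_, rfl⟩
    refine (halfPt_mem_bccCoset_iff _ _).2 ⟨hP, ?_⟩
    rw [sgnIso_halfPt] at hp
    have hp2 := ((halfPt_mem_bccCoset_iff _ _).1 hp).2
    rw [key P hP] at hp2
    exact (dihPerm _ _).injective hp2

theorem exists_coordSum_eq (k : ZMod 4) : ∃ P, SamePar P ∧ coordSum P = k := by
  have : ∀ k : ZMod 4, ∃ P ∈ ([![0, 0, 0], ![1, -1, 1], ![2, 0, 0], ![1, 1, 1]] :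
      List (Fin 3 → ℤ)), ((P 0 - P 1) % 2 = 0 ∧ (P 1 - P 2) % 2 = 0) ∧
      ((P 0 + P 1 + P 2 : ℤ) : ZMod 4) = k := by decide
  obtain ⟨P, -, h⟩ := this k
  exact ⟨P, h⟩

theorem InducesPerm.unique {g : Isom3} {π ρ : Equiv.Perm (Fin 4)} (h : InducesPerm g π)
    (h' : InducesPerm g ρ) : π = ρ := by
  ext1 k
  have h1 : bccCoset (π k) = bccCoset (ρ k) := by rw [← h, ← h']
  obtain ⟨P, hP, hk⟩ := exists_coordSum_eq (π k)
  have h2 : halfPt P ∈ bccCoset (ρ k) := by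
    rw [← h1]; exact (halfPt_mem_bccCoset_iff _ _).2 ⟨hP, hk⟩
  exact hk.symm.trans ((halfPt_mem_bccCoset_iff _ _).1 h2).2

/-- The determinant whose sign is the sign of a labelled tetrahedron. -/
noncomputable def cellDet (v : Fin 4 → E3) : ℝ :=
  (Matrix.of fun i j : Fin 3 => v i.succ j - v 0 j).det

/-- The form with a column of ones treats the four vertices alike, so that relabelling them is a
permutation of rows. -/
theorem cellDet_eq (v : Fin 4 → E3) :
    cellDet v = (Matrix.of fun i j : Fin 4 => (![1, v i 0, v i 1, v i 2] : Fin 4 → ℝ) j).det := by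
  rw [cellDet, Matrix.det_fin_three, Matrix.det_succ_row_zero]
  simp [Fin.sum_univ_succ, Matrix.det_fin_three, Fin.succAbove]
  ring

theorem cellDet_perm (v : Fin 4 → E3) (π : Equiv.Perm (Fin 4)) :
    cellDet (fun k => v (π k)) = ((Equiv.Perm.sign π : ℤ) : ℝ) * cellDet v := by
  rw [cellDet_eq, cellDet_eq, ← Matrix.det_permute]
  rfl

theorem cellDet_sgnIso (s : Equiv.Perm (Fin 3)) (e : Fin 3 → ℤˣ) (t : E3) (v : Fin 4 → E3) :
    cellDet (fun k => sgnIso s e t (v k)) =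
      ((Equiv.Perm.sign s * ∏ i, e i : ℤˣ) : ℤ) * cellDet v := by
  have h : (Matrix.of fun i j : Fin 3 => sgnIso s e t (v i.succ) j - sgnIso s e t (v 0) j) =
      Matrix.of fun i j : Fin 3 => ((e j : ℤ) : ℝ) *
        (((Matrix.of fun i j : Fin 3 => v i.succ j - v 0 j).submatrix id s) i j) := by
    ext i j
    simp [sgnIso_apply]; ring
  rw [cellDet, h, Matrix.det_mul_row, Matrix.det_permute', cellDet]
  push_cast
  ring

theorem affineIndependent_iff_cellDet (v : Fin 4 → E3) :
    AffineIndependent ℝ v ↔ cellDet v ≠ 0 := by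
  rw [affineIndependent_iff_linearIndependent_vsub ℝ v 0,
    ← linearIndependent_equiv (finSuccAboveEquiv (0 : Fin 4)), cellDet, ← isUnit_iff_ne_zero,
    ← Matrix.isUnit_iff_isUnit_det, ← Matrix.linearIndependent_rows_iff_isUnit,
    ← LinearMap.linearIndependent_iff (WithLp.linearEquiv 2 ℝ (Fin 3 → ℝ)).toLinearMap
      (LinearEquiv.ker _)]
  rfl

theorem cellSign_of_cellDet {v w : Fin 4 → E3} (hv : cellDet v ≠ 0) (ε : ℤˣ)
    (h : cellDet w = ((ε : ℤ) : ℝ) * cellDet v) : cellSign w = ε * cellSign v := by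
  change (if 0 < cellDet w then (1 : ℤˣ) else -1) = ε * (if 0 < cellDet v then (1 : ℤˣ) else -1)
  rw [h]
  rcases Int.units_eq_one_or ε with rfl | rfl <;> rcases lt_or_gt_of_ne hv with h | h
  · simp
  · simp
  · simp [h, h.le]
  · simp [h, h.le]

/-- The handedness changes by the determinant of the linear part, `sign s * ∏ e`, and by the sign of
the permutation that relabels the vertices. -/
theorem sgnIso_inducesSigned (s : Equiv.Perm (Fin 3)) (e : Fin 3 → ℤˣ) {T : Fin 3 → ℤ}
    (hT : SamePar T) :
    InducesSigned (sgnIso s e (halfPt T)) (dihPerm (∏ i, e i) (coordSum T),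
      Equiv.Perm.sign s * (∏ i, e i) *
        Equiv.Perm.sign (dihPerm (∏ i, e i) (coordSum T))) := by
  refine ⟨sgnIso_inducesPerm s e hT, fun v hv => ?_⟩
  refine cellSign_of_cellDet ((affineIndependent_iff_cellDet v).1 hv.2.1) _ ?_
  rw [cellDet_perm (fun k => sgnIso s e (halfPt T) (v k)), cellDet_sgnIso]
  simp only [Equiv.Perm.sign_inv]
  push_cast
  ring

/-- Without a cell the sign condition in `InducesSigned` would be vacuous and the induced sign not
unique. -/
theorem exists_isDelaunayCell : ∃ v, IsDelaunayCell v := by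
  refine ⟨fun k => halfPt (![![0, 0, 0], ![1, 1, -1], ![2, 0, 0], ![1, 1, 1]] k), ?_, ?_,
    -- The circumcentre and circumradius of the tetrahedron with vertices (0,0,0), (1/2,1/2,-1/2),
    -- (1,0,0), (1/2,1/2,1/2).
    !₂[1 / 2, 1 / 4, 0], Real.sqrt (5 / 16), ?_, ?_⟩
  · intro k
    refine (halfPt_mem_bccCoset_iff _ _).2 ?_
    revert k
    change ∀ k : ZMod 4, _
    unfold SamePar coordSum
    decide
  · rw [affineIndependent_iff_cellDet, cellDet, Matrix.det_fin_three]
    simp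
    norm_num
  · intro k
    rw [EuclideanSpace.dist_eq, Fin.sum_univ_three]
    congr 1
    fin_cases k <;> simp [Real.dist_eq, sq_abs] <;> norm_num
  · intro p hp
    obtain ⟨P, ⟨ha, hb⟩, rfl⟩ := (mem_bcc_iff p).1 hp
    rw [EuclideanSpace.dist_eq, Fin.sum_univ_three]
    apply Real.sqrt_le_sqrt
    simp only [Real.dist_eq, sq_abs, halfPt_apply]
    simp
    -- The bound 5/16 splits as 1/16 from the middle coordinate and 1/4 from the first coordinate
    -- (integral points) or the last one (half-integral points).
    have h0 : ∀ n : ℤ, (1 : ℝ) / 16 ≤ ((n : ℝ) / 2 - 4⁻¹) ^ 2 := by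
      intro n
      have : n ≤ 0 ∨ 1 ≤ n := by lia
      rcases this with h | h
      · have : (n : ℝ) ≤ 0 := by exact_mod_cast h
        nlinarith
      · have : (1 : ℝ) ≤ n := by exact_mod_cast h
        nlinarith
    have h1 := h0 (P 1)
    have h2 : ∀ n : ℤ, n % 2 = 1 → (1 : ℝ) / 4 ≤ ((n : ℝ) / 2) ^ 2 := by
      intro n hn
      have : n ≤ -1 ∨ 1 ≤ n := by lia
      rcases this with h | h
      · have : (n : ℝ) ≤ -1 := by exact_mod_cast h
        nlinarith
      · have : (1 : ℝ) ≤ n := by exact_mod_cast h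
        nlinarith
    have h3 : ∀ n : ℤ, n % 2 = 0 → (1 : ℝ) / 4 ≤ ((n : ℝ) / 2 - 2⁻¹) ^ 2 := by
      intro n hn
      have := h2 (n - 1) (by lia)
      push_cast at this
      calc _ ≤ _ := this
        _ = _ := by ring
    rcases Int.emod_two_eq_zero_or_one (P 0) with h | h
    · have := h3 _ h
      nlinarith [sq_nonneg ((P 2 : ℝ) / 2)]
    · have := h2 (P 2) (by lia)
      nlinarith [sq_nonneg ((P 0 : ℝ) / 2 - 2⁻¹)]

theorem InducesSigned.unique {g : Isom3} {σ τ : SignedPerm} (h : InducesSigned g σ)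
    (h' : InducesSigned g τ) : σ = τ := by
  have h1 := h.1.unique h'.1
  obtain ⟨v, hv⟩ := exists_isDelaunayCell
  have h2 := h.2 v hv
  rw [h1, h'.2 v hv] at h2
  exact Prod.ext h1 (mul_right_cancel h2).symm

theorem bccSymm_existsUnique (g : Isom3) (hg : g ∈ bccSymm) :
    ∃! σ : SignedPerm, InducesSigned g σ := by
  obtain ⟨s, e, T, hT, rfl⟩ := (mem_bccSymm_iff g).1 hg
  exact ⟨_, sgnIso_inducesSigned s e hT, fun τ h => h.unique (sgnIso_inducesSigned s e hT)⟩

/-! ### The groups of induced permutations -/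

theorem dihPerm_eq_iff (π : Equiv.Perm (Fin 4)) (E : ℤˣ) (c : ZMod 4) :
    π = dihPerm E c ↔ ∀ k : ZMod 4, π k = ((E : ℤ) : ZMod 4) * k + c :=
  ⟨fun h k => by rw [h]; rfl, fun h => Equiv.ext h⟩

theorem dihPerm_mul (E : ℤˣ) (c : ZMod 4) (E' : ℤˣ) (c' : ZMod 4) :
    dihPerm E c * dihPerm E' c' = dihPerm (E * E') (((E : ℤ) : ZMod 4) * c' + c) := by
  rw [dihPerm_eq_iff]
  intro k
  change ((E : ℤ) : ZMod 4) * (((E' : ℤ) : ZMod 4) * k + c') + c = _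
  push_cast
  ring

theorem dihPerm_one_zero : dihPerm 1 0 = 1 := by
  symm
  rw [dihPerm_eq_iff]
  intro k
  change k = _
  simp

theorem dihPerm_injective {E : ℤˣ} {c : ZMod 4} {E' : ℤˣ} {c' : ZMod 4}
    (h : dihPerm E c = dihPerm E' c') : E = E' ∧ c = c' := by
  have h1 : ∀ k : ZMod 4, ((E : ℤ) : ZMod 4) * k + c = ((E' : ℤ) : ZMod 4) * k + c' :=
    (dihPerm_eq_iff _ _ _).1 h
  have h2 := h1 0
  have h3 := h1 1
  revert h2 h3 E E' c c'
  decide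

theorem dihPerm_one_pow (n : ℕ) : dihPerm 1 1 ^ n = dihPerm 1 n := by
  induction n with
  | zero => simp [dihPerm_one_zero]
  | succ n ih => rw [pow_succ, ih, dihPerm_mul]; simp [add_comm]

theorem finRotate_eq_dihPerm : finRotate 4 = dihPerm 1 1 := by
  rw [dihPerm_eq_iff]
  change ∀ k : Fin 4, _
  decide

theorem swap_eq_dihPerm : Equiv.swap 1 3 = dihPerm (-1) 0 := by
  rw [dihPerm_eq_iff]
  change ∀ k : Fin 4, _
  decide

theorem mem_dihedralPerms_iff (π : Equiv.Perm (Fin 4)) :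
    π ∈ dihedralPerms ↔ ∃ E c, π = dihPerm E c := by
  constructor
  · intro h
    induction h using Subgroup.closure_induction with
    | mem x hx =>
      rcases hx with rfl | rfl
      · exact ⟨1, 1, finRotate_eq_dihPerm⟩
      · exact ⟨-1, 0, swap_eq_dihPerm⟩
    | one => exact ⟨1, 0, dihPerm_one_zero.symm⟩
    | mul x y _ _ hx hy =>
      obtain ⟨E, c, rfl⟩ := hx
      obtain ⟨E', c', rfl⟩ := hy
      exact ⟨_, _, dihPerm_mul _ _ _ _⟩
    | inv x _ hx =>
      obtain ⟨E, c, rfl⟩ := hx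
      refine ⟨E, -(((E : ℤ) : ZMod 4) * c), ?_⟩
      rw [inv_eq_iff_mul_eq_one, dihPerm_mul, ← dihPerm_one_zero]
      congr 1
      · simp
      · clear * -
        revert E c; decide
  · rintro ⟨E, c, rfl⟩
    have hr : dihPerm 1 1 ∈ dihedralPerms :=
      Subgroup.subset_closure (by simp [finRotate_eq_dihPerm])
    have hs : dihPerm (-1) 0 ∈ dihedralPerms :=
      Subgroup.subset_closure (by simp [swap_eq_dihPerm])
    have hc : dihPerm 1 c ∈ dihedralPerms := by
      have := pow_mem hr c.val
      rwa [dihPerm_one_pow, ZMod.natCast_zmod_val] at this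
    rcases Int.units_eq_one_or E with rfl | rfl
    · exact hc
    · have := mul_mem hc hs
      rwa [dihPerm_mul, one_mul, mul_zero, zero_add] at this

/-- The four-cycle k ↦ k + 1 and the transposition k ↦ -k are both odd. -/
theorem sign_dihPerm (E : ℤˣ) (c : ZMod 4) :
    Equiv.Perm.sign (dihPerm E c) = E * (-1) ^ c.val := by
  have hc : Equiv.Perm.sign (dihPerm 1 c) = (-1) ^ c.val := by
    have h := dihPerm_one_pow c.val
    rw [ZMod.natCast_zmod_val] at h
    rw [← h, map_pow, ← finRotate_eq_dihPerm, sign_finRotate]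
    norm_num
  rcases Int.units_eq_one_or E with rfl | rfl
  · rw [hc, one_mul]
  · have : dihPerm (-1) c = dihPerm 1 c * dihPerm (-1) 0 := by rw [dihPerm_mul]; simp
    rw [this, map_mul, hc, ← swap_eq_dihPerm, Equiv.Perm.sign_swap (by decide), mul_comm]

/-- The permutation of the cosets depends only on the signs and the translation. The parity of `s`
stays free and can be adjusted to give either sign. -/
theorem mem_G16_iff (σ : SignedPerm) : σ ∈ G16 ↔ σ.1 ∈ dihedralPerms := by
  rw [mem_dihedralPerms_iff]
  constructor
  · rintro ⟨g, hg, h⟩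
    obtain ⟨s, e, T, hT, rfl⟩ := (mem_bccSymm_iff g).1 hg
    exact ⟨∏ i, e i, coordSum T, by rw [h.unique (sgnIso_inducesSigned s e hT)]⟩
  · rintro ⟨E, c, h⟩
    obtain ⟨T, hT, hc⟩ := exists_coordSum_eq c
    have h1 : ∀ ε : ℤˣ, ∃ s : Equiv.Perm (Fin 3), Equiv.Perm.sign s = ε := by decide
    obtain ⟨s, hs⟩ := h1 (σ.2 * (E * Equiv.Perm.sign (dihPerm E c)))
    have h2 := sgnIso_inducesSigned s ![E, 1, 1] hT
    refine ⟨_, sgnIso_mem_bccSymm s ![E, 1, 1] hT, ?_⟩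
    convert h2 using 1
    have hE : (∏ i, (![E, 1, 1] : Fin 3 → ℤˣ) i) = E := by simp [Fin.prod_univ_three]
    refine Prod.ext ?_ ?_
    · simp [h, hE, hc]
    · simp only [hE, hc, hs]
      rw [mul_assoc, mul_assoc, Int.units_mul_self, mul_one]

theorem G16_eq : G16 = dihedralPerms.prod ⊤ := by
  ext σ
  rw [mem_G16_iff, Subgroup.mem_prod]
  simp

/-! ### The marked lines -/

/-- The sign `(-1)^⌊n/2⌋` of a residue modulo `4`. -/
def resSign (n : ZMod 4) : ℤˣ := if n.val < 2 then 1 else -1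

/-- The signs of the coordinates of the marked direction at the point with the half-integral
coordinates `Q i / 2`. -/
def resDir (Q : Fin 3 → ZMod 4) (i : Fin 3) : ℤˣ :=
  if (Q 0).val % 2 = 0 then resSign (Q (i + 1)) else resSign (Q (i + 2))

/-- Reduction modulo `4`. -/
def res (P : Fin 3 → ℤ) : Fin 3 → ZMod 4 := fun i => (P i : ZMod 4)

/-- Parity condition on triples of residues modulo `4`. -/
abbrev ResPar (Q : Fin 3 → ZMod 4) : Prop :=
  (Q 0).val % 2 = (Q 1).val % 2 ∧ (Q 1).val % 2 = (Q 2).val % 2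

theorem zmod_four_val (n : ℤ) : (((n : ZMod 4).val : ℕ) : ℤ) = n % 4 := by
  rw [ZMod.val_intCast]; rfl

theorem SamePar.resPar {P : Fin 3 → ℤ} (hP : SamePar P) : ResPar (res P) := by
  have h0 := zmod_four_val (P 0)
  have h1 := zmod_four_val (P 1)
  have h2 := zmod_four_val (P 2)
  obtain ⟨ha, hb⟩ := hP
  unfold res
  constructor <;> lia

theorem res_even_iff (P : Fin 3 → ℤ) (i : Fin 3) : (res P i).val % 2 = 0 ↔ P i % 2 = 0 := by
  have h0 := zmod_four_val (P i)
  unfold res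
  lia

theorem res_odd_iff (P : Fin 3 → ℤ) (i : Fin 3) : (res P i).val % 2 = 1 ↔ P i % 2 = 1 := by
  have h0 := zmod_four_val (P i)
  unfold res
  lia

theorem congTwo_halfPt_iff_res (P : Fin 3 → ℤ) (i j : Fin 3) :
    CongTwo (halfPt P i) (halfPt P j) ↔ res P i = res P j := by
  rw [congTwo_halfPt_iff, res, res, eq_comm, ZMod.intCast_eq_intCast_iff_dvd_sub,
    Int.dvd_iff_emod_eq_zero]
  push_cast
  lia

/-- The vector with entries `± 1` given by signs. -/
noncomputable def signVec (d : Fin 3 → ℤˣ) : E3 := WithLp.toLp 2 fun i => ((d i : ℤ) : ℝ)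

@[simp] theorem signVec_apply (d : Fin 3 → ℤˣ) (i : Fin 3) : signVec d i = ((d i : ℤ) : ℝ) := rfl

/-- The rule for the signs of the marked direction; `ev` and `od` say whether the point is
integral or not, and `ab`, `bc`, `ca` which coordinates are congruent modulo `2`. -/
def DirRule (ev od ab bc ca : Prop) (δ : Fin 3 → ℤˣ) : Prop :=
  (ev ∧ ((ab ∧ bc ∧ δ = ![1, 1, 1]) ∨ (¬ bc ∧ ca ∧ δ = ![-1, 1, 1]) ∨
    (¬ ca ∧ ab ∧ δ = ![1, -1, 1]) ∨ (¬ ab ∧ bc ∧ δ = ![1, 1, -1]))) ∨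
  (od ∧ ((ab ∧ bc ∧ δ = ![1, 1, 1]) ∨ (¬ ca ∧ ab ∧ δ = ![-1, 1, 1]) ∨
    (¬ ab ∧ bc ∧ δ = ![1, -1, 1]) ∨ (¬ bc ∧ ca ∧ δ = ![1, 1, -1])))

instance (ev od ab bc ca : Prop) [Decidable ev] [Decidable od] [Decidable ab] [Decidable bc]
    [Decidable ca] (δ : Fin 3 → ℤˣ) : Decidable (DirRule ev od ab bc ca δ) := by
  unfold DirRule; infer_instance

theorem hasLineDirection_iff_dirRule (p d : E3) :
    HasLineDirection p d ↔ ∃ δ : Fin 3 → ℤˣ, d = signVec δ ∧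
      DirRule (IsIntPoint p) (IsHalfPoint p) (CongTwo (p 0) (p 1)) (CongTwo (p 1) (p 2))
        (CongTwo (p 2) (p 0)) δ := by
  have h0 : signVec ![1, 1, 1] = !₂[1, 1, 1] := by ext i; fin_cases i <;> simp
  have h1 : signVec ![-1, 1, 1] = !₂[-1, 1, 1] := by ext i; fin_cases i <;> simp
  have h2 : signVec ![1, -1, 1] = !₂[1, -1, 1] := by ext i; fin_cases i <;> simp
  have h3 : signVec ![1, 1, -1] = !₂[1, 1, -1] := by ext i; fin_cases i <;> simp
  unfold HasLineDirection DirRule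
  simp only [← h0, ← h1, ← h2, ← h3]
  constructor
  · rintro (⟨h, (⟨a, b, rfl⟩ | ⟨a, b, rfl⟩ | ⟨a, b, rfl⟩ | ⟨a, b, rfl⟩)⟩ |
      ⟨h, (⟨a, b, rfl⟩ | ⟨a, b, rfl⟩ | ⟨a, b, rfl⟩ | ⟨a, b, rfl⟩)⟩)
    · exact ⟨_, rfl, .inl ⟨h, .inl ⟨a, b, rfl⟩⟩⟩
    · exact ⟨_, rfl, .inl ⟨h, .inr (.inl ⟨a, b, rfl⟩)⟩⟩
    · exact ⟨_, rfl, .inl ⟨h, .inr (.inr (.inl ⟨a, b, rfl⟩))⟩⟩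
    · exact ⟨_, rfl, .inl ⟨h, .inr (.inr (.inr ⟨a, b, rfl⟩))⟩⟩
    · exact ⟨_, rfl, .inr ⟨h, .inl ⟨a, b, rfl⟩⟩⟩
    · exact ⟨_, rfl, .inr ⟨h, .inr (.inl ⟨a, b, rfl⟩)⟩⟩
    · exact ⟨_, rfl, .inr ⟨h, .inr (.inr (.inl ⟨a, b, rfl⟩))⟩⟩
    · exact ⟨_, rfl, .inr ⟨h, .inr (.inr (.inr ⟨a, b, rfl⟩))⟩⟩
  · rintro ⟨δ, rfl, (⟨h, (⟨a, b, rfl⟩ | ⟨a, b, rfl⟩ | ⟨a, b, rfl⟩ | ⟨a, b, rfl⟩)⟩ |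
      ⟨h, (⟨a, b, rfl⟩ | ⟨a, b, rfl⟩ | ⟨a, b, rfl⟩ | ⟨a, b, rfl⟩)⟩)⟩
    · exact .inl ⟨h, .inl ⟨a, b, rfl⟩⟩
    · exact .inl ⟨h, .inr (.inl ⟨a, b, rfl⟩)⟩
    · exact .inl ⟨h, .inr (.inr (.inl ⟨a, b, rfl⟩))⟩
    · exact .inl ⟨h, .inr (.inr (.inr ⟨a, b, rfl⟩))⟩
    · exact .inr ⟨h, .inl ⟨a, b, rfl⟩⟩
    · exact .inr ⟨h, .inr (.inl ⟨a, b, rfl⟩)⟩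
    · exact .inr ⟨h, .inr (.inr (.inl ⟨a, b, rfl⟩))⟩
    · exact .inr ⟨h, .inr (.inr (.inr ⟨a, b, rfl⟩))⟩

/-- The rule for the marked direction in terms of residues modulo `4`. -/
abbrev ResRule (Q : Fin 3 → ZMod 4) (δ : Fin 3 → ℤˣ) : Prop :=
  DirRule (∀ i, (Q i).val % 2 = 0) (∀ i, (Q i).val % 2 = 1) (Q 0 = Q 1) (Q 1 = Q 2) (Q 2 = Q 0) δ

theorem hasLineDirection_halfPt_iff (P : Fin 3 → ℤ) (d : E3) :
    HasLineDirection (halfPt P) d ↔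
      ∃ δ : Fin 3 → ℤˣ, d = signVec δ ∧ ResRule (res P) δ := by
  rw [hasLineDirection_iff_dirRule]
  simp only [ResRule, isIntPoint_halfPt_iff, isHalfPoint_halfPt_iff, congTwo_halfPt_iff_res,
    res_even_iff, res_odd_iff]

/-- The eight cases of the rule collapse into one formula, up to the common sign `ε`, which does not
affect the line. -/
theorem resDir_of_rule : ∀ (Q : Fin 3 → ZMod 4) (δ : Fin 3 → ℤˣ), ResRule Q δ →
    ∃ ε : ℤˣ, ∀ i, δ i = ε * resDir Q i := by
  decide +kernel

theorem exists_rule : ∀ Q : Fin 3 → ZMod 4, ResPar Q → ∃ δ : Fin 3 → ℤˣ, ResRule Q δ := by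
  decide +kernel

/-- The line through a point in a direction. -/
def lineThrough (p d : E3) : Set E3 := {q | ∃ t : ℝ, q = p + t • d}

theorem lineThrough_sign (p : E3) {d d' : Fin 3 → ℤˣ} {ε : ℤˣ} (h : ∀ i, d i = ε * d' i) :
    lineThrough p (signVec d) = lineThrough p (signVec d') := by
  have h1 : signVec d = ((ε : ℤ) : ℝ) • signVec d' := by ext i; simp [h]
  rw [h1]
  ext q
  rcases Int.units_eq_one_or ε with rfl | rfl
  · simp
  · constructor
    · rintro ⟨t, rfl⟩; exact ⟨-t, by simp⟩
    · rintro ⟨t, rfl⟩; exact ⟨-t, by simp⟩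

/-- The marked line through a lattice point. -/
noncomputable def markedLine (P : Fin 3 → ℤ) : Set E3 :=
  lineThrough (halfPt P) (signVec (resDir (res P)))

theorem mem_markedLines_iff (ℓ : Set E3) :
    ℓ ∈ markedLines ↔ ∃ P, SamePar P ∧ ℓ = markedLine P := by
  constructor
  · rintro ⟨p, d, h, rfl⟩
    have hp : p ∈ bcc := h.imp And.left And.left
    obtain ⟨P, hP, rfl⟩ := (mem_bcc_iff p).1 hp
    obtain ⟨δ, rfl, hδ⟩ := (hasLineDirection_halfPt_iff P d).1 h
    obtain ⟨ε, hε⟩ := resDir_of_rule _ _ hδ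
    exact ⟨P, hP, lineThrough_sign _ hε⟩
  · rintro ⟨P, hP, rfl⟩
    obtain ⟨δ, hδ⟩ := exists_rule _ hP.resPar
    obtain ⟨ε, hε⟩ := resDir_of_rule _ _ hδ
    exact ⟨halfPt P, signVec δ, (hasLineDirection_halfPt_iff P _).2 ⟨δ, rfl, hδ⟩,
      (lineThrough_sign _ hε).symm⟩

/-- The marking is consistent: all lattice points on a marked line, which follow each other in steps
of half the direction vector, determine the same line. -/
theorem resDir_along_line : ∀ Q : Fin 3 → ZMod 4, ResPar Q → ∀ n : ZMod 4, ∃ ε : ℤˣ,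
    ∀ i, resDir Q i = ε * resDir (fun j => Q j + n * ((resDir Q j : ℤ) : ZMod 4)) i := by
  decide +kernel

/-- Signed permutations of triples of residues. -/
def sgnRes (s : Equiv.Perm (Fin 3)) (e : Fin 3 → ℤˣ) (Q T : Fin 3 → ZMod 4) : Fin 3 → ZMod 4 :=
  fun i => ((e i : ℤ) : ZMod 4) * Q (s i) + T i

theorem res_sgnVec_add (s : Equiv.Perm (Fin 3)) (e : Fin 3 → ℤˣ) (P T : Fin 3 → ℤ) :
    res (sgnVec s e P + T) = sgnRes s e (res P) (res T) := by
  funext i; simp [res, sgnRes, sgnVec]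

/-- The signed permutation followed by the translation by `T` respects the marked directions. -/
abbrev RespectsDir (s : Equiv.Perm (Fin 3)) (e : Fin 3 → ℤˣ) (T : Fin 3 → ZMod 4) : Prop :=
  ∀ Q, ResPar Q → ∃ ε : ℤˣ, ∀ i, e i * resDir Q (s i) = ε * resDir (sgnRes s e Q T) i

theorem sgnIso_image_line (s : Equiv.Perm (Fin 3)) (e : Fin 3 → ℤˣ) (T P : Fin 3 → ℤ)
    (d : Fin 3 → ℤˣ) :
    sgnIso s e (halfPt T) '' lineThrough (halfPt P) (signVec d) =
      lineThrough (halfPt (sgnVec s e P + T)) (signVec fun i => e i * d (s i)) := by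
  have key : ∀ t : ℝ, sgnIso s e (halfPt T) (halfPt P + t • signVec d) =
      halfPt (sgnVec s e P + T) + t • signVec fun i => e i * d (s i) := by
    intro t
    rw [← sgnIso_halfPt]
    ext i
    simp [sgnIso_apply]
    ring
  ext q
  constructor
  · rintro ⟨_, ⟨t, rfl⟩, rfl⟩; exact ⟨t, key t⟩
  · rintro ⟨t, rfl⟩; exact ⟨_, ⟨t, rfl⟩, key t⟩

theorem exists_int_lift (Q : Fin 3 → ZMod 4) (hQ : ResPar Q) : ∃ P, SamePar P ∧ res P = Q := by
  refine ⟨fun i => (Q i).val, ?_, ?_⟩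
  · unfold SamePar; unfold ResPar at hQ; lia
  · funext i; simp [res]

theorem markedLine_eq_of_mem {P Q : Fin 3 → ℤ} (hQ : SamePar Q)
    (h : halfPt P ∈ markedLine Q) :
    markedLine Q = lineThrough (halfPt P) (signVec (resDir (res Q))) ∧
      ∃ ε : ℤˣ, ∀ i, resDir (res Q) i = ε * resDir (res P) i := by
  obtain ⟨t, ht⟩ := h
  refine ⟨?_, ?_⟩
  · rw [ht]
    ext q
    constructor
    · rintro ⟨u, rfl⟩; exact ⟨u - t, by rw [add_assoc, ← add_smul]; simp⟩
    · rintro ⟨u, rfl⟩; exact ⟨t + u, by rw [add_smul, add_assoc]⟩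
  · have h0 : ∀ i, (P i : ℝ) = Q i + 2 * t * ((resDir (res Q) i : ℤ) : ℝ) := by
      intro i
      have := congrArg (fun p : E3 => p i) ht
      simp at this
      linarith
    -- The entries of the direction are ± 1, so 2t is up to sign a difference of doubled
    -- coordinates.
    obtain ⟨n, hn⟩ : ∃ n : ℤ, 2 * t = n := by
      have h1 := h0 0
      rcases Int.units_eq_one_or (resDir (res Q) 0) with h | h <;> rw [h] at h1
      · exact ⟨P 0 - Q 0, by push_cast at h1 ⊢; linarith⟩
      · exact ⟨Q 0 - P 0, by push_cast at h1 ⊢; linarith⟩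
    have h2 : ∀ i, P i = Q i + n * (resDir (res Q) i : ℤ) := by
      intro i
      have := h0 i
      rw [hn] at this
      exact_mod_cast this
    have h3 : res P = fun j => res Q j + (n : ZMod 4) * ((resDir (res Q) j : ℤ) : ZMod 4) := by
      funext j
      simp only [res]
      rw [h2]
      push_cast
      rfl
    rw [h3]
    exact resDir_along_line _ hQ.resPar _

/-- By consistency along lines, permuting the marked lines means carrying the marked direction at
each lattice point to the one at its image. That depends only on residues modulo 4, so it is
decidable. -/
theorem mem_markedSymm_iff_respectsDir (s : Equiv.Perm (Fin 3)) (e : Fin 3 → ℤˣ)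
    {T : Fin 3 → ℤ} (hT : SamePar T) :
    sgnIso s e (halfPt T) ∈ markedSymm ↔ RespectsDir s e (res T) := by
  constructor
  · rintro ⟨-, h⟩ Q hQ
    obtain ⟨P, hP, rfl⟩ := exists_int_lift Q hQ
    have h1 : sgnIso s e (halfPt T) '' markedLine P ∈ markedLines := by
      rw [← h]; exact ⟨_, (mem_markedLines_iff _).2 ⟨P, hP, rfl⟩, rfl⟩
    obtain ⟨R, hR, hPR⟩ := (mem_markedLines_iff _).1 h1
    rw [markedLine, sgnIso_image_line] at hPR
    have h2 : halfPt (sgnVec s e P + T) ∈ markedLine R := by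
      rw [← hPR]; exact ⟨0, by simp⟩
    obtain ⟨h3, ε, hε⟩ := markedLine_eq_of_mem hR h2
    rw [h3] at hPR
    have h4 : halfPt (sgnVec s e P + T) + signVec (fun i => e i * resDir (res P) (s i)) ∈
        lineThrough (halfPt (sgnVec s e P + T)) (signVec (resDir (res R))) := by
      rw [← hPR]; exact ⟨1, by simp⟩
    obtain ⟨u, hu⟩ := h4
    have h5 := add_left_cancel hu
    have h6 : ∀ i, (((e i * resDir (res P) (s i) : ℤˣ) : ℤ) : ℝ) =
        u * ((resDir (res R) i : ℤ) : ℝ) := fun i => by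
      have := congrArg (fun p : E3 => p i) h5
      simpa using this
    obtain ⟨ε', hε'⟩ : ∃ ε' : ℤˣ, u = ((ε' : ℤ) : ℝ) := by
      have h7 := h6 0
      rcases Int.units_eq_one_or (e 0 * resDir (res P) (s 0)) with h | h <;>
        rcases Int.units_eq_one_or (resDir (res R) 0) with h' | h' <;>
        rw [h, h'] at h7 <;> push_cast at h7
      · exact ⟨1, by push_cast; linarith⟩
      · exact ⟨-1, by push_cast; linarith⟩
      · exact ⟨-1, by push_cast; linarith⟩
      · exact ⟨1, by push_cast; linarith⟩
    refine ⟨ε' * ε, fun i => ?_⟩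
    have h8 := h6 i
    rw [hε'] at h8
    have h9 : e i * resDir (res P) (s i) = ε' * resDir (res R) i := by
      ext; push_cast; exact_mod_cast h8
    rw [h9, hε, res_sgnVec_add, mul_assoc]
  · intro h
    have h1 : ∀ P, SamePar P → sgnIso s e (halfPt T) '' markedLine P =
        markedLine (sgnVec s e P + T) := by
      intro P hP
      obtain ⟨ε, hε⟩ := h (res P) hP.resPar
      rw [markedLine, sgnIso_image_line, markedLine]
      exact lineThrough_sign _ fun i => by rw [hε, res_sgnVec_add]
    have hb := sgnIso_mem_bccSymm s e hT
    refine ⟨hb, Set.Subset.antisymm ?_ fun ℓ hℓ => ?_⟩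
    · rintro _ ⟨ℓ, hℓ, rfl⟩
      obtain ⟨P, hP, rfl⟩ := (mem_markedLines_iff _).1 hℓ
      exact (mem_markedLines_iff _).2 ⟨_, (hP.signedPerm s e).add hT, h1 P hP⟩
    · obtain ⟨Q, hQ, rfl⟩ := (mem_markedLines_iff _).1 hℓ
      have hb' : sgnIso s e (halfPt T) '' bcc = bcc := hb
      have hq := (halfPt_mem_bcc_iff Q).2 hQ
      rw [← hb'] at hq
      obtain ⟨p, hp, hpq⟩ := hq
      obtain ⟨P, hP, rfl⟩ := (mem_bcc_iff p).1 hp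
      rw [sgnIso_halfPt] at hpq
      refine ⟨markedLine P, (mem_markedLines_iff _).2 ⟨P, hP, rfl⟩, ?_⟩
      change _ '' _ = _
      rw [h1 P hP, halfPt_injective hpq]

/-- The (doubled) translation part of a symmetry of the marked lattice with given linear part. -/
def shift (s : Equiv.Perm (Fin 3)) (e : Fin 3 → ℤˣ) : Fin 3 → ℤ :=
  fun i => (if Equiv.Perm.sign s = 1 then 0 else (e i : ℤ)) + 1 - (e (i + 2) : ℤ)

theorem samePar_shift : ∀ s e, SamePar (shift s e) := by
  unfold SamePar; decide +kernel

/-- All 48 linear parts are thus realized by marked symmetries, and only the translations remain to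
be found. -/
theorem respectsDir_shift : ∀ s e, RespectsDir s e (res (shift s e)) := by
  unfold RespectsDir; decide +kernel

theorem respectsDir_one : ∀ T : Fin 3 → ZMod 4, ResPar T → RespectsDir 1 1 T →
    T 0 = T 1 ∧ T 1 = T 2 ∧ 2 * T 0 = 0 := by
  unfold RespectsDir; decide +kernel

theorem respectsDir_one_const : ∀ c : ZMod 4, 2 * c = 0 → RespectsDir 1 1 (fun _ => c) := by
  unfold RespectsDir; decide +kernel

/-- The translations preserving the marked lines: all coordinates are congruent integers
modulo `2`. -/
def MarkedTransl (L : Fin 3 → ℤ) : Prop :=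
  L 0 % 2 = 0 ∧ (L 0 - L 1) % 4 = 0 ∧ (L 1 - L 2) % 4 = 0

theorem MarkedTransl.samePar {L : Fin 3 → ℤ} (h : MarkedTransl L) : SamePar L := by
  unfold MarkedTransl at h; unfold SamePar; lia

theorem transl_mem_markedSymm_iff {L : Fin 3 → ℤ} (hL : SamePar L) :
    transl (halfPt L) ∈ markedSymm ↔ MarkedTransl L := by
  rw [transl_eq_sgnIso, mem_markedSymm_iff_respectsDir 1 1 hL]
  have hc : ∀ i j, res L i = res L j ↔ (L i - L j) % 4 = 0 := fun i j => by
    rw [← congTwo_halfPt_iff_res, congTwo_halfPt_iff]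
  have h2 : 2 * res L 0 = 0 ↔ L 0 % 2 = 0 := by
    rw [← res_even_iff]
    generalize res L 0 = c
    revert c; decide
  constructor
  · intro h
    obtain ⟨ha, hb, h0⟩ := respectsDir_one _ hL.resPar h
    exact ⟨h2.1 h0, (hc _ _).1 ha, (hc _ _).1 hb⟩
  · rintro ⟨h0, ha, hb⟩
    have ha' := (hc _ _).2 ha
    have hb' := (hc _ _).2 hb
    have : res L = fun _ => res L 0 := by
      funext i; fin_cases i
      · rfl
      · exact ha'.symm
      · exact (ha'.trans hb').symm
    rw [this]
    exact respectsDir_one_const _ (h2.2 h0)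

theorem sgnIso_shift_mem_markedSymm (s : Equiv.Perm (Fin 3)) (e : Fin 3 → ℤˣ) :
    sgnIso s e (halfPt (shift s e)) ∈ markedSymm :=
  (mem_markedSymm_iff_respectsDir s e (samePar_shift s e)).2 (respectsDir_shift s e)

theorem sgnIso_shift_add_mem_markedSymm (s : Equiv.Perm (Fin 3)) (e : Fin 3 → ℤˣ)
    {L : Fin 3 → ℤ} (hL : MarkedTransl L) :
    sgnIso s e (halfPt (L + shift s e)) ∈ markedSymm := by
  rw [← halfPt_add, ← transl_mul_sgnIso]
  exact mul_mem ((transl_mem_markedSymm_iff hL.samePar).2 hL) (sgnIso_shift_mem_markedSymm s e)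

theorem mem_markedSymm_iff (g : Isom3) :
    g ∈ markedSymm ↔ ∃ s e L, MarkedTransl L ∧ g = sgnIso s e (halfPt (L + shift s e)) := by
  constructor
  · intro h
    obtain ⟨s, e, T, hT, rfl⟩ := (mem_bccSymm_iff g).1 h.1
    have h1 : transl (halfPt (T - shift s e)) * sgnIso s e (halfPt (shift s e)) =
        sgnIso s e (halfPt T) := by
      rw [transl_mul_sgnIso, halfPt_add, sub_add_cancel]
    refine ⟨s, e, T - shift s e, ?_, by rw [sub_add_cancel]⟩
    rw [← transl_mem_markedSymm_iff (hT.sub (samePar_shift s e))]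
    rw [← h1] at h
    exact (Subgroup.mul_mem_cancel_right _ (sgnIso_shift_mem_markedSymm s e)).1 h
  · rintro ⟨s, e, L, hL, rfl⟩
    exact sgnIso_shift_add_mem_markedSymm s e hL

/-- This coincidence is why marked symmetries preserve handedness: the sign induced by a lattice
symmetry is `sign s` times (-1) to the coset shift, and marked translations have even coset shift.
-/
theorem coordSum_shift_sign : ∀ s e,
    Equiv.Perm.sign s = (-1) ^ (coordSum (shift s e)).val := by
  unfold coordSum; decide +kernel

theorem MarkedTransl.coordSum {L : Fin 3 → ℤ} (h : MarkedTransl L) :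
    coordSum L = 0 ∧ (L 0 % 4 = 0) ∨ coordSum L = 2 ∧ L 0 % 4 = 2 := by
  unfold MarkedTransl at h
  have h0 : ∀ k : ℤ, _root_.coordSum L = (k : ZMod 4) ↔ (L 0 + L 1 + L 2 - k) % 4 = 0 := fun k => by
    rw [_root_.coordSum, eq_comm, ZMod.intCast_eq_intCast_iff_dvd_sub, Int.dvd_iff_emod_eq_zero]
    rfl
  have h1 := h0 0
  have h2 := h0 2
  push_cast at h1 h2
  rw [h1, h2]
  lia

theorem markedSymm_sign {g : Isom3} (hg : g ∈ markedSymm) {σ : SignedPerm}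
    (h : InducesSigned g σ) : σ.2 = 1 := by
  obtain ⟨s, e, L, hL, rfl⟩ := (mem_markedSymm_iff g).1 hg
  rw [h.unique (sgnIso_inducesSigned s e (hL.samePar.add (samePar_shift s e)))]
  simp only
  rw [sign_dihPerm, coordSum_add, mul_assoc, ← mul_assoc (∏ i, e i), Int.units_mul_self, one_mul,
    coordSum_shift_sign s e]
  have : ∀ c : ZMod 4, ((-1 : ℤˣ)) ^ c.val * (-1) ^ c.val = 1 ∧
      ((-1 : ℤˣ)) ^ c.val * (-1) ^ (2 + c).val = 1 := by decide
  rcases hL.coordSum with h | h <;> rw [h.1]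
  · rw [zero_add]; exact (this _).1
  · exact (this _).2

/-- The boolean decides whether the translation by (1,1,1) is added; its doubled coordinate sum is
6, that is, 2 modulo 4. -/
theorem exists_shift_perm : ∀ (E : ℤˣ) (c : ZMod 4), ∃ s e, ∃ b : Bool,
    (∏ i, e i) = E ∧ (if b then 2 else 0) + coordSum (shift s e) = c := by
  unfold coordSum; decide +kernel

theorem markedSymm_le_bccSymm : markedSymm ≤ bccSymm := fun _ h => h.1

theorem G8_eq : G8 = dihedralPerms := by
  ext π
  rw [mem_dihedralPerms_iff]
  constructor
  · rintro ⟨g, hg, h⟩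
    obtain ⟨s, e, L, hL, rfl⟩ := (mem_markedSymm_iff g).1 hg
    exact ⟨_, _, h.unique (sgnIso_inducesPerm s e (hL.samePar.add (samePar_shift s e)))⟩
  · rintro ⟨E, c, rfl⟩
    obtain ⟨s, e, b, hE, hc⟩ := exists_shift_perm E c
    have hL : MarkedTransl (fun _ => if b then 2 else 0) := by
      unfold MarkedTransl; cases b <;> simp
    refine ⟨_, sgnIso_shift_add_mem_markedSymm s e hL, ?_⟩
    have h := sgnIso_inducesPerm s e (hL.samePar.add (samePar_shift s e))
    rw [hE, coordSum_add] at h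
    rw [← hc]
    convert h using 3
    cases b <;> decide

/-! ### The two odd subgroups -/

theorem mem_fullGroup_bot_iff (g : Isom3) :
    g ∈ fullGroup ⊥ ↔ g ∈ bccSymm ∧ InducesSigned g 1 := by
  refine and_congr_right fun _ => ⟨?_, fun h => ⟨1, one_mem _, h⟩⟩
  rintro ⟨σ, hσ, h⟩
  rw [Subgroup.mem_bot] at hσ
  rw [hσ] at h
  exact h

theorem mem_quarterGroup_bot_iff (g : Isom3) :
    g ∈ quarterGroup ⊥ ↔ g ∈ markedSymm ∧ InducesPerm g 1 := by
  refine and_congr_right fun _ => ⟨?_, fun h => ⟨1, one_mem _, h⟩⟩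
  rintro ⟨σ, hσ, h⟩
  rw [Subgroup.mem_bot] at hσ
  rw [hσ] at h
  exact h

theorem mem_fullGroup_bot_iff_exists (g : Isom3) :
    g ∈ fullGroup ⊥ ↔ ∃ s e T, Equiv.Perm.sign s = 1 ∧ (∏ i, e i) = 1 ∧ SamePar T ∧
      coordSum T = 0 ∧ g = sgnIso s e (halfPt T) := by
  rw [mem_fullGroup_bot_iff]
  constructor
  · rintro ⟨hg, h⟩
    obtain ⟨s, e, T, hT, rfl⟩ := (mem_bccSymm_iff g).1 hg
    have h1 := h.unique (sgnIso_inducesSigned s e hT)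
    have h2 := congrArg Prod.fst h1
    simp only [Prod.fst_one] at h2
    rw [← dihPerm_one_zero] at h2
    obtain ⟨hE, hc⟩ := dihPerm_injective h2
    have h3 := congrArg Prod.snd h1
    simp only [Prod.snd_one] at h3
    rw [← hE, ← hc, dihPerm_one_zero, map_one, mul_one, mul_one] at h3
    exact ⟨s, e, T, h3.symm, hE.symm, hT, hc.symm, rfl⟩
  · rintro ⟨s, e, T, hs, he, hT, hc, rfl⟩
    refine ⟨sgnIso_mem_bccSymm s e hT, ?_⟩
    have h := sgnIso_inducesSigned s e hT
    rw [hs, he, hc, dihPerm_one_zero, map_one, mul_one, mul_one] at h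
    exact h

theorem coordSum_shift_of_even : ∀ s e, Equiv.Perm.sign s = 1 → (∏ i, e i) = 1 →
    coordSum (shift s e) = 0 := by
  unfold coordSum; decide +kernel

theorem mem_quarterGroup_bot_iff_exists (g : Isom3) :
    g ∈ quarterGroup ⊥ ↔ ∃ s e L, Equiv.Perm.sign s = 1 ∧ (∏ i, e i) = 1 ∧
      (∀ i, L i % 4 = 0) ∧ g = sgnIso s e (halfPt (L + shift s e)) := by
  rw [mem_quarterGroup_bot_iff]
  constructor
  · rintro ⟨hg, h⟩
    obtain ⟨s, e, L, hL, rfl⟩ := (mem_markedSymm_iff g).1 hg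
    have h1 := h.unique (sgnIso_inducesPerm s e (hL.samePar.add (samePar_shift s e)))
    rw [← dihPerm_one_zero] at h1
    obtain ⟨hE, hc⟩ := dihPerm_injective h1
    have h2 := coordSum_shift_sign s e
    rw [coordSum_add] at hc
    -- The coset shift of `L` is 0 or 2 and cancels that of `shift s e`, which is therefore even.
    have hs : Equiv.Perm.sign s = 1 := by
      rw [h2]
      generalize coordSum (shift s e) = c at *
      rcases hL.coordSum with h | h <;> rw [h.1] at hc <;> clear * - hc <;> revert c <;> decide
    rw [coordSum_shift_of_even s e hs hE.symm, add_zero] at hc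
    refine ⟨s, e, L, hs, hE.symm, ?_, rfl⟩
    rcases hL.coordSum with h | h
    · obtain ⟨h1, h2, h3⟩ := hL
      simp only [Fin.forall_fin_succ, Fin.isValue]
      simp
      lia
    · rw [h.1] at hc
      exact absurd hc (by decide)
  · rintro ⟨s, e, L, hs, he, hL, rfl⟩
    have hL' : MarkedTransl L := by
      have h0 := hL 0
      have h1 := hL 1
      have h2 := hL 2
      unfold MarkedTransl; lia
    refine ⟨sgnIso_shift_add_mem_markedSymm s e hL', ?_⟩
    have h := sgnIso_inducesPerm s e (hL'.samePar.add (samePar_shift s e))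
    have hc : coordSum L = 0 := by
      have h0 := hL 0
      rcases hL'.coordSum with h | h
      · exact h.1
      · lia
    rwa [he, coordSum_add, coordSum_shift_of_even s e hs he, hc, add_zero,
      dihPerm_one_zero] at h

/-! ### Generators of the two odd subgroups -/

/-- The rotation of order `3` permuting the coordinates cyclically. -/
noncomputable def rho : Isom3 := sgnIso (finRotate 3) 1 0

/-- The half-turn about the last coordinate axis. -/
noncomputable def delta : Isom3 := sgnIso 1 ![-1, -1, 1] 0

/-- A screw half-turn with axis parallel to the last coordinate axis. -/
noncomputable def screw : Isom3 := sgnIso 1 ![-1, -1, 1] (halfPt ![0, 2, 2])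

/-- The vectors of the translations in a group of isometries. -/
def translGroup (G : Subgroup Isom3) : AddSubgroup E3 where
  carrier := {t | transl t ∈ G}
  add_mem' {t u} ht hu := by
    change transl _ ∈ G
    rw [← transl_mul]; exact mul_mem ht hu
  zero_mem' := by change transl _ ∈ G; rw [transl_zero]; exact one_mem _
  neg_mem' {t} ht := by
    change transl _ ∈ G
    rw [← transl_inv]; exact inv_mem ht

theorem mem_translGroup (G : Subgroup Isom3) (t : E3) : t ∈ translGroup G ↔ transl t ∈ G := Iff.rfl

theorem linear_mem_translGroup {G : Subgroup Isom3} {g : Isom3} (hg : g ∈ G) {t : E3}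
    (ht : t ∈ translGroup G) : g.linearIsometryEquiv t ∈ translGroup G := by
  rw [mem_translGroup, ← conj_transl]
  exact mul_mem (mul_mem hg ht) (inv_mem hg)

theorem rho_linear (t : E3) (i : Fin 3) : rho.linearIsometryEquiv t i = t (i + 1) := by
  rw [rho, sgnIso_linear]
  fin_cases i <;> simp

theorem rho_apply (t : E3) (i : Fin 3) : rho t i = t (i + 1) := by
  have h := rho_linear t i
  rwa [linear_apply, rho, sgnIso_zero, sub_zero] at h

theorem rho_pow (n : ℕ) : rho ^ n = sgnIso (finRotate 3 ^ n) 1 0 := by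
  induction n with
  | zero => ext p i; simp [sgnIso_apply]
  | succ n ih =>
    rw [pow_succ, ih, rho, sgnIso_mul, pow_succ']
    congr 1
    ext i; simp [sgnIso_apply]

theorem sgnIso_mem_of_rho {H : Subgroup Isom3} (h : rho ∈ H) {s : Equiv.Perm (Fin 3)}
    (hs : Equiv.Perm.sign s = 1) : sgnIso s 1 0 ∈ H := by
  have : ∀ s : Equiv.Perm (Fin 3), Equiv.Perm.sign s = 1 → ∃ n : Fin 3,
      s = finRotate 3 ^ (n : ℕ) := by decide
  obtain ⟨n, rfl⟩ := this s hs
  rw [← rho_pow]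
  exact pow_mem h _

theorem rho_conj (e : Fin 3 → ℤˣ) (t : E3) :
    rho * sgnIso 1 e t * rho⁻¹ =
      sgnIso 1 (fun i => e (i + 1)) (WithLp.toLp 2 fun i => t (i + 1)) := by
  rw [mul_inv_eq_iff_eq_mul]
  ext p i
  simp [isom_mul_apply, rho_apply, sgnIso_apply]

theorem even_signs : ∀ e : Fin 3 → ℤˣ, (∏ i, e i) = 1 →
    e = 1 ∨ e = ![-1, -1, 1] ∨ e = (fun i => (![-1, -1, 1] : Fin 3 → ℤˣ) (i + 1)) ∨
      e = (fun i => (![-1, -1, 1] : Fin 3 → ℤˣ) (i + 1 + 1)) := by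
  decide

/-- The linear part splits into a power of `rho` and an even sign change, which is trivial or
conjugate to `delta` under `rho`. The translations form D₃, spanned by (1,1,0) and its cyclic
shifts. -/
theorem fullGroup_bot_le {H : Subgroup Isom3} (hr : rho ∈ H) (hd : delta ∈ H)
    (ht : transl (halfPt ![2, 2, 0]) ∈ H) : fullGroup ⊥ ≤ H := by
  intro g hg
  obtain ⟨s, e, T, hs, he, hT, hc, rfl⟩ := (mem_fullGroup_bot_iff_exists g).1 hg
  have h1 : sgnIso s e (halfPt T) = transl (halfPt T) * (sgnIso 1 e 0 * sgnIso s 1 0) := by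
    rw [sgnIso_mul, transl_mul_sgnIso]
    congr 1
    · funext i; simp
    · ext i; simp [sgnIso_apply]
  rw [h1]
  refine mul_mem ?_ (mul_mem ?_ (sgnIso_mem_of_rho hr hs))
  · have hT2 : (P : ℤ) → P = T 0 + T 1 + T 2 → P % 4 = 0 := by
      rintro P rfl
      have hc' : ((T 0 + T 1 + T 2 : ℤ) : ZMod 4) = 0 := hc
      rw [ZMod.intCast_zmod_eq_zero_iff_dvd] at hc'
      lia
    have hT3 := hT2 _ rfl
    obtain ⟨a, b⟩ := hT
    -- `x`, `y`, `z` solve T = 2 (x + z, x + y, y + z), the expansion in the three shifted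
    -- generators.
    obtain ⟨x, hx⟩ : ∃ x, T 0 + T 1 - T 2 = 4 * x := ⟨(T 0 + T 1 - T 2) / 4, by lia⟩
    obtain ⟨y, hy⟩ : ∃ x, T 1 + T 2 - T 0 = 4 * x := ⟨(T 1 + T 2 - T 0) / 4, by lia⟩
    obtain ⟨z, hz⟩ : ∃ x, T 2 + T 0 - T 1 = 4 * x := ⟨(T 2 + T 0 - T 1) / 4, by lia⟩
    have m0 : halfPt ![2, 2, 0] ∈ translGroup H := ht
    have m1 := linear_mem_translGroup hr m0
    have m2 := linear_mem_translGroup hr m1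
    have m : x • halfPt ![2, 2, 0] + z • rho.linearIsometryEquiv (halfPt ![2, 2, 0]) +
        y • rho.linearIsometryEquiv (rho.linearIsometryEquiv (halfPt ![2, 2, 0])) ∈
        translGroup H :=
      add_mem (add_mem (zsmul_mem m0 _) (zsmul_mem m1 _)) (zsmul_mem m2 _)
    have heq : halfPt T = x • halfPt ![2, 2, 0] +
        z • rho.linearIsometryEquiv (halfPt ![2, 2, 0]) +
        y • rho.linearIsometryEquiv (rho.linearIsometryEquiv (halfPt ![2, 2, 0])) := by
      have e0 : T 0 = 2 * (x + z) := by lia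
      have e1 : T 1 = 2 * (x + y) := by lia
      have e2 : T 2 = 2 * (y + z) := by lia
      ext i
      simp only [PiLp.add_apply, PiLp.smul_apply, rho_linear, halfPt_apply]
      fin_cases i <;> simp [e0, e1, e2] <;> ring
    rw [heq]
    exact m
  · have hc1 := mul_mem (mul_mem hr hd) (inv_mem hr)
    have hc2 := mul_mem (mul_mem hr hc1) (inv_mem hr)
    have hz : (WithLp.toLp 2 fun i => (0 : E3) (i + 1) : E3) = 0 := by ext i; simp
    rw [delta, rho_conj, hz] at hc1
    rw [delta, rho_conj, hz, rho_conj, hz] at hc2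
    rcases even_signs e he with rfl | rfl | rfl | rfl
    · rw [← transl_eq_sgnIso, transl_zero]; exact one_mem _
    · exact hd
    · exact hc1
    · exact hc2

theorem shift_of_even : ∀ s e, Equiv.Perm.sign s = 1 →
    shift s e = fun i => 1 - (e (i + 2) : ℤ) := by
  intro s e hs
  funext i
  simp [shift, hs]

theorem screw_mul_self : screw * screw = transl (halfPt ![0, 0, 4]) := by
  ext p i
  fin_cases i <;> simp [screw, isom_mul_apply, sgnIso_apply, transl_apply]
  ring

/-- No translation has to be assumed: the square of `screw` is the translation by (0,0,2), whose
cyclic shifts span the translations 2ℤ³. -/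
theorem quarterGroup_bot_le {H : Subgroup Isom3} (hr : rho ∈ H) (hd : screw ∈ H) :
    quarterGroup ⊥ ≤ H := by
  intro g hg
  obtain ⟨s, e, L, hs, he, hL, rfl⟩ := (mem_quarterGroup_bot_iff_exists g).1 hg
  have h1 : sgnIso s e (halfPt (L + shift s e)) = transl (halfPt L) *
      (sgnIso 1 e (halfPt (fun i => 1 - (e (i + 2) : ℤ))) * sgnIso s 1 0) := by
    rw [sgnIso_mul, transl_mul_sgnIso, shift_of_even s e hs]
    congr 1
    · funext i; simp
    · ext i; simp [sgnIso_apply]; ring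
  rw [h1]
  refine mul_mem ?_ (mul_mem ?_ (sgnIso_mem_of_rho hr hs))
  · choose k hk using fun i => (Int.dvd_of_emod_eq_zero (hL i) : (4 : ℤ) ∣ L i)
    have m0 : halfPt ![0, 0, 4] ∈ translGroup H := by
      rw [mem_translGroup, ← screw_mul_self]; exact mul_mem hd hd
    have m1 := linear_mem_translGroup hr m0
    have m2 := linear_mem_translGroup hr m1
    have m := add_mem (add_mem (zsmul_mem m0 (k 2)) (zsmul_mem m1 (k 1))) (zsmul_mem m2 (k 0))
    have heq : halfPt L = k 2 • halfPt ![0, 0, 4] +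
        k 1 • rho.linearIsometryEquiv (halfPt ![0, 0, 4]) +
        k 0 • rho.linearIsometryEquiv (rho.linearIsometryEquiv (halfPt ![0, 0, 4])) := by
      ext i
      simp only [PiLp.add_apply, PiLp.smul_apply, rho_linear, halfPt_apply, hk]
      fin_cases i <;> simp <;> ring
    rw [heq]
    exact m
  · have hc1 := mul_mem (mul_mem hr hd) (inv_mem hr)
    have hc2 := mul_mem (mul_mem hr hc1) (inv_mem hr)
    rw [screw, rho_conj] at hc1
    rw [screw, rho_conj, rho_conj] at hc2
    rcases even_signs e he with rfl | rfl | rfl | rfl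
    · have : halfPt (fun i => 1 - (((1 : Fin 3 → ℤˣ) (i + 2) : ℤˣ) : ℤ)) = 0 := by
        ext i; simp
      rw [this, ← transl_eq_sgnIso, transl_zero]; exact one_mem _
    · convert hd using 1
      rw [screw]
      congr 2
      decide
    · convert hc1 using 2
      ext i
      fin_cases i <;> simp
    · convert hc2 using 2
      ext i
      fin_cases i <;> simp

/-- When the signs multiply to one, the cube is a translation. The hypothesis `ht` kills its first
component, and the other two agree with that one up to sign. -/
theorem sgnIso_finRotate_cube {e : Fin 3 → ℤˣ} {t : E3} (he : (∏ i, e i) = 1)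
    (ht : t 0 + ((e 0 : ℤ) : ℝ) * t 1 + ((e 0 : ℤ) : ℝ) * ((e 1 : ℤ) : ℝ) * t 2 = 0) :
    sgnIso (finRotate 3) e t ^ 3 = 1 := by
  rw [pow_three]
  have h0 : (finRotate 3) 0 = 1 := rfl
  have h1 : (finRotate 3) 1 = 2 := rfl
  have h2 : (finRotate 3) 2 = 0 := rfl
  rw [Fin.prod_univ_three] at he
  have he2 : e 2 = e 0 * e 1 := by
    rw [← mul_left_inj (e 2), he, Int.units_mul_self]
  ext p i
  rw [isom_mul_apply, isom_mul_apply]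
  fin_cases i <;> simp [sgnIso_apply, h0, h1, h2, he2] <;>
    rcases Int.units_eq_one_or (e 0) with h | h <;>
    rcases Int.units_eq_one_or (e 1) with h' | h' <;>
    simp [h, h'] at ht ⊢ <;> linarith

theorem orderOf_sgnIso_finRotate {e : Fin 3 → ℤˣ} {t : E3} (he : (∏ i, e i) = 1)
    (ht : t 0 + ((e 0 : ℤ) : ℝ) * t 1 + ((e 0 : ℤ) : ℝ) * ((e 1 : ℤ) : ℝ) * t 2 = 0) :
    orderOf (sgnIso (finRotate 3) e t) = 3 := by
  have : Fact (Nat.Prime 3) := ⟨Nat.prime_three⟩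
  refine orderOf_eq_prime (sgnIso_finRotate_cube he ht) fun h => ?_
  have h1 := sgnIso_linear (finRotate 3) e t (EuclideanSpace.single 0 1) 0
  rw [h] at h1
  have h0 : (finRotate 3) 0 = 1 := rfl
  change (EuclideanSpace.single (0 : Fin 3) (1 : ℝ)) 0 = _ at h1
  rw [h0] at h1
  simp at h1

theorem rho_mem_markedSymm : rho ∈ markedSymm := by
  have h := sgnIso_shift_mem_markedSymm (finRotate 3) 1
  have : halfPt (shift (finRotate 3) 1) = 0 := by
    rw [shift_of_even _ _ (by decide)]; ext i; simp
  rwa [this] at h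

theorem rho_mem_oddSubgroup {G : Subgroup Isom3} (hG : rho ∈ G) : rho ∈ oddSubgroup G :=
  Subgroup.subset_closure ⟨hG, orderOf_sgnIso_finRotate (by simp) (by simp)⟩

/-- Two rotations of order 3 with the same linear part and parallel axes have a translation as
quotient, and one of them combines with `rho` to `delta`. -/
theorem fullGroup_bot_le_oddSubgroup : fullGroup ⊥ ≤ oddSubgroup bccSymm := by
  have hr := rho_mem_oddSubgroup (markedSymm_le_bccSymm rho_mem_markedSymm)
  have h1 : sgnIso (finRotate 3) ![1, -1, -1] (halfPt ![2, 0, 2]) ∈ oddSubgroup bccSymm :=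
    Subgroup.subset_closure ⟨sgnIso_mem_bccSymm _ _ (by unfold SamePar; decide),
      orderOf_sgnIso_finRotate (by decide) (by simp)⟩
  have h2 : sgnIso (finRotate 3) ![1, -1, -1] 0 ∈ oddSubgroup bccSymm := by
    have h0 : halfPt 0 = 0 := by ext i; simp
    rw [← h0]
    exact Subgroup.subset_closure ⟨sgnIso_mem_bccSymm _ _ (by unfold SamePar; decide),
      orderOf_sgnIso_finRotate (by decide) (by simp)⟩
  refine fullGroup_bot_le hr ?_ ?_
  · have h3 := mul_mem (mul_mem hr (mul_mem h2 (inv_mem hr))) (inv_mem hr)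
    convert h3 using 1
    rw [eq_mul_inv_iff_mul_eq, ← mul_assoc, eq_mul_inv_iff_mul_eq]
    ext p i
    fin_cases i <;> simp [isom_mul_apply, rho_apply, sgnIso_apply, delta]
  · have h3 := mul_mem h1 (inv_mem h2)
    have h4 : sgnIso (finRotate 3) ![1, -1, -1] (halfPt ![2, 0, 2]) *
        (sgnIso (finRotate 3) ![1, -1, -1] 0)⁻¹ = transl (halfPt ![2, 0, 2]) := by
      rw [mul_inv_eq_iff_eq_mul, transl_mul_sgnIso, add_zero]
    rw [h4, ← mem_translGroup] at h3
    have h5 := linear_mem_translGroup hr (linear_mem_translGroup hr h3)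
    rw [← mem_translGroup]
    convert h5 using 1
    ext i
    fin_cases i <;> simp [rho_linear]

/-- The combination with `rho` that gave `delta` before gives `screw` here, because the rotation of
order 3 now carries the translation part required by the marking. -/
theorem quarterGroup_bot_le_oddSubgroup : quarterGroup ⊥ ≤ oddSubgroup markedSymm := by
  have hr := rho_mem_oddSubgroup rho_mem_markedSymm
  have h1 : sgnIso (finRotate 3) ![1, -1, -1] (halfPt ![2, 0, 2]) ∈ oddSubgroup markedSymm := by
    have h0 : shift (finRotate 3) ![1, -1, -1] = ![2, 0, 2] := by decide
    have h := sgnIso_shift_mem_markedSymm (finRotate 3) ![1, -1, -1]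
    rw [h0] at h
    exact Subgroup.subset_closure ⟨h, orderOf_sgnIso_finRotate (by decide) (by simp)⟩
  refine quarterGroup_bot_le hr ?_
  have h3 := mul_mem (mul_mem hr (mul_mem h1 (inv_mem hr))) (inv_mem hr)
  convert h3 using 1
  rw [eq_mul_inv_iff_mul_eq, ← mul_assoc, eq_mul_inv_iff_mul_eq]
  ext p i
  fin_cases i <;> simp [isom_mul_apply, rho_apply, sgnIso_apply, screw]

/-- An element with trivial cube must vanish in a 2-group; concretely, E³ = E for signs and 3c = 0
forces c = 0 modulo 4. -/
theorem inducesSigned_one_of_cube {g : Isom3} (hg : g ∈ bccSymm) (h : g ^ 3 = 1) :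
    InducesSigned g 1 := by
  obtain ⟨σ, hσ, -⟩ := bccSymm_existsUnique g hg
  have h3 : InducesSigned (g * (g * g)) (σ * (σ * σ)) :=
    hσ.mul (mul_mem hg hg) (hσ.mul hg hσ)
  rw [← pow_three, h] at h3
  have h4 := h3.unique InducesSigned.one
  have h5 : σ ∈ G16 := ⟨g, hg, hσ⟩
  rw [mem_G16_iff, mem_dihedralPerms_iff] at h5
  obtain ⟨E, c, hE⟩ := h5
  have h6 := congrArg Prod.fst h4
  simp only [Prod.fst_mul, Prod.fst_one, hE] at h6
  rw [dihPerm_mul, dihPerm_mul, ← dihPerm_one_zero] at h6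
  obtain ⟨h7, h8⟩ := dihPerm_injective h6
  have h9 := congrArg Prod.snd h4
  simp only [Prod.snd_mul, Prod.snd_one] at h9
  rw [Int.units_mul_self, mul_one] at h7 h9
  subst h7
  have hc : c = 0 := by
    clear * - h8
    revert c; decide
  have : σ = 1 := by
    refine Prod.ext ?_ h9
    rw [hE, hc, dihPerm_one_zero]; rfl
  rwa [this] at hσ

theorem oddSubgroup_bccSymm : oddSubgroup bccSymm = fullGroup ⊥ := by
  refine le_antisymm ((Subgroup.closure_le _).2 ?_) fullGroup_bot_le_oddSubgroup
  rintro g ⟨hg, h⟩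
  rw [SetLike.mem_coe, mem_fullGroup_bot_iff]
  exact ⟨hg, inducesSigned_one_of_cube hg (orderOf_dvd_iff_pow_eq_one.1 h.dvd)⟩

theorem oddSubgroup_markedSymm : oddSubgroup markedSymm = quarterGroup ⊥ := by
  refine le_antisymm ((Subgroup.closure_le _).2 ?_) quarterGroup_bot_le_oddSubgroup
  rintro g ⟨hg, h⟩
  rw [SetLike.mem_coe, mem_quarterGroup_bot_iff]
  exact ⟨hg, (inducesSigned_one_of_cube hg.1 (orderOf_dvd_iff_pow_eq_one.1 h.dvd)).1⟩

/-! ### Functoriality of the odd subgroup -/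

theorem oddSubgroup_mono {G H : Subgroup Isom3} (h : G ≤ H) : oddSubgroup G ≤ oddSubgroup H :=
  Subgroup.closure_mono fun _ hg => ⟨h hg.1, hg.2⟩

theorem oddSubgroup_eq_of_le {G N : Subgroup Isom3} (h : oddSubgroup N ≤ G) (h' : G ≤ N) :
    oddSubgroup G = oddSubgroup N :=
  le_antisymm (oddSubgroup_mono h') <| (Subgroup.closure_le _).2 fun _ hg =>
    Subgroup.subset_closure ⟨h (Subgroup.subset_closure hg), hg.2⟩

/-- Injective homomorphisms preserve orders. The target is arbitrary so that conjugation by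
isometries and by affine bijections are both covered. -/
theorem map_oddSubgroup {Γ : Type*} [Group Γ] (G : Subgroup Isom3) (f : Isom3 →* Γ)
    (hf : Function.Injective f) :
    (oddSubgroup G).map f = Subgroup.closure {g | g ∈ G.map f ∧ orderOf g = 3} := by
  rw [oddSubgroup, MonoidHom.map_closure]
  congr 1
  ext x
  constructor
  · rintro ⟨g, ⟨hg, h⟩, rfl⟩
    exact ⟨⟨g, hg, rfl⟩, by rw [orderOf_injective f hf, h]⟩
  · rintro ⟨⟨g, hg, rfl⟩, h⟩
    exact ⟨g, ⟨hg, by rwa [orderOf_injective f hf] at h⟩, rfl⟩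

theorem mem_normalizer_of_conj {G : Subgroup Isom3} {g : Isom3}
    (h : G.map (MulAut.conj g).toMonoidHom = G) : g ∈ Subgroup.normalizer (G : Set Isom3) := by
  rw [Subgroup.mem_normalizer_iff]
  intro x
  constructor
  · intro hx
    have : g * x * g⁻¹ ∈ G.map (MulAut.conj g).toMonoidHom := ⟨x, hx, rfl⟩
    rwa [h] at this
  · intro hx
    rw [← h] at hx
    obtain ⟨y, hy, hxy⟩ := hx
    have : y = x := by simpa using hxy
    rwa [← this]

theorem conj_map_self {G : Subgroup Isom3} {g : Isom3} (hg : g ∈ G) :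
    G.map (MulAut.conj g).toMonoidHom = G := by
  ext x
  constructor
  · rintro ⟨y, hy, rfl⟩
    exact mul_mem (mul_mem hg hy) (inv_mem hg)
  · intro hx
    exact ⟨g⁻¹ * x * g, mul_mem (mul_mem (inv_mem hg) hx) hg, by simp [mul_assoc]⟩

theorem le_normalizer_oddSubgroup (G : Subgroup Isom3) :
    G ≤ Subgroup.normalizer (oddSubgroup G : Set Isom3) := by
  intro g hg
  apply mem_normalizer_of_conj
  rw [map_oddSubgroup _ _ (MulAut.conj g).injective, conj_map_self hg]
  rfl

/-! ### The normalizers -/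

theorem mem_translGroup_fullGroup_bot_iff (t : E3) :
    t ∈ translGroup (fullGroup ⊥) ↔ ∃ X : Fin 3 → ℤ, (X 0 + X 1 + X 2) % 2 = 0 ∧
      t = halfPt (2 * X) := by
  rw [mem_translGroup, mem_fullGroup_bot_iff_exists]
  constructor
  · rintro ⟨s, e, T, -, -, hT, hc, h⟩
    have ht : t = halfPt T := by
      have := congrArg (fun g : Isom3 => g 0) h
      simpa [sgnIso_zero, transl_apply] using this
    have hc' : ((T 0 + T 1 + T 2 : ℤ) : ZMod 4) = 0 := hc
    rw [ZMod.intCast_zmod_eq_zero_iff_dvd] at hc'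
    obtain ⟨ha, hb⟩ := hT
    refine ⟨fun i => T i / 2, by lia, ?_⟩
    rw [ht]
    congr 1
    have : ∀ i, T i = 2 * (T i / 2) := by
      simp only [Fin.forall_fin_succ, Fin.isValue]
      simp
      lia
    funext i
    exact this i
  · rintro ⟨X, hX, rfl⟩
    refine ⟨1, 1, 2 * X, by simp, by simp, ?_, ?_, transl_eq_sgnIso _⟩
    · unfold SamePar; simp
    · change (((2 * X) 0 + (2 * X) 1 + (2 * X) 2 : ℤ) : ZMod 4) = 0
      rw [ZMod.intCast_zmod_eq_zero_iff_dvd]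
      simp
      lia

theorem mem_translGroup_quarterGroup_bot_iff (t : E3) :
    t ∈ translGroup (quarterGroup ⊥) ↔ ∃ X : Fin 3 → ℤ, t = halfPt (4 * X) := by
  rw [mem_translGroup, mem_quarterGroup_bot_iff_exists]
  constructor
  · rintro ⟨s, e, L, -, -, hL, h⟩
    have ht : t = halfPt (L + shift s e) := by
      have := congrArg (fun g : Isom3 => g 0) h
      simpa [sgnIso_zero, transl_apply] using this
    have he : e = 1 := by
      have h1 : ∀ p i, (transl t).linearIsometryEquiv p i = ((e i : ℤ) : ℝ) * p (s i) := by
        rw [h]; exact fun p i => sgnIso_linear s e _ p i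
      funext i
      have h2 := h1 (WithLp.toLp 2 fun _ => 1) i
      rw [transl_linear] at h2
      rcases Int.units_eq_one_or (e i) with h3 | h3
      · exact h3
      · rw [h3] at h2; norm_num at h2
    have hs : s = 1 := by
      subst he
      have h1 : ∀ p i, (transl t).linearIsometryEquiv p i = p (s i) := by
        rw [h]; intro p i; simp [sgnIso_linear]
      ext1 i
      have h2 := h1 (EuclideanSpace.single i 1) i
      rw [transl_linear] at h2
      by_contra hne
      exact hne (by simpa using h2)
    subst he hs
    choose k hk using fun i => (Int.dvd_of_emod_eq_zero (hL i) : (4 : ℤ) ∣ L i)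
    refine ⟨k, ?_⟩
    rw [ht]
    congr 1
    funext i
    simp [shift, hk]
  · rintro ⟨X, rfl⟩
    refine ⟨1, 1, 4 * X, by simp, by simp, fun i => by simp, ?_⟩
    rw [transl_eq_sgnIso]
    congr 2
    funext i
    simp [shift]

theorem exists_sgnIso_of_double (g : Isom3) (h : ∀ j, ∃ X : Fin 3 → ℤ,
    g.linearIsometryEquiv (EuclideanSpace.single j 2) = halfPt (4 * X)) :
    ∃ s e, g = sgnIso s e (g 0) := by
  refine exists_sgnIso_of_basis g fun j => ?_
  obtain ⟨X, hX⟩ := h j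
  have hn := g.linearIsometryEquiv.norm_map (EuclideanSpace.single j (2 : ℝ))
  rw [hX] at hn
  have h1 := norm_sq_eq (halfPt (4 * X))
  rw [hn] at h1
  simp at h1
  have h2 : X 0 ^ 2 + X 1 ^ 2 + X 2 ^ 2 = 1 := by
    have : (X 0 : ℝ) ^ 2 + X 1 ^ 2 + X 2 ^ 2 = 1 := by linarith
    exact_mod_cast this
  have h3 : EuclideanSpace.single j (1 : ℝ) = (1 / 2 : ℝ) • EuclideanSpace.single j (2 : ℝ) := by
    ext i; by_cases h : i = j <;> simp [h]
  rw [h3, map_smul, hX]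
  refine exists_basis_of_int (P := X) (fun i => ?_) h2
  simp
  ring

/-- A square is congruent to its parity modulo 4. Since the squares add up to 4, the number of odd
coordinates is divisible by 4, hence zero. -/
theorem exists_double_of_norm {X : Fin 3 → ℤ} (h : ‖halfPt (2 * X)‖ = 2) :
    ∃ Y : Fin 3 → ℤ, halfPt (2 * X) = halfPt (4 * Y) := by
  have h1 := norm_sq_eq (halfPt (2 * X))
  rw [h] at h1
  simp at h1
  have h3 : X 0 ^ 2 + X 1 ^ 2 + X 2 ^ 2 = 4 := by
    have : (X 0 : ℝ) ^ 2 + X 1 ^ 2 + X 2 ^ 2 = 4 := by linarith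
    exact_mod_cast this
  have sq_mod : ∀ x : ℤ, x ^ 2 % 4 = x % 2 := by
    intro x
    obtain ⟨k, hk | hk⟩ : ∃ k, x = 2 * k ∨ x = 2 * k + 1 := ⟨x / 2, by lia⟩ <;>
      rw [hk] <;> ring_nf <;> lia
  have s0 := sq_mod (X 0)
  have s1 := sq_mod (X 1)
  have s2 := sq_mod (X 2)
  refine ⟨fun i => X i / 2, ?_⟩
  congr 1
  have : ∀ i, 2 * X i = 4 * (X i / 2) := by
    simp only [Fin.forall_fin_succ, Fin.isValue]
    simp
    lia
  funext i
  exact this i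

theorem linear_mem_translGroup_of_normalizer {H : Subgroup Isom3} {g : Isom3}
    (hg : g ∈ Subgroup.normalizer (H : Set Isom3)) {t : E3} (ht : t ∈ translGroup H) :
    g.linearIsometryEquiv t ∈ translGroup H := by
  rw [mem_translGroup, ← conj_transl]
  exact (Subgroup.mem_normalizer_iff.1 hg _).1 ht

/-- The commutator of the translation by t with h is the translation by t - h t, where h acts by its
linear part. -/
theorem sub_linear_mem_of_normalizer {H : Subgroup Isom3} {t : E3}
    (ht : transl t ∈ Subgroup.normalizer (H : Set Isom3)) {h : Isom3} (hh : h ∈ H) :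
    t - h.linearIsometryEquiv t ∈ translGroup H := by
  have h1 : transl t * h * (transl t)⁻¹ ∈ H := (Subgroup.mem_normalizer_iff.1 ht _).1 hh
  have h2 := mul_mem h1 (inv_mem hh)
  rw [mem_translGroup]
  convert h2 using 1
  rw [sub_eq_add_neg, ← map_neg, ← transl_mul, ← conj_transl, ← transl_inv]
  group

theorem rho_mem_quarterGroup_bot : rho ∈ quarterGroup ⊥ := by
  rw [← oddSubgroup_markedSymm]; exact rho_mem_oddSubgroup rho_mem_markedSymm

theorem screw_mem_quarterGroup_bot : screw ∈ quarterGroup ⊥ := by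
  rw [mem_quarterGroup_bot_iff_exists]
  refine ⟨1, ![-1, -1, 1], 0, by simp, by decide, by simp, ?_⟩
  rw [screw]
  congr 2
  decide

theorem quarterGroup_bot_le_fullGroup_bot :
    quarterGroup ⊥ ≤ fullGroup ⊥ := by
  rw [← oddSubgroup_bccSymm, ← oddSubgroup_markedSymm]
  exact oddSubgroup_mono markedSymm_le_bccSymm

theorem delta_mem_fullGroup_bot : delta ∈ fullGroup ⊥ := by
  rw [mem_fullGroup_bot_iff_exists]
  refine ⟨1, ![-1, -1, 1], 0, by simp, by decide, by unfold SamePar; decide, by decide, ?_⟩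
  rw [delta]
  congr 1
  ext i; simp

/-- A normalizing isometry preserves the translations of T₁, hence permutes the vectors of length 2
in D₃, which are ± 2 times the basis vectors. So its linear part is a signed permutation, and
dividing by it leaves a translation to be located. -/
theorem normalizer_oddSubgroup_bccSymm :
    Subgroup.normalizer (oddSubgroup bccSymm : Set Isom3) = bccSymm := by
  refine le_antisymm (fun g hg => ?_) (le_normalizer_oddSubgroup _)
  have hle := le_normalizer_oddSubgroup bccSymm
  rw [oddSubgroup_bccSymm] at hg hle
  obtain ⟨s, e, hse⟩ := exists_sgnIso_of_double g fun j => by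
    have h1 : EuclideanSpace.single j 2 ∈ translGroup (fullGroup ⊥) := by
      rw [mem_translGroup_fullGroup_bot_iff]
      refine ⟨Pi.single j 2, by fin_cases j <;> decide, ?_⟩
      ext i
      by_cases h : i = j
      · subst h; norm_num
      · simp [h]
    have h2 := linear_mem_translGroup_of_normalizer hg h1
    obtain ⟨X, hX, hXt⟩ := (mem_translGroup_fullGroup_bot_iff _).1 h2
    rw [hXt] at h2 ⊢
    refine exists_double_of_norm (?_ : ‖halfPt (2 * X)‖ = 2)
    rw [← hXt, LinearIsometryEquiv.norm_map, PiLp.norm_single, Real.norm_ofNat]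
  have h0 : halfPt 0 = 0 := by ext i; simp
  have hm : sgnIso s e 0 ∈ bccSymm := by
    rw [← h0]; exact sgnIso_mem_bccSymm s e (by unfold SamePar; decide)
  have hfac : transl (g 0) * sgnIso s e 0 = g := by
    rw [transl_mul_sgnIso, add_zero]; exact hse.symm
  have ht : transl (g 0) ∈ Subgroup.normalizer (fullGroup ⊥ : Set Isom3) := by
    rw [← hfac] at hg
    exact (Subgroup.mul_mem_cancel_right _ (hle hm)).1 hg
  rw [← hfac]
  refine mul_mem ?_ hm
  generalize g 0 = t at ht
  -- The commutator with `delta` makes 2 t₀ and 2 t₁ integral, the one with `rho` makes the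
  -- differences of the coordinates integral; together this is membership in the bcc lattice.
  obtain ⟨X, -, hX⟩ := (mem_translGroup_fullGroup_bot_iff _).1
    (sub_linear_mem_of_normalizer ht delta_mem_fullGroup_bot)
  obtain ⟨Y, -, hY⟩ := (mem_translGroup_fullGroup_bot_iff _).1
    (sub_linear_mem_of_normalizer ht (quarterGroup_bot_le_fullGroup_bot rho_mem_quarterGroup_bot))
  have x0 := congrArg (fun p : E3 => p 0) hX
  have x1 := congrArg (fun p : E3 => p 1) hX
  have y0 := congrArg (fun p : E3 => p 0) hY
  have y1 := congrArg (fun p : E3 => p 1) hY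
  simp [delta, sgnIso_linear] at x0 x1
  simp [rho_linear] at y0 y1
  have hxy : X 0 - X 1 = 2 * Y 0 := by
    have : (X 0 : ℝ) - X 1 = 2 * Y 0 := by linarith
    exact_mod_cast this
  have : t = halfPt ![X 0, X 1, X 1 - 2 * Y 1] := by
    ext i
    fin_cases i <;> simp <;> linarith
  rw [this, transl_eq_sgnIso]
  refine sgnIso_mem_bccSymm _ _ ?_
  unfold SamePar
  simp
  lia

theorem normalizer_oddSubgroup_markedSymm :
    Subgroup.normalizer (oddSubgroup markedSymm : Set Isom3) = markedSymm := by
  refine le_antisymm (fun g hg => ?_) (le_normalizer_oddSubgroup _)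
  have hle := le_normalizer_oddSubgroup markedSymm
  rw [oddSubgroup_markedSymm] at hg hle
  obtain ⟨s, e, hse⟩ := exists_sgnIso_of_double g fun j => by
    have h1 : EuclideanSpace.single j 2 ∈ translGroup (quarterGroup ⊥) := by
      rw [mem_translGroup_quarterGroup_bot_iff]
      refine ⟨Pi.single j 1, ?_⟩
      ext i
      by_cases h : i = j
      · subst h; norm_num
      · simp [h]
    exact (mem_translGroup_quarterGroup_bot_iff _).1 (linear_mem_translGroup_of_normalizer hg h1)
  have hm := sgnIso_shift_mem_markedSymm s e
  have hfac : transl (g 0 - halfPt (shift s e)) * sgnIso s e (halfPt (shift s e)) = g := by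
    rw [transl_mul_sgnIso, sub_add_cancel]; exact hse.symm
  have ht : transl (g 0 - halfPt (shift s e)) ∈
      Subgroup.normalizer (quarterGroup ⊥ : Set Isom3) := by
    rw [← hfac] at hg
    exact (Subgroup.mul_mem_cancel_right _ (hle hm)).1 hg
  rw [← hfac]
  refine mul_mem ?_ hm
  generalize g 0 - halfPt (shift s e) = t at ht
  -- The same two commutators now lie in 2ℤ³, so t is integral with coordinates congruent modulo 2.
  obtain ⟨X, hX⟩ := (mem_translGroup_quarterGroup_bot_iff _).1
    (sub_linear_mem_of_normalizer ht screw_mem_quarterGroup_bot)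
  obtain ⟨Y, hY⟩ := (mem_translGroup_quarterGroup_bot_iff _).1
    (sub_linear_mem_of_normalizer ht rho_mem_quarterGroup_bot)
  have x0 := congrArg (fun p : E3 => p 0) hX
  have x1 := congrArg (fun p : E3 => p 1) hX
  have y0 := congrArg (fun p : E3 => p 0) hY
  have y1 := congrArg (fun p : E3 => p 1) hY
  simp [screw, sgnIso_linear] at x0 x1
  simp [rho_linear] at y0 y1
  have hxy : X 0 - X 1 = 2 * Y 0 := by
    have : (X 0 : ℝ) - X 1 = 2 * Y 0 := by linarith
    exact_mod_cast this
  have : t = halfPt ![2 * X 0, 2 * X 1, 2 * X 1 - 4 * Y 1] := by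
    ext i
    fin_cases i <;> simp <;> linarith
  have hM : MarkedTransl ![2 * X 0, 2 * X 1, 2 * X 1 - 4 * Y 1] := by
    unfold MarkedTransl
    simp
    lia
  rw [this]
  exact (transl_mem_markedSymm_iff hM.samePar).2 hM

/-! ### Groups between an odd subgroup and its normalizer -/

section Lift

variable {M Γ : Type*} [Group M] [Group Γ] {N : Subgroup M}

/-- The elements of `N` whose image under `p` lies in `H`. -/
def liftGroup (p : N →* Γ) (H : Subgroup Γ) : Subgroup M := (H.comap p).map N.subtype

theorem coe_mem_liftGroup_iff (p : N →* Γ) (H : Subgroup Γ) (x : N) :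
    (x : M) ∈ liftGroup p H ↔ p x ∈ H := by
  constructor
  · rintro ⟨y, hy, hxy⟩
    rw [← Subtype.ext (show (y : M) = x from hxy)]; exact hy
  · exact fun h => ⟨x, h, rfl⟩

theorem liftGroup_mono (p : N →* Γ) {H K : Subgroup Γ} (h : H ≤ K) :
    liftGroup p H ≤ liftGroup p K :=
  Subgroup.map_mono (Subgroup.comap_mono h)

theorem liftGroup_injective {p : N →* Γ} (hp : Function.Surjective p) :
    Function.Injective (liftGroup p) := fun _ _ h =>
  Subgroup.comap_injective hp (Subgroup.map_injective N.subtype_injective h)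

theorem map_conj_liftGroup (p : N →* Γ) (H : Subgroup Γ) (g : N) :
    (liftGroup p H).map (MulAut.conj (g : M)).toMonoidHom =
      liftGroup p (H.map (MulAut.conj (p g)).toMonoidHom) := by
  ext x
  constructor
  · rintro ⟨_, ⟨y, hy, rfl⟩, rfl⟩
    exact ⟨g * y * g⁻¹, ⟨p y, hy, by simp⟩, by simp⟩
  · rintro ⟨y, ⟨η, hη, h⟩, rfl⟩
    refine ⟨_, ⟨g⁻¹ * y * g, ?_, rfl⟩, by simp [mul_assoc]⟩
    have h1 : p g * η * (p g)⁻¹ = p y := h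
    change p (g⁻¹ * y * g) ∈ H
    rw [map_mul, map_mul, ← h1, map_inv]
    simpa [mul_assoc] using hη

theorem liftGroup_conj_iff {p : N →* Γ} (hp : Function.Surjective p) (H K : Subgroup Γ) :
    (∃ g ∈ N, (liftGroup p H).map (MulAut.conj g).toMonoidHom = liftGroup p K) ↔
      ∃ γ : Γ, H.map (MulAut.conj γ).toMonoidHom = K := by
  constructor
  · rintro ⟨g, hg, h⟩
    exact ⟨p ⟨g, hg⟩, liftGroup_injective hp (by rw [← map_conj_liftGroup, ← h])⟩
  · rintro ⟨γ, rfl⟩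
    obtain ⟨g, rfl⟩ := hp γ
    exact ⟨g, g.2, map_conj_liftGroup p H g⟩

/-- A subgroup containing the kernel of p is recovered from its image. -/
theorem exists_eq_liftGroup (p : N →* Γ) {G : Subgroup M} (h : liftGroup p ⊥ ≤ G) (h' : G ≤ N) :
    ∃ H, G = liftGroup p H := by
  refine ⟨(G.subgroupOf N).map p, le_antisymm (fun x hx => ?_) ?_⟩
  · exact ⟨⟨x, h' hx⟩, ⟨⟨x, h' hx⟩, hx, rfl⟩, rfl⟩
  · rintro _ ⟨y, ⟨z, hz, hzy⟩, rfl⟩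
    have h1 : ((y * z⁻¹ : N) : M) ∈ G := h ((coe_mem_liftGroup_iff p ⊥ _).2 (by
      rw [Subgroup.mem_bot, map_mul, map_inv, hzy, mul_inv_cancel]))
    have h2 := mul_mem h1 hz
    simpa using h2

end Lift

theorem inducedSigned_spec (g : bccSymm) :
    ∃ σ : G16, InducesSigned (g : Isom3) σ := by
  obtain ⟨σ, hσ, -⟩ := bccSymm_existsUnique g g.2
  exact ⟨⟨σ, g, g.2, hσ⟩, hσ⟩

/-- The signed permutation induced by a symmetry of the bcc lattice. -/
noncomputable def signedHom : bccSymm →* G16 :=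
  MonoidHom.mk' (fun g => (inducedSigned_spec g).choose) fun g h => Subtype.ext <|
    (inducedSigned_spec (g * h)).choose_spec.unique
      ((inducedSigned_spec g).choose_spec.mul h.2 (inducedSigned_spec h).choose_spec)

theorem signedHom_spec (g : bccSymm) : InducesSigned (g : Isom3) (signedHom g) :=
  (inducedSigned_spec g).choose_spec

theorem signedHom_eq_iff (g : bccSymm) (σ : G16) :
    signedHom g = σ ↔ InducesSigned (g : Isom3) σ :=
  ⟨fun h => h ▸ signedHom_spec g, fun h => Subtype.ext ((signedHom_spec g).unique h)⟩

theorem signedHom_surjective : Function.Surjective signedHom := fun σ => by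
  obtain ⟨g, hg, h⟩ := σ.2
  exact ⟨⟨g, hg⟩, (signedHom_eq_iff _ _).2 h⟩

theorem fullGroup_eq_liftGroup (H : Subgroup G16) : fullGroup H = liftGroup signedHom H := by
  ext g
  constructor
  · rintro ⟨hg, σ, hσ, h⟩
    exact ⟨⟨g, hg⟩, by
      change signedHom _ ∈ H
      rwa [(signedHom_eq_iff ⟨g, hg⟩ σ).2 h], rfl⟩
  · rintro ⟨y, hy, rfl⟩
    exact ⟨y.2, _, hy, signedHom_spec y⟩

theorem inducedPerm_spec (g : markedSymm) : ∃ π : G8, InducesPerm (g : Isom3) π := by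
  obtain ⟨σ, hσ, -⟩ := bccSymm_existsUnique g g.2.1
  exact ⟨⟨σ.1, g, g.2, hσ.1⟩, hσ.1⟩

/-- The permutation of the cosets induced by a symmetry of the marked lattice. -/
noncomputable def permHom : markedSymm →* G8 :=
  MonoidHom.mk' (fun g => (inducedPerm_spec g).choose) fun g h => Subtype.ext <|
    (inducedPerm_spec (g * h)).choose_spec.unique
      ((inducedPerm_spec g).choose_spec.mul (inducedPerm_spec h).choose_spec)

theorem permHom_spec (g : markedSymm) : InducesPerm (g : Isom3) (permHom g) :=
  (inducedPerm_spec g).choose_spec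

theorem permHom_eq_iff (g : markedSymm) (π : G8) :
    permHom g = π ↔ InducesPerm (g : Isom3) π :=
  ⟨fun h => h ▸ permHom_spec g, fun h => Subtype.ext ((permHom_spec g).unique h)⟩

theorem permHom_surjective : Function.Surjective permHom := fun π => by
  obtain ⟨g, hg, h⟩ := π.2
  exact ⟨⟨g, hg⟩, (permHom_eq_iff _ _).2 h⟩

theorem quarterGroup_eq_liftGroup (K : Subgroup G8) : quarterGroup K = liftGroup permHom K := by
  ext g
  constructor
  · rintro ⟨hg, σ, hσ, h⟩
    exact ⟨⟨g, hg⟩, by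
      change permHom _ ∈ K
      rwa [(permHom_eq_iff ⟨g, hg⟩ σ).2 h], rfl⟩
  · rintro ⟨y, hy, rfl⟩
    exact ⟨y.2, _, hy, permHom_spec y⟩

theorem fullGroup_le (H : Subgroup G16) : fullGroup H ≤ bccSymm := fun _ h => h.1

theorem quarterGroup_le (K : Subgroup G8) : quarterGroup K ≤ markedSymm := fun _ h => h.1

theorem bot_le_fullGroup (H : Subgroup G16) : fullGroup ⊥ ≤ fullGroup H := by
  rw [fullGroup_eq_liftGroup, fullGroup_eq_liftGroup]; exact liftGroup_mono _ bot_le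

theorem bot_le_quarterGroup (K : Subgroup G8) : quarterGroup ⊥ ≤ quarterGroup K := by
  rw [quarterGroup_eq_liftGroup, quarterGroup_eq_liftGroup]; exact liftGroup_mono _ bot_le

theorem oddSubgroup_fullGroup (H : Subgroup G16) : oddSubgroup (fullGroup H) = fullGroup ⊥ := by
  rw [← oddSubgroup_bccSymm]
  refine oddSubgroup_eq_of_le ?_ (fullGroup_le H)
  rw [oddSubgroup_bccSymm]; exact bot_le_fullGroup H

theorem oddSubgroup_quarterGroup (K : Subgroup G8) :
    oddSubgroup (quarterGroup K) = quarterGroup ⊥ := by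
  rw [← oddSubgroup_markedSymm]
  refine oddSubgroup_eq_of_le ?_ (quarterGroup_le K)
  rw [oddSubgroup_markedSymm]; exact bot_le_quarterGroup K

/-! ### The full groups and the quarter groups are irreducible space groups -/

theorem abs_apply_le_norm (p : E3) (i : Fin 3) : |p i| ≤ ‖p‖ := by
  have := PiLp.norm_apply_le p i
  rwa [Real.norm_eq_abs] at this

/-- Discreteness is inherited from the large group, cocompactness from the small one. As T₂ ≤ T₁ and
N₂ ≤ N₁, one statement serves both families. -/
theorem isSpaceGroup_of_le {G : Subgroup Isom3} (h : quarterGroup ⊥ ≤ G) (h' : G ≤ bccSymm) :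
    IsSpaceGroup G where
  discrete p C hC := by
    obtain ⟨R, hR⟩ := hC.isBounded.exists_norm_le
    obtain ⟨n, hn⟩ := exists_nat_ge (2 * (R + ‖p‖))
    have hfin : (Set.univ ×ˢ (Set.univ ×ˢ Set.pi Set.univ fun _ => Set.Icc (-(n : ℤ)) n) :
        Set (Equiv.Perm (Fin 3) × (Fin 3 → ℤˣ) × (Fin 3 → ℤ))).Finite :=
      Set.finite_univ.prod (Set.finite_univ.prod (Set.Finite.pi fun _ => Set.finite_Icc _ _))
    refine (hfin.image fun x => sgnIso x.1 x.2.1 (halfPt x.2.2)).subset ?_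
    rintro g ⟨hg, hgp⟩
    obtain ⟨s, e, T, hT, rfl⟩ := (mem_bccSymm_iff g).1 (h' hg)
    refine ⟨(s, e, T), ⟨trivial, trivial, fun i _ => ?_⟩, rfl⟩
    have h1 := abs_apply_le_norm (sgnIso s e (halfPt T) p) i
    have h2 := hR _ hgp
    have h3 := abs_apply_le_norm p (s i)
    have h4 : sgnIso s e (halfPt T) p i = ((e i : ℤ) : ℝ) * p (s i) + T i / 2 := by
      rw [sgnIso_apply]; rfl
    have h5 : |((e i : ℤ) : ℝ) * p (s i)| = |p (s i)| := by
      rcases Int.units_eq_one_or (e i) with h | h <;> simp [h]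
    rw [h4] at h1
    have h6 : |(T i : ℝ)| ≤ n := by
      have h7 := abs_sub (((e i : ℤ) : ℝ) * p (s i) + T i / 2) (((e i : ℤ) : ℝ) * p (s i))
      rw [add_sub_cancel_left, abs_div, h5, abs_two] at h7
      linarith
    have h7 : |T i| ≤ n := by exact_mod_cast h6
    rw [abs_le] at h7
    exact h7
  cocompact := by
    -- Reduction modulo 2ℤ³ leaves coordinates in [0, 2), so the squared norm is at most 12 < 16.
    refine ⟨Metric.closedBall 0 4, isCompact_closedBall 0 4, fun q => ?_⟩
    have hmem : transl (halfPt (4 * fun i => ⌊q i / 2⌋)) ∈ G :=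
      h ((mem_translGroup_quarterGroup_bot_iff _).2 ⟨_, rfl⟩)
    refine ⟨_, hmem, q - halfPt (4 * fun i => ⌊q i / 2⌋), ?_, by
      rw [transl_apply, add_sub_cancel]⟩
    rw [mem_closedBall_zero_iff]
    have hb : ∀ i, ((q - halfPt (4 * fun i => ⌊q i / 2⌋)) i) ^ 2 ≤ 4 := by
      intro i
      have h1 := Int.floor_le (q i / 2)
      have h2 := Int.lt_floor_add_one (q i / 2)
      have h3 : (q - halfPt (4 * fun i => ⌊q i / 2⌋)) i = q i - 2 * ⌊q i / 2⌋ := by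
        simp; ring
      rw [h3]
      nlinarith
    have h0 := norm_sq_eq (q - halfPt (4 * fun i => ⌊q i / 2⌋))
    nlinarith [hb 0, hb 1, hb 2, norm_nonneg (q - halfPt (4 * fun i => ⌊q i / 2⌋))]

theorem isIrreducibleGroup_of_le {G : Subgroup Isom3} (h : quarterGroup ⊥ ≤ G) :
    IsIrreducibleGroup G := by
  rintro ⟨v, hv, hG⟩
  apply hv
  have h1 := hG _ (h rho_mem_quarterGroup_bot)
  have h2 := hG _ (h screw_mem_quarterGroup_bot)
  have h3 : v 0 = v 1 ∧ v 1 = v 2 := by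
    rcases h1 with h1 | h1
    · have a := congrArg (fun p : E3 => p 0) h1
      have b := congrArg (fun p : E3 => p 1) h1
      simp only [rho_linear] at a b
      simp at a b
      exact ⟨a.symm, b.symm⟩
    · have a := congrArg (fun p : E3 => p 0) h1
      have b := congrArg (fun p : E3 => p 1) h1
      have c := congrArg (fun p : E3 => p 2) h1
      simp only [rho_linear] at a b c
      simp at a b c
      constructor <;> linarith
  have h4 : v 2 = 0 := by
    rcases h2 with h2 | h2
    · have a := congrArg (fun p : E3 => p 0) h2
      simp [screw, sgnIso_linear] at a
      linarith
    · have a := congrArg (fun p : E3 => p 2) h2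
      simp [screw, sgnIso_linear] at a
      linarith
  ext i
  fin_cases i
  · simpa using h3.1.trans (h3.2.trans h4)
  · simpa using h3.2.trans h4
  · simpa using h4

theorem fullGroup_isIrreducibleSpaceGroup (H : Subgroup G16) :
    IsSpaceGroup (fullGroup H) ∧ IsIrreducibleGroup (fullGroup H) := by
  have h := quarterGroup_bot_le_fullGroup_bot.trans (bot_le_fullGroup H)
  exact ⟨isSpaceGroup_of_le h (fullGroup_le H), isIrreducibleGroup_of_le h⟩

theorem quarterGroup_isIrreducibleSpaceGroup (K : Subgroup G8) :
    IsSpaceGroup (quarterGroup K) ∧ IsIrreducibleGroup (quarterGroup K) :=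
  ⟨isSpaceGroup_of_le (bot_le_quarterGroup K) ((quarterGroup_le K).trans markedSymm_le_bccSymm),
    isIrreducibleGroup_of_le (bot_le_quarterGroup K)⟩

/-! ### Affine equivalence of the full and the quarter groups -/

/-- The inclusion of the isometries into the affine bijections. -/
noncomputable def toAffineHom : Isom3 →* (E3 ≃ᵃ[ℝ] E3) where
  toFun g := g.toAffineEquiv
  map_one' := rfl
  map_mul' _ _ := rfl

theorem toAffineHom_injective : Function.Injective toAffineHom :=
  AffineIsometryEquiv.toAffineEquiv_injective

/-- Conjugation of isometries by an affine bijection. -/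
noncomputable def affineConj (φ : E3 ≃ᵃ[ℝ] E3) : Isom3 →* (E3 ≃ᵃ[ℝ] E3) :=
  (MulAut.conj φ).toMonoidHom.comp toAffineHom

theorem affineConj_injective (φ : E3 ≃ᵃ[ℝ] E3) : Function.Injective (affineConj φ) :=
  (MulAut.conj φ).injective.comp toAffineHom_injective

theorem affinelyEquivalent_iff (G G' : Subgroup Isom3) :
    AffinelyEquivalent G G' ↔ ∃ φ, G.map (affineConj φ) = G'.map toAffineHom := by
  refine exists_congr fun φ => ?_
  exact SetLike.coe_set_eq (p := G.map (affineConj φ)) (q := G'.map toAffineHom)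

theorem affinelyEquivalent_of_conj {G G' : Subgroup Isom3} (g : Isom3)
    (h : G.map (MulAut.conj g).toMonoidHom = G') : AffinelyEquivalent G G' := by
  rw [affinelyEquivalent_iff]
  refine ⟨g.toAffineEquiv, ?_⟩
  rw [← h, Subgroup.map_map]
  rfl

theorem affineConj_oddSubgroup {G G' : Subgroup Isom3} {φ : E3 ≃ᵃ[ℝ] E3}
    (h : G.map (affineConj φ) = G'.map toAffineHom) :
    (oddSubgroup G).map (affineConj φ) = (oddSubgroup G').map toAffineHom := by
  rw [map_oddSubgroup _ _ (affineConj_injective φ), map_oddSubgroup _ _ toAffineHom_injective, h]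

theorem affine_apply (φ : E3 ≃ᵃ[ℝ] E3) (p v : E3) : φ (p + v) = φ p + φ.linear v := by
  have := φ.map_vadd p v
  rw [vadd_eq_add, vadd_eq_add, add_comm v, add_comm (φ.linear v)] at this
  exact this

theorem affineConj_eq_iff {φ : E3 ≃ᵃ[ℝ] E3} {x y : Isom3} :
    affineConj φ x = toAffineHom y ↔ ∀ p, φ (x p) = y (φ p) := by
  have h0 : affineConj φ x = toAffineHom y ↔ φ * toAffineHom x = toAffineHom y * φ :=
    mul_inv_eq_iff_eq_mul
  rw [h0]
  exact ⟨fun h p => congrArg (fun f : E3 ≃ᵃ[ℝ] E3 => f p) h, fun h => AffineEquiv.ext h⟩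

theorem affineConj_linear {φ : E3 ≃ᵃ[ℝ] E3} {x y : Isom3} (h : affineConj φ x = toAffineHom y)
    (v : E3) : φ.linear (x.linearIsometryEquiv v) = y.linearIsometryEquiv (φ.linear v) := by
  rw [affineConj_eq_iff] at h
  have h1 := h (0 + v)
  have h2 := h 0
  rw [zero_add] at h1
  rw [isom_apply x v, add_comm, affine_apply, h2, ← zero_add v, affine_apply, zero_add,
    isom_apply y (φ 0 + _), map_add, isom_apply y (φ 0)] at h1
  have h3 : φ.linear (x.linearIsometryEquiv v) + (y.linearIsometryEquiv (φ 0) + y 0) =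
      y.linearIsometryEquiv (φ.linear v) + (y.linearIsometryEquiv (φ 0) + y 0) := by
    rw [add_comm, h1]; abel
  exact add_right_cancel h3

/-- A linear map that is invariant under the rotations of the cube acts on norms by a scalar. -/
theorem norm_sq_of_tetrahedral {A : E3 →ₗ[ℝ] E3}
    (hr : ∀ v w : E3, inner ℝ (A (rho.linearIsometryEquiv v)) (A (rho.linearIsometryEquiv w)) =
      inner ℝ (A v) (A w))
    (hd : ∀ v w : E3, inner ℝ (A (screw.linearIsometryEquiv v))
      (A (screw.linearIsometryEquiv w)) = inner ℝ (A v) (A w)) :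
    ∃ c : ℝ, 0 ≤ c ∧ ∀ v, ‖A v‖ ^ 2 = c * ‖v‖ ^ 2 := by
  set b : Fin 3 → E3 := fun i => EuclideanSpace.single i 1 with hb
  have r0 : rho.linearIsometryEquiv (b 0) = b 2 := by
    ext i; rw [rho_linear]; fin_cases i <;> simp [hb]
  have r1 : rho.linearIsometryEquiv (b 1) = b 0 := by
    ext i; rw [rho_linear]; fin_cases i <;> simp [hb]
  have r2 : rho.linearIsometryEquiv (b 2) = b 1 := by
    ext i; rw [rho_linear]; fin_cases i <;> simp [hb]
  have d0 : screw.linearIsometryEquiv (b 0) = -b 0 := by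
    ext i; rw [screw, sgnIso_linear]; fin_cases i <;> simp [hb]
  have d2 : screw.linearIsometryEquiv (b 2) = b 2 := by
    ext i; rw [screw, sgnIso_linear]; fin_cases i <;> simp [hb]
  -- The half-turn negates one basis vector and fixes the other, so their images are orthogonal;
  -- `rho` carries this to the other pairs and equates the three norms.
  have h02 : inner ℝ (A (b 0)) (A (b 2)) = 0 := by
    have := hd (b 0) (b 2)
    rw [d0, d2, map_neg, inner_neg_left] at this
    linarith
  have h21 : inner ℝ (A (b 2)) (A (b 1)) = 0 := by
    have := hr (b 0) (b 2); rwa [r0, r2, h02] at this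
  have h10 : inner ℝ (A (b 1)) (A (b 0)) = 0 := by
    have := hr (b 2) (b 1); rwa [r2, r1, h21] at this
  have n0 : inner ℝ (A (b 2)) (A (b 2)) = inner ℝ (A (b 0)) (A (b 0)) := by
    have := hr (b 0) (b 0); rwa [r0] at this
  have n1 : inner ℝ (A (b 1)) (A (b 1)) = inner ℝ (A (b 0)) (A (b 0)) := by
    have := hr (b 1) (b 1); rw [r1] at this; exact this.symm
  refine ⟨inner ℝ (A (b 0)) (A (b 0)), real_inner_self_nonneg, fun v => ?_⟩
  have hv : v = v 0 • b 0 + v 1 • b 1 + v 2 • b 2 := by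
    ext i; fin_cases i <;> simp [hb]
  have h01 := h10
  have h12 := h21
  have h20 := h02
  rw [real_inner_comm] at h01 h12 h20
  have hA : A v = v 0 • A (b 0) + v 1 • A (b 1) + v 2 • A (b 2) := by
    conv_lhs => rw [hv]
    simp only [map_add, map_smul]
  rw [← real_inner_self_eq_norm_sq (A v), norm_sq_eq v, hA]
  simp only [inner_add_left, inner_add_right, inner_smul_left,
    inner_smul_right, h02, h20, h21, h12, h10, h01, n0, n1]
  simp
  ring

/-- The linear part of φ intertwines isometries with isometries, so the pulled-back inner product is
invariant under the linear parts of `T`. -/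
theorem exists_scale_of_affineConj {T T' : Subgroup Isom3} (hT : quarterGroup ⊥ ≤ T)
    {φ : E3 ≃ᵃ[ℝ] E3} (h : T.map (affineConj φ) = T'.map toAffineHom) :
    ∃ c : ℝ, 0 ≤ c ∧ ∀ v, ‖φ.linear v‖ ^ 2 = c * ‖v‖ ^ 2 := by
  have key : ∀ x ∈ T, ∀ v w : E3, inner ℝ (φ.linear (x.linearIsometryEquiv v))
      (φ.linear (x.linearIsometryEquiv w)) = inner ℝ (φ.linear v) (φ.linear w) := by
    intro x hx v w
    have : affineConj φ x ∈ T'.map toAffineHom := by rw [← h]; exact ⟨x, hx, rfl⟩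
    obtain ⟨y, -, hy⟩ := this
    rw [affineConj_linear hy.symm, affineConj_linear hy.symm, LinearIsometryEquiv.inner_map_map]
  exact norm_sq_of_tetrahedral (A := φ.linear.toLinearMap)
    (key rho (hT rho_mem_quarterGroup_bot)) (key screw (hT screw_mem_quarterGroup_bot))

theorem affineConj_transl (φ : E3 ≃ᵃ[ℝ] E3) (t : E3) :
    affineConj φ (transl t) = toAffineHom (transl (φ.linear t)) := by
  rw [affineConj_eq_iff]
  intro p
  rw [transl_apply, transl_apply, add_comm, affine_apply, add_comm]

theorem linear_mem_translGroup_iff {T T' : Subgroup Isom3} {φ : E3 ≃ᵃ[ℝ] E3}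
    (h : T.map (affineConj φ) = T'.map toAffineHom) (t : E3) :
    φ.linear t ∈ translGroup T' ↔ t ∈ translGroup T := by
  rw [mem_translGroup, mem_translGroup,
    ← Subgroup.mem_map_iff_mem (toAffineHom_injective) (K := T'), ← affineConj_transl, ← h,
    Subgroup.mem_map_iff_mem (affineConj_injective φ)]

/-- A similarity that preserves a lattice with a shortest vector preserves lengths: the image of the
shortest vector gives c ≥ 1 and its preimage c ≤ 1. -/
theorem exists_isom_of_affineConj {T : Subgroup Isom3} (hT : quarterGroup ⊥ ≤ T)
    {φ : E3 ≃ᵃ[ℝ] E3} (h : T.map (affineConj φ) = T.map toAffineHom) {m : ℝ} (hm : 0 < m)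
    (hmin : ∀ t ∈ translGroup T, t ≠ 0 → m ≤ ‖t‖ ^ 2) {t₀ : E3} (ht₀ : t₀ ∈ translGroup T)
    (hnorm : ‖t₀‖ ^ 2 = m) : ∃ g : Isom3, g.toAffineEquiv = φ := by
  obtain ⟨c, hc0, hc⟩ := exists_scale_of_affineConj hT h
  have hne : t₀ ≠ 0 := by rintro rfl; simp at hnorm; linarith
  have h1 := hmin _ ((linear_mem_translGroup_iff h t₀).2 ht₀) (by simpa using hne)
  rw [hc, hnorm] at h1
  have h1' : 1 ≤ c := by nlinarith
  have h2 : φ.linear (φ.linear.symm t₀) = t₀ := φ.linear.apply_symm_apply t₀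
  have h3 := hmin (φ.linear.symm t₀) ((linear_mem_translGroup_iff h _).1 (by rwa [h2]))
    (by simpa using hne)
  have h4 := hc (φ.linear.symm t₀)
  rw [h2, hnorm] at h4
  have h5 : c = 1 := by nlinarith
  refine ⟨⟨φ, fun v => ?_⟩, rfl⟩
  have h6 := hc v
  rw [h5, one_mul] at h6
  exact (sq_eq_sq₀ (norm_nonneg _) (norm_nonneg _)).1 h6

theorem mem_normalizer_of_affineConj {T : Subgroup Isom3} {g : Isom3}
    (h : T.map (affineConj g.toAffineEquiv) = T.map toAffineHom) :
    g ∈ Subgroup.normalizer (T : Set Isom3) := by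
  apply mem_normalizer_of_conj
  apply Subgroup.map_injective toAffineHom_injective
  rw [Subgroup.map_map, ← h]
  rfl

theorem exists_conj_of_affinelyEquivalent {T G G' : Subgroup Isom3} (hT : quarterGroup ⊥ ≤ T)
    {m : ℝ} (hm : 0 < m) (hmin : ∀ t ∈ translGroup T, t ≠ 0 → m ≤ ‖t‖ ^ 2) {t₀ : E3}
    (ht₀ : t₀ ∈ translGroup T) (hnorm : ‖t₀‖ ^ 2 = m) (hG : oddSubgroup G = T)
    (hG' : oddSubgroup G' = T) (h : AffinelyEquivalent G G') :
    ∃ g ∈ Subgroup.normalizer (T : Set Isom3), G.map (MulAut.conj g).toMonoidHom = G' := by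
  obtain ⟨φ, hφ⟩ := (affinelyEquivalent_iff G G').1 h
  have h1 := affineConj_oddSubgroup hφ
  rw [hG, hG'] at h1
  obtain ⟨g, rfl⟩ := exists_isom_of_affineConj hT h1 hm hmin ht₀ hnorm
  refine ⟨g, mem_normalizer_of_affineConj h1, ?_⟩
  apply Subgroup.map_injective toAffineHom_injective
  rw [Subgroup.map_map, ← hφ]
  rfl

theorem fullGroup_affinelyEquivalent_iff (H H' : Subgroup G16) :
    AffinelyEquivalent (fullGroup H) (fullGroup H') ↔
      ∃ γ : G16, H.map (MulAut.conj γ).toMonoidHom = H' := by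
  rw [← liftGroup_conj_iff signedHom_surjective, ← fullGroup_eq_liftGroup,
    ← fullGroup_eq_liftGroup]
  constructor
  · intro h
    suffices hc : ∃ g ∈ Subgroup.normalizer (fullGroup ⊥ : Set Isom3),
        (fullGroup H).map (MulAut.conj g).toMonoidHom = fullGroup H' by
      obtain ⟨g, hg, hgG⟩ := hc
      rw [← oddSubgroup_bccSymm, normalizer_oddSubgroup_bccSymm] at hg
      exact ⟨g, hg, hgG⟩
    refine exists_conj_of_affinelyEquivalent (T := fullGroup ⊥)
      (m := 2) (t₀ := halfPt (2 * ![1, 1, 0])) quarterGroup_bot_le_fullGroup_bot two_pos ?_ ?_ ?_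
      (oddSubgroup_fullGroup H) (oddSubgroup_fullGroup H') h
    · intro t ht hne
      obtain ⟨X, hX, rfl⟩ := (mem_translGroup_fullGroup_bot_iff t).1 ht
      have h1 : X 0 ^ 2 + X 1 ^ 2 + X 2 ^ 2 ≠ 0 := by
        intro h0
        have x0 : X 0 = 0 := by nlinarith [sq_nonneg (X 0), sq_nonneg (X 1), sq_nonneg (X 2)]
        have x1 : X 1 = 0 := by nlinarith [sq_nonneg (X 0), sq_nonneg (X 1), sq_nonneg (X 2)]
        have x2 : X 2 = 0 := by nlinarith [sq_nonneg (X 0), sq_nonneg (X 1), sq_nonneg (X 2)]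
        apply hne
        ext i
        fin_cases i <;> simp [x0, x1, x2]
      have h2 : (X 0 ^ 2 + X 1 ^ 2 + X 2 ^ 2) % 2 = 0 := by
        have : ∀ x : ℤ, x ^ 2 % 2 = x % 2 := fun x => by
          obtain ⟨k, hk | hk⟩ : ∃ k, x = 2 * k ∨ x = 2 * k + 1 := ⟨x / 2, by lia⟩ <;>
            rw [hk] <;> ring_nf <;> lia
        have s0 := this (X 0)
        have s1 := this (X 1)
        have s2 := this (X 2)
        lia
      have h3 : 2 ≤ X 0 ^ 2 + X 1 ^ 2 + X 2 ^ 2 := by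
        have : 0 ≤ X 0 ^ 2 + X 1 ^ 2 + X 2 ^ 2 := by positivity
        lia
      have h4 : (2 : ℝ) ≤ (X 0 : ℝ) ^ 2 + X 1 ^ 2 + X 2 ^ 2 := by exact_mod_cast h3
      rw [norm_sq_eq]
      simpa using h4
    · exact (mem_translGroup_fullGroup_bot_iff _).2 ⟨_, by decide, rfl⟩
    · rw [norm_sq_eq]; simp; norm_num
  · rintro ⟨g, -, h⟩
    exact affinelyEquivalent_of_conj g h

theorem quarterGroup_affinelyEquivalent_iff (K K' : Subgroup G8) :
    AffinelyEquivalent (quarterGroup K) (quarterGroup K') ↔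
      ∃ γ : G8, K.map (MulAut.conj γ).toMonoidHom = K' := by
  rw [← liftGroup_conj_iff permHom_surjective, ← quarterGroup_eq_liftGroup,
    ← quarterGroup_eq_liftGroup]
  constructor
  · intro h
    suffices hc : ∃ g ∈ Subgroup.normalizer (quarterGroup ⊥ : Set Isom3),
        (quarterGroup K).map (MulAut.conj g).toMonoidHom = quarterGroup K' by
      obtain ⟨g, hg, hgG⟩ := hc
      rw [← oddSubgroup_markedSymm, normalizer_oddSubgroup_markedSymm] at hg
      exact ⟨g, hg, hgG⟩
    refine exists_conj_of_affinelyEquivalent (T := quarterGroup ⊥)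
      (m := 4) (t₀ := halfPt (4 * ![1, 0, 0])) le_rfl four_pos ?_ ?_ ?_
      (oddSubgroup_quarterGroup K) (oddSubgroup_quarterGroup K') h
    · intro t ht hne
      obtain ⟨X, rfl⟩ := (mem_translGroup_quarterGroup_bot_iff t).1 ht
      have h1 : X 0 ^ 2 + X 1 ^ 2 + X 2 ^ 2 ≠ 0 := by
        intro h0
        have x0 : X 0 = 0 := by nlinarith [sq_nonneg (X 0), sq_nonneg (X 1), sq_nonneg (X 2)]
        have x1 : X 1 = 0 := by nlinarith [sq_nonneg (X 0), sq_nonneg (X 1), sq_nonneg (X 2)]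
        have x2 : X 2 = 0 := by nlinarith [sq_nonneg (X 0), sq_nonneg (X 1), sq_nonneg (X 2)]
        apply hne
        ext i
        fin_cases i <;> simp [x0, x1, x2]
      have h3 : 1 ≤ X 0 ^ 2 + X 1 ^ 2 + X 2 ^ 2 := by
        have : 0 ≤ X 0 ^ 2 + X 1 ^ 2 + X 2 ^ 2 := by positivity
        lia
      have h4 : (1 : ℝ) ≤ (X 0 : ℝ) ^ 2 + X 1 ^ 2 + X 2 ^ 2 := by exact_mod_cast h3
      rw [norm_sq_eq]
      simp
      linarith
    · exact (mem_translGroup_quarterGroup_bot_iff _).2 ⟨_, rfl⟩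
    · rw [norm_sq_eq]; simp; norm_num
  · rintro ⟨g, -, h⟩
    exact affinelyEquivalent_of_conj g h

/-! ### Full groups are not equivalent to quarter groups -/

theorem delta_mul_self : delta * delta = 1 := by
  ext p i
  fin_cases i <;> simp [delta, isom_mul_apply, sgnIso_apply]

theorem delta_ne_one : delta ≠ 1 := by
  intro h
  have := congrArg (fun g : Isom3 => g (EuclideanSpace.single 0 1) 0) h
  simp [delta, sgnIso_apply] at this
  norm_num at this

theorem exists_axis_sign : ∀ e : Fin 3 → ℤˣ, (∏ i, e i) = 1 → e ≠ 1 →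
    ∃ i, e i = 1 ∧ e (i + 2) = -1 := by
  decide

theorem eq_one_of_mem_quarterGroup_bot {g : Isom3} (hg : g ∈ quarterGroup ⊥) (h : g * g = 1) :
    g = 1 := by
  obtain ⟨s, e, L, hs, he, hL, rfl⟩ := (mem_quarterGroup_bot_iff_exists g).1 hg
  set t := halfPt (L + shift s e) with ht
  have hl : ∀ (p : E3) (i : Fin 3), ((e i : ℤ) : ℝ) * (((e (s i) : ℤ) : ℝ) * p (s (s i)) + t (s i)) + t i = p i :=
    fun p i => by
      have := congrArg (fun g : Isom3 => g p i) h
      simpa [isom_mul_apply, sgnIso_apply] using this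
  have hss : ∀ i, s (s i) = i := by
    intro i
    by_contra hne
    have h0 := hl 0 i
    have h1 := hl (EuclideanSpace.single i 1) i
    simp [hne] at h0 h1
    linarith
  have hs1 : s = 1 := by
    have : ∀ s : Equiv.Perm (Fin 3), Equiv.Perm.sign s = 1 → (∀ i, s (s i) = i) → s = 1 := by
      decide
    exact this s hs hss
  by_cases h1 : e = 1
  · have h0 : t = 0 := by
      ext i
      have := hl 0 i
      simp [h1, hs1] at this
      simp
      linarith
    rw [h0, h1, hs1, ← transl_eq_sgnIso, transl_zero]
  -- The motion is a screw: along its axis `i` the doubled translation is `L i + 2`, which is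
  -- nonzero because 4 divides `L i`.
  · obtain ⟨i, hi, hi2⟩ := exists_axis_sign e he h1
    have h0 := hl 0 i
    simp [hs1, hi] at h0
    have h2 : t i = 0 := by linarith
    rw [ht, halfPt_apply] at h2
    have h3 : (L + shift s e) i = 0 := by
      have : ((L + shift s e) i : ℝ) = 0 := by linarith
      exact_mod_cast this
    rw [shift_of_even s e hs] at h3
    simp [hi2] at h3
    have := hL i
    lia

/-- An equivalence would match the odd subgroups, but T₁ contains the involution `delta` and T₂
contains none. -/
theorem not_affinelyEquivalent_full_quarter (H : Subgroup G16) (K : Subgroup G8) :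
    ¬ AffinelyEquivalent (fullGroup H) (quarterGroup K) := by
  intro h
  obtain ⟨φ, hφ⟩ := (affinelyEquivalent_iff _ _).1 h
  have h1 := affineConj_oddSubgroup hφ
  rw [oddSubgroup_fullGroup, oddSubgroup_quarterGroup] at h1
  have h2 : affineConj φ delta ∈ (quarterGroup ⊥).map toAffineHom := by
    rw [← h1]; exact ⟨_, delta_mem_fullGroup_bot, rfl⟩
  obtain ⟨y, hy, hyd⟩ := h2
  have h3 : y * y = 1 := by
    apply toAffineHom_injective
    rw [map_mul, hyd, ← map_mul, delta_mul_self, map_one, map_one]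
  rw [eq_one_of_mem_quarterGroup_bot hy h3, map_one] at hyd
  exact delta_ne_one (affineConj_injective φ (by rw [← hyd, map_one]))

/-! ### Orthogonal matrices in dimension three -/

abbrev Mat3 : Type := Matrix (Fin 3) (Fin 3) ℝ

/-- The matrix of a linear isometry in the standard basis. -/
noncomputable def mat (A : E3 ≃ₗᵢ[ℝ] E3) : Mat3 :=
  Matrix.of fun i j => A (EuclideanSpace.single j 1) i

theorem mat_apply (A : E3 ≃ₗᵢ[ℝ] E3) (i j : Fin 3) :
    mat A i j = A (EuclideanSpace.single j 1) i := rfl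

theorem eq_sum_single (v : E3) : v = ∑ j, v j • EuclideanSpace.single j (1 : ℝ) := by
  ext i; simp [Fin.sum_univ_three]; fin_cases i <;> simp

theorem apply_eq_sum_mat (A : E3 ≃ₗᵢ[ℝ] E3) (v : E3) (i : Fin 3) :
    A v i = ∑ j, mat A i j * v j := by
  conv_lhs => rw [eq_sum_single v, map_sum]
  simp [mat_apply, Fin.sum_univ_three, mul_comm]

theorem mat_one : mat 1 = 1 := by
  ext i j; simp [mat_apply, Matrix.one_apply]

theorem mat_mul (A B : E3 ≃ₗᵢ[ℝ] E3) : mat (A * B) = mat A * mat B := by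
  ext i j
  rw [Matrix.mul_apply]
  exact apply_eq_sum_mat A _ i

theorem mat_injective : Function.Injective mat := fun A B h => by
  ext v i; rw [apply_eq_sum_mat, apply_eq_sum_mat, h]

theorem mat_inv (A : E3 ≃ₗᵢ[ℝ] E3) : mat A⁻¹ = (mat A).transpose := by
  ext i j
  have h := A.inner_map_map (A⁻¹ (EuclideanSpace.single j 1)) (EuclideanSpace.single i 1)
  have h1 : A (A⁻¹ (EuclideanSpace.single j 1)) = EuclideanSpace.single j (1 : ℝ) :=
    A.apply_symm_apply _
  rw [h1, EuclideanSpace.inner_single_left, EuclideanSpace.inner_single_right] at h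
  simpa [mat_apply] using h.symm

theorem mat_mul_transpose (A : E3 ≃ₗᵢ[ℝ] E3) : mat A * (mat A).transpose = 1 := by
  rw [← mat_inv, ← mat_mul, mul_inv_cancel, mat_one]

theorem det_mat (A : E3 ≃ₗᵢ[ℝ] E3) : (mat A).det = 1 ∨ (mat A).det = -1 := by
  have h := congrArg Matrix.det (mat_mul_transpose A)
  rw [Matrix.det_mul, Matrix.det_transpose, Matrix.det_one] at h
  exact mul_self_eq_one_iff.1 h

/-- Rotations: the linear isometries of determinant one. -/
noncomputable def rotations : Subgroup (E3 ≃ₗᵢ[ℝ] E3) where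
  carrier := {A | (mat A).det = 1}
  mul_mem' {A B} hA hB := by
    change (mat (A * B)).det = 1
    rw [mat_mul, Matrix.det_mul, hA, hB, one_mul]
  one_mem' := by change (mat 1).det = 1; rw [mat_one, Matrix.det_one]
  inv_mem' {A} hA := by
    change (mat A⁻¹).det = 1
    rw [mat_inv, Matrix.det_transpose]; exact hA

theorem mem_rotations (A : E3 ≃ₗᵢ[ℝ] E3) : A ∈ rotations ↔ (mat A).det = 1 := Iff.rfl

theorem adjugate_mat {A : E3 ≃ₗᵢ[ℝ] E3} (hA : A ∈ rotations) :
    (mat A).adjugate = (mat A).transpose := by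
  have h : (mat A).adjugate * mat A * (mat A).transpose = (mat A).transpose := by
    rw [Matrix.adjugate_mul, (mem_rotations A).1 hA, one_smul, one_mul]
  rwa [mul_assoc, mat_mul_transpose, mul_one] at h

theorem cofactors {A : E3 ≃ₗᵢ[ℝ] E3} (hA : A ∈ rotations) (i j : Fin 3) :
    mat A i j = mat A (i + 1) (j + 1) * mat A (i + 2) (j + 2) -
      mat A (i + 1) (j + 2) * mat A (i + 2) (j + 1) := by
  have h := congrFun (congrFun (adjugate_mat hA) j) i
  rw [Matrix.transpose_apply] at h
  rw [← h, Matrix.adjugate_fin_three]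
  fin_cases i <;> fin_cases j <;> simp <;> ring

/-- From (A - 1) Aᵀ = -(A - 1)ᵀ in odd dimension, det (A - 1) is its own negative. -/
theorem exists_fixed {A : E3 ≃ₗᵢ[ℝ] E3} (hA : A ∈ rotations) : ∃ u : E3, u ≠ 0 ∧ A u = u := by
  have h : (mat A - 1).det = 0 := by
    have h1 : (mat A - 1) * (mat A).transpose = -(mat A - 1).transpose := by
      rw [sub_mul, mat_mul_transpose, Matrix.transpose_sub, Matrix.transpose_one]; simp
    have h2 := congrArg Matrix.det h1
    rw [Matrix.det_mul, Matrix.det_transpose, (mem_rotations A).1 hA, Matrix.det_neg,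
      Matrix.det_transpose] at h2
    simp at h2
    linarith
  obtain ⟨v, hv, h⟩ := Matrix.exists_mulVec_eq_zero_iff.2 h
  refine ⟨WithLp.toLp 2 v, fun h0 => hv ?_, ?_⟩
  · ext i; exact congrArg (fun p : E3 => p i) h0
  · ext i
    rw [apply_eq_sum_mat]
    rw [Matrix.sub_mulVec, Matrix.one_mulVec, sub_eq_zero] at h
    exact congrFun h i

theorem exists_neg_fixed {A : E3 ≃ₗᵢ[ℝ] E3} (hA : (mat A).det = -1) :
    ∃ u : E3, u ≠ 0 ∧ A u = -u := by
  have h : (mat A + 1).det = 0 := by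
    have h1 : (mat A + 1) * (mat A).transpose = (mat A + 1).transpose := by
      rw [add_mul, mat_mul_transpose, Matrix.transpose_add, Matrix.transpose_one, one_mul,
        add_comm]
    have h2 := congrArg Matrix.det h1
    rw [Matrix.det_mul, Matrix.det_transpose, hA, Matrix.det_transpose] at h2
    linarith
  obtain ⟨v, hv, h⟩ := Matrix.exists_mulVec_eq_zero_iff.2 h
  refine ⟨WithLp.toLp 2 v, fun h0 => hv ?_, ?_⟩
  · ext i; exact congrArg (fun p : E3 => p i) h0
  · ext i
    rw [apply_eq_sum_mat]
    rw [Matrix.add_mulVec, Matrix.one_mulVec, add_eq_zero_iff_eq_neg] at h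
    exact congrFun h i

/-- The cross product of two vectors. -/
noncomputable def cross3 (u v : E3) : E3 :=
  WithLp.toLp 2 fun i => u (i + 1) * v (i + 2) - u (i + 2) * v (i + 1)

theorem cross3_apply (u v : E3) (i : Fin 3) :
    cross3 u v i = u (i + 1) * v (i + 2) - u (i + 2) * v (i + 1) := rfl

theorem map_cross {A : E3 ≃ₗᵢ[ℝ] E3} (hA : A ∈ rotations) (u v : E3) :
    A (cross3 u v) = cross3 (A u) (A v) := by
  ext i
  rw [cross3_apply]
  simp only [apply_eq_sum_mat, Fin.sum_univ_three]
  have h := cofactors hA i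
  have h0 := h 0
  have h1 := h 1
  have h2 := h 2
  simp only [cross3_apply]
  rw [h0, h1, h2]
  fin_cases i <;> simp <;> ring

theorem exists_smul_of_cross_eq_zero {u v : E3} (hu : u ≠ 0) (h : cross3 u v = 0) :
    ∃ c : ℝ, v = c • u := by
  have h' : ∀ i, u (i + 1) * v (i + 2) = u (i + 2) * v (i + 1) := fun i => by
    have := congrArg (fun p : E3 => p i) h
    rw [cross3_apply] at this
    exact sub_eq_zero.1 this
  have h0 := h' 0
  have h1 := h' 1
  have h2 := h' 2
  have e1 : (2 : Fin 3) + 1 = 0 := rfl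
  have e2 : (2 : Fin 3) + 2 = 1 := rfl
  have e3 : (1 : Fin 3) + 2 = 0 := rfl
  have e4 : (1 : Fin 3) + 1 = 2 := rfl
  simp only [zero_add, e1, e2, e3, e4] at h0 h1 h2
  obtain ⟨j, hj⟩ : ∃ j, u j ≠ 0 := by
    by_contra hn
    push Not at hn
    exact hu (by ext i; exact hn i)
  refine ⟨v j / u j, ?_⟩
  ext i
  rw [PiLp.smul_apply, smul_eq_mul, div_mul_eq_mul_div, eq_div_iff hj]
  fin_cases j <;> fin_cases i <;> simp <;> linarith

/-- A rotation commutes with the cross product, so it fixes the basis u, v, u × v. -/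
theorem eq_one_of_fixed_of_cross_ne_zero {A : E3 ≃ₗᵢ[ℝ] E3} (hA : A ∈ rotations) {u v : E3}
    (hu : A u = u) (hv : A v = v) (h : cross3 u v ≠ 0) : A = 1 := by
  have hw := map_cross hA u v
  rw [hu, hv] at hw
  set w := cross3 u v with hwdef
  have hww : w 0 * w 0 + w 1 * w 1 + w 2 * w 2 ≠ 0 := by
    intro h0
    apply h
    have a0 : w 0 = 0 := by nlinarith [mul_self_nonneg (w 0), mul_self_nonneg (w 1), mul_self_nonneg (w 2)]
    have a1 : w 1 = 0 := by nlinarith [mul_self_nonneg (w 0), mul_self_nonneg (w 1), mul_self_nonneg (w 2)]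
    have a2 : w 2 = 0 := by nlinarith [mul_self_nonneg (w 0), mul_self_nonneg (w 1), mul_self_nonneg (w 2)]
    ext i; fin_cases i <;> simp [a0, a1, a2]
  have w0 : w 0 = u 1 * v 2 - u 2 * v 1 := rfl
  have w1 : w 1 = u 2 * v 0 - u 0 * v 2 := rfl
  have w2 : w 2 = u 0 * v 1 - u 1 * v 0 := rfl
  let M : Mat3 := Matrix.of fun i j => (![u i, v i, w i] : Fin 3 → ℝ) j
  have hM : IsUnit M.det := by
    rw [isUnit_iff_ne_zero]
    convert hww using 1
    rw [Matrix.det_fin_three]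
    simp [M]
    rw [w0, w1, w2]
    ring
  have hAM : mat A * M = M := by
    ext i j
    rw [Matrix.mul_apply]
    fin_cases j
    · exact (apply_eq_sum_mat A u i).symm.trans (congrArg (fun p : E3 => p i) hu)
    · exact (apply_eq_sum_mat A v i).symm.trans (congrArg (fun p : E3 => p i) hv)
    · exact (apply_eq_sum_mat A w i).symm.trans (congrArg (fun p : E3 => p i) hw)
  apply mat_injective
  rw [mat_one]
  have h1 := congrArg (· * M⁻¹) hAM
  simpa [mul_assoc, Matrix.mul_nonsing_inv M hM] using h1

/-- A nontrivial rotation has an axis. -/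
theorem exists_axis {A : E3 ≃ₗᵢ[ℝ] E3} (hA : A ∈ rotations) (h1 : A ≠ 1) :
    ∃ u : E3, u ≠ 0 ∧ A u = u ∧ ∀ v, A v = v → ∃ c : ℝ, v = c • u := by
  obtain ⟨u, hu, hAu⟩ := exists_fixed hA
  refine ⟨u, hu, hAu, fun v hv => exists_smul_of_cross_eq_zero hu ?_⟩
  by_contra h
  exact h1 (eq_one_of_fixed_of_cross_ne_zero hA hAu hv h)

theorem eq_or_eq_neg_of_smul {u v : E3} (h : ‖u‖ = ‖v‖) (hu : ∃ c : ℝ, v = c • u) :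
    v = u ∨ v = -u := by
  obtain ⟨c, rfl⟩ := hu
  by_cases h0 : u = 0
  · left; simp [h0]
  rw [norm_smul] at h
  have h1 : ‖c‖ = 1 := by
    have := norm_ne_zero_iff.2 h0
    field_simp at h
    linarith
  rw [Real.norm_eq_abs] at h1
  rcases (abs_eq zero_le_one).1 h1 with rfl | rfl
  · left; simp
  · right; simp

/-! ### Traces of rotations -/

/-- The trace of a linear isometry. -/
noncomputable def tr (A : E3 ≃ₗᵢ[ℝ] E3) : ℝ := (mat A).trace

theorem tr_eq (A : E3 ≃ₗᵢ[ℝ] E3) : tr A = mat A 0 0 + mat A 1 1 + mat A 2 2 := by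
  rw [tr, Matrix.trace_fin_three]

/-- The Cayley–Hamilton identity for rotations. -/
theorem mat_mul_self {A : E3 ≃ₗᵢ[ℝ] E3} (hA : A ∈ rotations) :
    mat A * mat A = (mat A).transpose + tr A • mat A - tr A • (1 : Mat3) := by
  have h := cofactors hA
  ext i j
  rw [Matrix.mul_apply, Fin.sum_univ_three, tr_eq]
  have h00 := h 0 0
  have h01 := h 0 1
  have h02 := h 0 2
  have h10 := h 1 0
  have h11 := h 1 1
  have h12 := h 1 2
  have h20 := h 2 0
  have h21 := h 2 1
  have h22 := h 2 2
  have e1 : (2 : Fin 3) + 1 = 0 := rfl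
  have e2 : (2 : Fin 3) + 2 = 1 := rfl
  have e3 : (1 : Fin 3) + 2 = 0 := rfl
  have e4 : (1 : Fin 3) + 1 = 2 := rfl
  simp only [zero_add, e1, e2, e3, e4] at h00 h01 h02 h10 h11 h12 h20 h21 h22
  fin_cases i <;> fin_cases j <;> simp <;> linarith

theorem tr_mul_self {A : E3 ≃ₗᵢ[ℝ] E3} (hA : A ∈ rotations) :
    tr (A * A) = tr A ^ 2 - 2 * tr A := by
  rw [tr, mat_mul, mat_mul_self hA, Matrix.trace_sub, Matrix.trace_add, Matrix.trace_smul,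
    Matrix.trace_smul, Matrix.trace_transpose, Matrix.trace_one]
  rw [← tr]
  simp
  ring

/-- For trace zero the Cayley–Hamilton identity collapses to A² = Aᵀ. -/
theorem cube_eq_one_of_tr {A : E3 ≃ₗᵢ[ℝ] E3} (hA : A ∈ rotations) (h : tr A = 0) :
    A ^ 3 = 1 := by
  apply mat_injective
  rw [pow_three, mat_mul, mat_mul, mat_mul_self hA, h, mat_one]
  simp [mat_mul_transpose]

theorem fourth_eq_one_of_tr {A : E3 ≃ₗᵢ[ℝ] E3} (hA : A ∈ rotations) (h : tr A = 1) :
    A ^ 4 = 1 := by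
  have h2 : mat (A * A * A) = 1 + mat A * mat A - mat A := by
    rw [mul_assoc, mat_mul, mat_mul, mat_mul_self hA, h, one_smul, one_smul, mul_sub, mul_add,
      mat_mul_transpose, mul_one, mat_mul_self hA, h, one_smul, one_smul]
  apply mat_injective
  rw [show A ^ 4 = A * (A * A * A) by rw [pow_succ', pow_three, mul_assoc], mat_mul, h2, mul_sub, mul_add, mul_one, ← mat_mul,
    ← mat_mul, ← mul_assoc, h2, mat_one, mat_mul]
  abel

/-- The axial vector of a rotation. -/
noncomputable def axial (A : E3 ≃ₗᵢ[ℝ] E3) : E3 :=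
  WithLp.toLp 2 fun i => mat A (i + 2) (i + 1) - mat A (i + 1) (i + 2)

theorem axial_apply (A : E3 ≃ₗᵢ[ℝ] E3) (i : Fin 3) :
    axial A i = mat A (i + 2) (i + 1) - mat A (i + 1) (i + 2) := rfl

/-- For a rotation by θ the axial vector has length 2 |sin θ| and the trace is 1 + 2 cos θ. In
particular the axial vector has squared length 3 when the trace vanishes. -/
theorem norm_axial_sq {A : E3 ≃ₗᵢ[ℝ] E3} (hA : A ∈ rotations) :
    ‖axial A‖ ^ 2 = (3 - tr A) * (1 + tr A) := by
  have h1 := congrArg Matrix.trace (mat_mul_transpose A)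
  have h2 := tr_mul_self hA
  rw [tr_eq (A * A), mat_mul] at h2
  rw [Matrix.trace_fin_three] at h1
  simp only [Matrix.mul_apply, Fin.sum_univ_three, Matrix.transpose_apply, Matrix.trace_one,
    Fintype.card_fin] at h1 h2
  have e1 : (2 : Fin 3) + 1 = 0 := rfl
  have e2 : (2 : Fin 3) + 2 = 1 := rfl
  have e3 : (1 : Fin 3) + 2 = 0 := rfl
  have e4 : (1 : Fin 3) + 1 = 2 := rfl
  rw [norm_sq_eq]
  simp only [axial_apply, zero_add, e1, e2, e3, e4]
  push_cast at h1
  linarith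

theorem tr_le_three {A : E3 ≃ₗᵢ[ℝ] E3} (hA : A ∈ rotations) : -1 ≤ tr A ∧ tr A ≤ 3 := by
  have h := norm_axial_sq hA
  have h1 : 0 ≤ (3 - tr A) * (1 + tr A) := by rw [← h]; positivity
  constructor <;> nlinarith

theorem map_axial {A : E3 ≃ₗᵢ[ℝ] E3} (hA : A ∈ rotations) : A (axial A) = axial A := by
  have h := cofactors hA
  ext i
  rw [apply_eq_sum_mat, Fin.sum_univ_three]
  have h01 := h 0 1
  have h02 := h 0 2
  have h10 := h 1 0
  have h12 := h 1 2
  have h20 := h 2 0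
  have h21 := h 2 1
  have e1 : (2 : Fin 3) + 1 = 0 := rfl
  have e2 : (2 : Fin 3) + 2 = 1 := rfl
  have e3 : (1 : Fin 3) + 2 = 0 := rfl
  have e4 : (1 : Fin 3) + 1 = 2 := rfl
  simp only [zero_add, e1, e2, e3, e4] at h01 h02 h10 h12 h20 h21
  simp only [axial_apply, zero_add, e1, e2, e3, e4]
  fin_cases i <;> simp <;> linarith

theorem mul_self_eq_one_of_tr {A : E3 ≃ₗᵢ[ℝ] E3} (hA : A ∈ rotations) (h : tr A = -1) :
    A * A = 1 := by
  have hw := norm_axial_sq hA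
  rw [h] at hw
  have h0 : axial A = 0 := by
    rw [← norm_eq_zero]
    have : ‖axial A‖ ^ 2 = 0 := by rw [hw]; norm_num
    exact pow_eq_zero_iff two_ne_zero |>.1 this
  have h1 : ∀ i, mat A (i + 2) (i + 1) = mat A (i + 1) (i + 2) := fun i => by
    have := congrArg (fun p : E3 => p i) h0
    rw [axial_apply] at this
    exact sub_eq_zero.1 this
  have h2 : (mat A).transpose = mat A := by
    ext i j
    have a := h1 0
    have b := h1 1
    have c := h1 2
    fin_cases i <;> fin_cases j <;>
      first | rfl | exact a | exact b | exact c | exact a.symm | exact b.symm | exact c.symm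
  have h3 := mat_mul_transpose A
  rw [h2] at h3
  apply mat_injective
  rw [mat_mul, h3, mat_one]

/-- The squared entries of A - 1 add up to 6 - 2 tr A. -/
theorem eq_one_of_tr {A : E3 ≃ₗᵢ[ℝ] E3} (h : tr A = 3) : A = 1 := by
  have h1 := mat_mul_transpose A
  have hrow : ∀ i, mat A i 0 ^ 2 + mat A i 1 ^ 2 + mat A i 2 ^ 2 = 1 := fun i => by
    have := congrFun (congrFun h1 i) i
    simp only [Matrix.mul_apply, Fin.sum_univ_three, Matrix.transpose_apply,
      Matrix.one_apply_eq] at this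
    linarith
  rw [tr_eq] at h
  have r0 := hrow 0
  have r1 := hrow 1
  have r2 := hrow 2
  have hs : (mat A 0 0 - 1) ^ 2 + (mat A 1 1 - 1) ^ 2 + (mat A 2 2 - 1) ^ 2 + mat A 0 1 ^ 2 +
      mat A 0 2 ^ 2 + mat A 1 0 ^ 2 + mat A 1 2 ^ 2 + mat A 2 0 ^ 2 + mat A 2 1 ^ 2 = 0 := by
    linarith
  have z : ∀ x : ℝ, x ^ 2 ≤ 0 → x = 0 := fun x hx => by
    have := sq_nonneg x
    exact pow_eq_zero_iff two_ne_zero |>.1 (le_antisymm hx this)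
  have p1 := sq_nonneg (mat A 0 0 - 1)
  have p2 := sq_nonneg (mat A 1 1 - 1)
  have p3 := sq_nonneg (mat A 2 2 - 1)
  have p4 := sq_nonneg (mat A 0 1)
  have p5 := sq_nonneg (mat A 0 2)
  have p6 := sq_nonneg (mat A 1 0)
  have p7 := sq_nonneg (mat A 1 2)
  have p8 := sq_nonneg (mat A 2 0)
  have p9 := sq_nonneg (mat A 2 1)
  have q1 := z (mat A 0 0 - 1) (by linarith)
  have q2 := z (mat A 1 1 - 1) (by linarith)
  have q3 := z (mat A 2 2 - 1) (by linarith)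
  apply mat_injective
  rw [mat_one]
  ext i j
  fin_cases i <;> fin_cases j <;> simp
  · linarith
  · exact z _ (by linarith)
  · exact z _ (by linarith)
  · exact z _ (by linarith)
  · linarith
  · exact z _ (by linarith)
  · exact z _ (by linarith)
  · exact z _ (by linarith)
  · linarith

/-- A rotation of trace zero in terms of its axial vector. -/
theorem two_mul_mat_of_tr {A : E3 ≃ₗᵢ[ℝ] E3} (hA : A ∈ rotations) (h : tr A = 0) (i j : Fin 3) :
    mat A i j + mat A j i = axial A i * axial A j - (1 : Mat3) i j := by
  have hCH : mat A * mat A = (mat A).transpose := by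
    rw [mat_mul_self hA, h]; simp
  have hCH' : (mat A).transpose * (mat A).transpose = mat A := by
    rw [← Matrix.transpose_mul, hCH, Matrix.transpose_transpose]
  have hT : (mat A).transpose * mat A = 1 := by
    rw [← mat_inv, ← mat_mul, inv_mul_cancel, mat_one]
  -- The antisymmetric matrix A - Aᵀ is the cross product with the axial vector a, so its square is
  -- a aᵀ - |a|², with |a|² = 3.
  have hK : (mat A - (mat A).transpose) * (mat A - (mat A).transpose) =
      (mat A).transpose + mat A - (1 + 1) := by
    rw [sub_mul, mul_sub, mul_sub, hCH, hCH', hT, mat_mul_transpose]; abel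
  have hn := norm_axial_sq hA
  rw [h, norm_sq_eq] at hn
  have e1 : (2 : Fin 3) + 1 = 0 := rfl
  have e2 : (2 : Fin 3) + 2 = 1 := rfl
  have e3 : (1 : Fin 3) + 2 = 0 := rfl
  have e4 : (1 : Fin 3) + 1 = 2 := rfl
  have hij := congrFun (congrFun hK i) j
  simp only [axial_apply, Matrix.mul_apply, Fin.sum_univ_three, zero_add, e1, e2, e3, e4] at hn hij
  fin_cases i <;> fin_cases j <;>
    simp [axial_apply, e1, e2, e3, e4] at hij ⊢ <;> linarith

theorem mat_of_tr {A : E3 ≃ₗᵢ[ℝ] E3} (hA : A ∈ rotations) (h : tr A = 0) (i : Fin 3) :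
    2 * mat A i i = axial A i ^ 2 - 1 ∧
    2 * mat A (i + 2) (i + 1) = axial A (i + 1) * axial A (i + 2) + axial A i ∧
    2 * mat A (i + 1) (i + 2) = axial A (i + 1) * axial A (i + 2) - axial A i := by
  have h1 := two_mul_mat_of_tr hA h i i
  have h2 := two_mul_mat_of_tr hA h (i + 1) (i + 2)
  have h3 := axial_apply A i
  rw [Matrix.one_apply_eq] at h1
  rw [Matrix.one_apply_ne (by fin_cases i <;> decide)] at h2
  refine ⟨by linarith, by linarith, by linarith⟩

/-- Integral traces of A B and A B⁻¹ will restrict the angle between the axes of two rotations of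
order 3 through this formula. -/
theorem four_mul_tr_mul {A B : E3 ≃ₗᵢ[ℝ] E3} (hA : A ∈ rotations) (hB : B ∈ rotations)
    (hA0 : tr A = 0) (hB0 : tr B = 0) :
    4 * tr (A * B) = inner ℝ (axial A) (axial B) ^ 2 - 2 * inner ℝ (axial A) (axial B) - 3 := by
  have hk : inner ℝ (axial A) (axial B) =
      axial A 0 * axial B 0 + axial A 1 * axial B 1 + axial A 2 * axial B 2 := by
    rw [PiLp.inner_apply, Fin.sum_univ_three]
    simp [mul_comm]
  have na := norm_axial_sq hA
  have nb := norm_axial_sq hB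
  rw [norm_sq_eq, hA0] at na
  rw [norm_sq_eq, hB0] at nb
  obtain ⟨a00, a21, a12⟩ := mat_of_tr hA hA0 0
  obtain ⟨a11, a02, a20⟩ := mat_of_tr hA hA0 1
  obtain ⟨a22, a10, a01⟩ := mat_of_tr hA hA0 2
  obtain ⟨b00, b21, b12⟩ := mat_of_tr hB hB0 0
  obtain ⟨b11, b02, b20⟩ := mat_of_tr hB hB0 1
  obtain ⟨b22, b10, b01⟩ := mat_of_tr hB hB0 2
  have e1 : (2 : Fin 3) + 1 = 0 := rfl
  have e2 : (2 : Fin 3) + 2 = 1 := rfl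
  have e3 : (1 : Fin 3) + 2 = 0 := rfl
  have e4 : (1 : Fin 3) + 1 = 2 := rfl
  simp only [zero_add, e1, e2, e3, e4] at a00 a21 a12 a11 a02 a20 a22 a10 a01 b00 b21 b12 b11 b02 b20 b22 b10 b01
  have ht : 4 * tr (A * B) = ∑ i, ∑ j, (2 * mat A i j) * (2 * mat B j i) := by
    rw [tr_eq, mat_mul]
    simp only [Matrix.mul_apply, Fin.sum_univ_three]
    ring
  rw [ht, hk]
  simp only [Fin.sum_univ_three]
  rw [a00, a21, a12, a11, a02, a20, a22, a10, a01, b00, b21, b12, b11, b02, b20, b22, b10, b01]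
  linear_combination (-1 : ℝ) * na - nb

/-! ### Bieberbach's argument for irreducible space groups -/

/-- `A` moves every vector by at most `c` times its length. -/
def Near (c : ℝ) (A : E3 ≃ₗᵢ[ℝ] E3) : Prop := ∀ v, ‖A v - v‖ ≤ c * ‖v‖

theorem Near.inv {c : ℝ} {A : E3 ≃ₗᵢ[ℝ] E3} (h : Near c A) : Near c A⁻¹ := fun v => by
  have h1 : A (A⁻¹ v) = v := A.apply_symm_apply v
  have h2 := h (A⁻¹ v)
  rw [h1, LinearIsometryEquiv.norm_map] at h2
  rwa [norm_sub_rev]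

theorem Near.conj {c : ℝ} {A : E3 ≃ₗᵢ[ℝ] E3} (h : Near c A) (B : E3 ≃ₗᵢ[ℝ] E3) :
    Near c (B * A * B⁻¹) := fun v => by
  have h1 : B (B⁻¹ v) = v := B.apply_symm_apply v
  have h2 := h (B⁻¹ v)
  rw [LinearIsometryEquiv.norm_map, ← B.norm_map, map_sub, h1] at h2
  exact h2

/-- A B - B A = (A - 1)(B - 1) - (B - 1)(A - 1), hence the product of the two bounds. -/
theorem norm_commutator_le {a b : ℝ} {A B : E3 ≃ₗᵢ[ℝ] E3} (ha0 : 0 ≤ a) (hb0 : 0 ≤ b)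
    (ha : Near a A) (hb : Near b B) (v : E3) : ‖A (B v) - B (A v)‖ ≤ 2 * a * b * ‖v‖ := by
  have h1 : A (B v) - B (A v) = (A (B v - v) - (B v - v)) - (B (A v - v) - (A v - v)) := by
    rw [map_sub, map_sub]; abel
  have h2 := (ha (B v - v)).trans (mul_le_mul_of_nonneg_left (hb v) ha0)
  have h3 := (hb (A v - v)).trans (mul_le_mul_of_nonneg_left (ha v) hb0)
  rw [h1]
  have h4 := norm_sub_le (A (B v - v) - (B v - v)) (B (A v - v) - (A v - v))
  linarith

theorem Near.commutator {a b : ℝ} {A B : E3 ≃ₗᵢ[ℝ] E3} (ha0 : 0 ≤ a) (hb0 : 0 ≤ b)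
    (ha : Near a A) (hb : Near b B) : Near (2 * a * b) (A * B * A⁻¹ * B⁻¹) := fun v => by
  set w := A⁻¹ (B⁻¹ v) with hw
  have h1 : B (A w) = v := by
    rw [hw, show A (A⁻¹ (B⁻¹ v)) = B⁻¹ v from A.apply_symm_apply _]
    exact B.apply_symm_apply v
  have h2 : ‖w‖ = ‖v‖ := by rw [hw, LinearIsometryEquiv.norm_map, LinearIsometryEquiv.norm_map]
  have h3 := norm_commutator_le ha0 hb0 ha hb w
  rw [h1, h2] at h3
  exact h3

/-- An isometry of determinant -1 negates some vector and moves it by twice its length. -/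
theorem Near.mem_rotations {A : E3 ≃ₗᵢ[ℝ] E3} (h : Near (1 / 4) A) : A ∈ rotations := by
  rcases det_mat A with h1 | h1
  · exact h1
  · exfalso
    obtain ⟨u, hu, hAu⟩ := exists_neg_fixed h1
    have h2 := h u
    rw [hAu, ← neg_add', norm_neg, ← two_smul ℝ u, norm_smul, Real.norm_ofNat] at h2
    have := norm_pos_iff.2 hu
    linarith

theorem Near.eq_of_smul {A : E3 ≃ₗᵢ[ℝ] E3} (h : Near (1 / 4) A) {u : E3} (hu : A u = u ∨ A u = -u) :
    A u = u := by
  rcases hu with hu | hu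
  · exact hu
  · have h2 := h u
    rw [hu, ← neg_add', norm_neg, ← two_smul ℝ u, norm_smul, Real.norm_ofNat] at h2
    have : ‖u‖ = 0 := by linarith [norm_nonneg u]
    rw [norm_eq_zero] at this
    simp [this]

/-- The commutator is evaluated as α γ p - γ α p with γ α p = 0, where |p| ≤ 2M. The linear
commutator and the two translation parts contribute at most M/4 each, so the bound M reproduces
itself under iteration. -/
theorem isom_norm_commutator_le {α γ : Isom3} {b M : ℝ} (hb0 : 0 ≤ b) (hb : b ≤ 1 / 4)
    (hα : Near (1 / 4) α.linearIsometryEquiv) (hγ : Near b γ.linearIsometryEquiv)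
    (hαM : ‖α 0‖ ≤ M) (hγM : ‖γ 0‖ ≤ M) : ‖(α * γ * α⁻¹ * γ⁻¹) 0‖ ≤ M := by
  set p := α⁻¹ (γ⁻¹ 0) with hp
  set A := α.linearIsometryEquiv
  set C := γ.linearIsometryEquiv
  have h0 : γ (α p) = 0 := by rw [hp, isom_apply_inv_self, isom_apply_inv_self]
  have h1 : (α * γ * α⁻¹ * γ⁻¹) 0 = α (γ p) - γ (α p) := by
    rw [h0, sub_zero]; rfl
  have h2 : ∀ q, α q = A q + α 0 := isom_apply α
  have h3 : ∀ q, γ q = C q + γ 0 := isom_apply γ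
  have h4 : ‖p‖ ≤ 2 * M := by
    rw [h3, h2, map_add] at h0
    have h5 : ‖p‖ = ‖C (α 0) + γ 0‖ := by
      rw [← A.norm_map, ← C.norm_map (A p), eq_neg_of_add_eq_zero_left ((add_assoc _ _ _).symm.trans h0),
        norm_neg]
    rw [h5]
    refine (norm_add_le _ _).trans ?_
    rw [C.norm_map]; linarith
  have h5 : α (γ p) - γ (α p) = (A (C p) - C (A p)) + (A (γ 0) - γ 0) - (C (α 0) - α 0) := by
    rw [h2, h3, h3 (α p), h2 p, map_add, map_add]; abel
  have h6 := norm_commutator_le (by norm_num) hb0 hα hγ p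
  have h7 := hα (γ 0)
  have h8 := hγ (α 0)
  rw [h1, h5]
  refine (norm_sub_le _ _).trans ?_
  have h9 := norm_add_le (A (C p) - C (A p)) (A (γ 0) - γ 0)
  have hM : 0 ≤ M := (norm_nonneg _).trans hαM
  have h10 : 2 * (1 / 4) * b * ‖p‖ ≤ 2 * (1 / 4) * (1 / 4) * (2 * M) := by gcongr
  have h11 : b * ‖α 0‖ ≤ 1 / 4 * M := by gcongr
  have h12 : 1 / 4 * ‖γ 0‖ ≤ 1 / 4 * M := by gcongr
  linarith

theorem IsSpaceGroup.finite_norm_le {G : Subgroup Isom3} (hG : IsSpaceGroup G) (M : ℝ) :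
    {g : Isom3 | g ∈ G ∧ ‖g 0‖ ≤ M}.Finite := by
  refine (hG.discrete 0 (Metric.closedBall 0 M) (isCompact_closedBall 0 M)).subset ?_
  rintro g ⟨h1, h2⟩
  exact ⟨h1, mem_closedBall_zero_iff.2 h2⟩

/-- The iterated commutators of `γ` with `α`. -/
noncomputable def iterComm (α γ : Isom3) : ℕ → Isom3
  | 0 => γ
  | k + 1 => α * iterComm α γ k * α⁻¹ * (iterComm α γ k)⁻¹

/-- Iterated commutators with α have linear parts tending to the identity while the origin moves by
a bounded amount. Discreteness makes some linear part trivial; from there the axis u of α is fixed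
step by step back to γ. -/
theorem near_fixed {G : Subgroup Isom3} (hG : IsSpaceGroup G) {α γ : Isom3} (hαG : α ∈ G)
    (hγG : γ ∈ G) (hα : Near (1 / 4) α.linearIsometryEquiv)
    (hγ : Near (1 / 4) γ.linearIsometryEquiv) {u : E3} (hu : α.linearIsometryEquiv u = u)
    (hu' : ∀ v, α.linearIsometryEquiv v = v → ∃ c : ℝ, v = c • u) :
    γ.linearIsometryEquiv u = u := by
  set M := max ‖α 0‖ ‖γ 0‖
  have hb : ∀ k : ℕ, 0 ≤ (1 / 4 : ℝ) * (1 / 2) ^ k ∧ (1 / 4 : ℝ) * (1 / 2) ^ k ≤ 1 / 4 := fun k => by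
    have := pow_le_one₀ (n := k) (by norm_num : (0 : ℝ) ≤ 1 / 2) (by norm_num)
    exact ⟨by positivity, by linarith⟩
  have hseq : ∀ k, iterComm α γ k ∈ G ∧
      Near (1 / 4 * (1 / 2) ^ k) (iterComm α γ k).linearIsometryEquiv ∧
      ‖iterComm α γ k 0‖ ≤ M := by
    intro k
    induction k with
    | zero => exact ⟨hγG, by rw [pow_zero, mul_one]; exact hγ, le_max_right _ _⟩
    | succ k ih =>
      obtain ⟨h1, h2, h3⟩ := ih
      refine ⟨mul_mem (mul_mem (mul_mem hαG h1) (inv_mem hαG)) (inv_mem h1), ?_, ?_⟩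
      · have h4 := Near.commutator (by norm_num) (hb k).1 hα h2
        have h5 : 2 * (1 / 4) * (1 / 4 * (1 / 2) ^ k) = (1 / 4 : ℝ) * (1 / 2) ^ (k + 1) := by
          rw [pow_succ]; ring
        rw [h5] at h4
        exact h4
      · exact isom_norm_commutator_le (hb k).1 (hb k).2 hα h2 (le_max_left _ _) h3
  -- The iterates stay in a finite set, and each member with nontrivial linear part is eventually
  -- excluded by the shrinking bound.
  have hex : ∃ k, (iterComm α γ k).linearIsometryEquiv = 1 := by
    by_contra hne
    push Not at hne
    have hlim : Filter.Tendsto (fun k : ℕ => (1 / 4 : ℝ) * (1 / 2) ^ k) Filter.atTop (nhds 0) := by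
      have := (tendsto_pow_atTop_nhds_zero_of_lt_one (by norm_num : (0 : ℝ) ≤ 1 / 2)
        (by norm_num)).const_mul (1 / 4 : ℝ)
      simpa using this
    have hev : ∀ g ∈ {g : Isom3 | g ∈ G ∧ ‖g 0‖ ≤ M}, ∀ᶠ k in Filter.atTop,
        iterComm α γ k ≠ g := by
      intro g _
      by_cases hg : g.linearIsometryEquiv = 1
      · exact Filter.Eventually.of_forall fun k h => hne k (by rw [h, hg])
      · obtain ⟨v, hv⟩ : ∃ v, g.linearIsometryEquiv v ≠ v := by
          by_contra hall
          push Not at hall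
          exact hg (LinearIsometryEquiv.ext hall)
        have hpos : 0 < ‖g.linearIsometryEquiv v - v‖ := norm_pos_iff.2 (sub_ne_zero.2 hv)
        have hl := hlim.mul_const ‖v‖
        rw [zero_mul] at hl
        filter_upwards [hl.eventually_lt_const hpos] with k hk h
        have := (hseq k).2.1 v
        rw [h] at this
        linarith
    have hall := (Filter.eventually_all_finite (hG.finite_norm_le M)).2 hev
    obtain ⟨k, hk⟩ := hall.exists
    exact hk _ ⟨(hseq k).1, (hseq k).2.2⟩ rfl
  obtain ⟨k, hk⟩ := hex
  -- If A C A⁻¹ C⁻¹ fixes u and A fixes u, then A fixes C⁻¹ u. So C⁻¹ u = ± u, and the minus sign is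
  -- impossible near the identity.
  have hdesc : ∀ k, (iterComm α γ k).linearIsometryEquiv u = u → γ.linearIsometryEquiv u = u := by
    intro k
    induction k with
    | zero => exact id
    | succ k ih =>
      intro h
      apply ih
      set A := α.linearIsometryEquiv
      set C := (iterComm α γ k).linearIsometryEquiv with hC
      have h1 : A (C (A⁻¹ (C⁻¹ u))) = u := h
      have hAu : A⁻¹ u = u := by
        rw [show A⁻¹ u = A⁻¹ (A u) by rw [hu]]; exact A.symm_apply_apply u
      have h2 : C (A⁻¹ (C⁻¹ u)) = u := by
        have h0 := congrArg (fun q => A⁻¹ q) h1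
        rw [← hAu]
        conv_rhs => rw [← h0]
        rw [hAu]
        exact (A.symm_apply_apply _).symm
      have h3 : A⁻¹ (C⁻¹ u) = C⁻¹ u := by
        conv_rhs => rw [← h2]
        exact (C.symm_apply_apply _).symm
      have h4 : A (C⁻¹ u) = C⁻¹ u := by
        conv_lhs => rw [← h3]
        exact A.apply_symm_apply _
      have h5 := eq_or_eq_neg_of_smul (u := u) (v := C⁻¹ u) (by rw [LinearIsometryEquiv.norm_map])
        (hu' _ h4)
      have h6 : Near (1 / 4) C⁻¹ := by
        apply Near.inv
        intro v
        exact ((hseq k).2.1 v).trans (mul_le_mul_of_nonneg_right (hb k).2 (norm_nonneg v))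
      have h7 := h6.eq_of_smul h5
      conv_lhs => rw [← h7]
      exact C.apply_symm_apply u
  exact hdesc k (by rw [hk]; rfl)

/-- In an irreducible space group no linear part other than the identity is close to the
identity. -/
theorem eq_one_of_near {G : Subgroup Isom3} (hG : IsSpaceGroup G) (hI : IsIrreducibleGroup G)
    {α : Isom3} (hαG : α ∈ G) (hα : Near (1 / 4) α.linearIsometryEquiv) :
    α.linearIsometryEquiv = 1 := by
  by_contra hne
  obtain ⟨u, hu, hAu, hax⟩ := exists_axis hα.mem_rotations hne
  refine hI ⟨u, hu, fun g hg => ?_⟩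
  have h1 : (g⁻¹ * α * g).linearIsometryEquiv u = u := by
    refine near_fixed hG hαG (mul_mem (mul_mem (inv_mem hg) hαG) hg) hα ?_ hAu hax
    have := hα.conj (g⁻¹).linearIsometryEquiv
    rwa [linear_inv, inv_inv] at this
  set A := α.linearIsometryEquiv
  set B := g.linearIsometryEquiv
  have h2 : B⁻¹ (A (B u)) = u := h1
  have h3 : A (B u) = B u := by
    conv_rhs => rw [← h2]
    exact (B.apply_symm_apply _).symm
  exact eq_or_eq_neg_of_smul (by rw [LinearIsometryEquiv.norm_map]) (hax _ h3)

/-- The group of the linear parts. -/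
noncomputable def linearHom : Isom3 →* (E3 ≃ₗᵢ[ℝ] E3) where
  toFun g := g.linearIsometryEquiv
  map_one' := rfl
  map_mul' _ _ := rfl

theorem linearHom_apply (g : Isom3) : linearHom g = g.linearIsometryEquiv := rfl

theorem abs_mat_le (A : E3 ≃ₗᵢ[ℝ] E3) (i j : Fin 3) : |mat A i j| ≤ 1 := by
  have h := abs_apply_le_norm (A (EuclideanSpace.single j 1)) i
  rwa [LinearIsometryEquiv.norm_map, PiLp.norm_single, norm_one] at h

/-- Three entries of size 1/24 give 1/8 in each coordinate, and √3/8 < 1/4. -/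
theorem near_of_mat {A B : E3 ≃ₗᵢ[ℝ] E3} (h : ∀ i j, |mat A i j - mat B i j| ≤ 1 / 24) :
    Near (1 / 4) (A⁻¹ * B) := by
  intro v
  have h1 : ‖(A⁻¹ * B) v - v‖ = ‖B v - A v‖ := by
    rw [← A.norm_map, map_sub]
    congr 2
    exact A.apply_symm_apply _
  rw [h1]
  have h2 : ∀ i, |(B v - A v) i| ≤ 1 / 8 * ‖v‖ := by
    intro i
    have h3 : (B v - A v) i = ∑ j, (mat B i j - mat A i j) * v j := by
      rw [PiLp.sub_apply, apply_eq_sum_mat, apply_eq_sum_mat, ← Finset.sum_sub_distrib]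
      exact Finset.sum_congr rfl fun j _ => by ring
    rw [h3]
    refine (Finset.abs_sum_le_sum_abs _ _).trans ?_
    have h4 : ∀ j ∈ Finset.univ, |(mat B i j - mat A i j) * v j| ≤ 1 / 24 * ‖v‖ := by
      intro j _
      rw [abs_mul, abs_sub_comm]
      exact mul_le_mul (h i j) (abs_apply_le_norm v j) (abs_nonneg _) (by norm_num)
    refine (Finset.sum_le_sum h4).trans ?_
    simp
    linarith
  have h5 : ∀ i, (B v - A v) i ^ 2 ≤ (1 / 8 * ‖v‖) ^ 2 := fun i => by
    rw [← sq_abs]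
    exact pow_le_pow_left₀ (abs_nonneg _) (h2 i) 2
  have h6 := norm_sq_eq (B v - A v)
  refine abs_le_of_sq_le_sq' ?_ (by positivity) |>.2
  rw [h6]
  nlinarith [h5 0, h5 1, h5 2, sq_nonneg ‖v‖]

/-- Two linear parts whose matrix entries fall into the same cells of width 1/24 have a quotient
near the identity, hence coincide. -/
theorem finite_linear {G : Subgroup Isom3} (hG : IsSpaceGroup G) (hI : IsIrreducibleGroup G) :
    Finite (G.map linearHom) := by
  let f : G.map linearHom → Fin 3 → Fin 3 → Finset.Icc (-24 : ℤ) 24 := fun A i j =>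
    ⟨⌊24 * mat A.1 i j⌋, by
      have h := abs_le.1 (abs_mat_le A.1 i j)
      rw [Finset.mem_Icc]
      constructor
      · rw [Int.le_floor]; push_cast; linarith
      · have : (⌊24 * mat A.1 i j⌋ : ℝ) ≤ 24 := (Int.floor_le _).trans (by linarith)
        exact_mod_cast this⟩
  refine Finite.of_injective f fun A B hAB => ?_
  have hnear : Near (1 / 4) (A.1⁻¹ * B.1) := by
    apply near_of_mat
    intro i j
    have h1 : ⌊24 * mat A.1 i j⌋ = ⌊24 * mat B.1 i j⌋ :=
      congrArg Subtype.val (congrFun (congrFun hAB i) j)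
    have h2 := Int.abs_sub_lt_one_of_floor_eq_floor h1
    rw [← mul_sub, abs_mul] at h2
    norm_num at h2
    linarith
  obtain ⟨g, hg, hgA⟩ := A.2
  obtain ⟨h, hh, hhB⟩ := B.2
  have h1 := eq_one_of_near hG hI (α := g⁻¹ * h) (mul_mem (inv_mem hg) hh) (by
    rw [linear_mul, linear_inv, ← linearHom_apply, ← linearHom_apply, hgA, hhB]; exact hnear)
  rw [linear_mul, linear_inv, ← linearHom_apply, ← linearHom_apply, hgA, hhB, inv_mul_eq_one] at h1
  exact Subtype.ext h1

/-! ### The translation lattice -/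

theorem exists_le_norm {G : Subgroup Isom3} (hG : IsSpaceGroup G) :
    ∃ r : ℝ, 0 < r ∧ ∀ t ∈ translGroup G, t ≠ 0 → r ≤ ‖t‖ := by
  have hfin : {t : E3 | t ∈ translGroup G ∧ t ≠ 0 ∧ ‖t‖ ≤ 1}.Finite := by
    refine ((hG.finite_norm_le 1).image fun g => g 0).subset ?_
    rintro t ⟨h1, -, h2⟩
    exact ⟨transl t, ⟨h1, by simpa [transl_apply] using h2⟩, by simp [transl_apply]⟩
  rcases Set.eq_empty_or_nonempty {t : E3 | t ∈ translGroup G ∧ t ≠ 0 ∧ ‖t‖ ≤ 1} with he | hne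
  · refine ⟨1, one_pos, fun t ht h0 => ?_⟩
    by_contra hlt
    have : t ∈ {t : E3 | t ∈ translGroup G ∧ t ≠ 0 ∧ ‖t‖ ≤ 1} := ⟨ht, h0, by linarith⟩
    rw [he] at this
    exact this
  · obtain ⟨a, ⟨ha, ha0, ha1⟩, hmin⟩ := hfin.exists_minimalFor (fun t => ‖t‖) _ hne
    refine ⟨‖a‖, norm_pos_iff.2 ha0, fun t ht h0 => ?_⟩
    by_cases h1 : ‖t‖ ≤ 1
    · by_contra hlt
      push Not at hlt
      exact absurd (hmin ⟨ht, h0, h1⟩ hlt.le) (not_le.2 hlt)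
    · linarith

/-- With one representative per linear part, cocompactness puts every point within bounded distance
of a translation vector. A vector orthogonal to all translations could be scaled beyond that
distance. -/
theorem span_translGroup {G : Subgroup Isom3} (hG : IsSpaceGroup G) (hI : IsIrreducibleGroup G) :
    Submodule.span ℝ (translGroup G : Set E3) = ⊤ := by
  have hfin := finite_linear hG hI
  choose rep hrep hrep' using fun A : G.map linearHom => A.2
  obtain ⟨C, hC, hcov⟩ := hG.cocompact
  obtain ⟨R, hR⟩ := hC.isBounded.exists_norm_le
  obtain ⟨N, hN⟩ : ∃ N : ℝ, ∀ A, ‖rep A 0‖ ≤ N := by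
    obtain ⟨N, hN⟩ := (Set.finite_range fun A => ‖rep A 0‖).bddAbove
    exact ⟨N, fun A => hN ⟨A, rfl⟩⟩
  have hdecomp : ∀ q : E3, ∃ t ∈ translGroup G, ‖q - t‖ ≤ R + N := by
    intro q
    obtain ⟨g, hg, p, hp, rfl⟩ := hcov q
    set A : G.map linearHom := ⟨linearHom g, g, hg, rfl⟩
    have h1 : g * (rep A)⁻¹ = transl ((g * (rep A)⁻¹) 0) := by
      refine eq_transl_of_linear fun v => ?_
      have : linearHom (g * (rep A)⁻¹) = 1 := by rw [map_mul, map_inv, hrep', mul_inv_cancel]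
      rw [← linearHom_apply, this]; rfl
    refine ⟨(g * (rep A)⁻¹) 0, ?_, ?_⟩
    · rw [mem_translGroup, ← h1]; exact mul_mem hg (inv_mem (hrep A))
    · have h2 : g p = (g * (rep A)⁻¹) (rep A p) := by
        rw [isom_mul_apply, isom_inv_apply_self]
      have h3 : g p - (g * (rep A)⁻¹) 0 = rep A p := by
        rw [h2]; conv_lhs => enter [1]; rw [h1]
        rw [transl_apply, add_sub_cancel_left]
      rw [h3, isom_apply]
      refine (norm_add_le _ _).trans ?_
      rw [LinearIsometryEquiv.norm_map]
      exact add_le_add (hR p hp) (hN A)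
  rw [← Submodule.orthogonal_eq_bot_iff, Submodule.eq_bot_iff]
  intro u hu
  by_contra hu0
  obtain ⟨t, ht, hle⟩ := hdecomp (((|R + N| + 1) / ‖u‖) • u)
  have h1 : inner ℝ t u = 0 := hu t (Submodule.subset_span ht)
  have hpos := norm_pos_iff.2 hu0
  have h2 : inner ℝ (((|R + N| + 1) / ‖u‖) • u - t) u = (|R + N| + 1) * ‖u‖ := by
    rw [inner_sub_left, h1, sub_zero, real_inner_smul_left, real_inner_self_eq_norm_sq]
    field_simp
  have h3 := real_inner_le_norm (((|R + N| + 1) / ‖u‖) • u - t) u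
  rw [h2] at h3
  have h4 := le_of_mul_le_mul_right h3 hpos
  linarith [le_abs_self (R + N)]

theorem tr_eq_trace (A : E3 ≃ₗᵢ[ℝ] E3) : tr A = LinearMap.trace ℝ E3 A.toLinearEquiv.toLinearMap := by
  rw [LinearMap.trace_eq_matrix_trace ℝ (EuclideanSpace.basisFun (Fin 3) ℝ).toBasis, tr]
  congr 1

/-- The crystallographic restriction: in a basis of the translation lattice the linear part has an
integral matrix. -/
theorem exists_int_tr {G : Subgroup Isom3} (hG : IsSpaceGroup G) (hI : IsIrreducibleGroup G)
    {g : Isom3} (hg : g ∈ G) : ∃ n : ℤ, tr g.linearIsometryEquiv = n := by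
  set L : Submodule ℤ E3 := (translGroup G).toIntSubmodule with hL
  obtain ⟨r, hr, hmin⟩ := exists_le_norm hG
  have hdisc : DiscreteTopology L := by
    refine DiscreteTopology.of_forall_le_norm hr fun x hx => hmin x x.2 ?_
    exact fun h => hx (Subtype.ext h)
  have hlat : IsZLattice ℝ L := ⟨span_translGroup hG hI⟩
  let b := Module.Free.chooseBasis ℤ L
  let b' := b.ofZLatticeBasis ℝ L
  have : Fintype (Module.Free.ChooseBasisIndex ℤ L) :=
    Module.Free.ChooseBasisIndex.fintype ℤ L
  classical
  rw [tr_eq_trace, LinearMap.trace_eq_matrix_trace ℝ b', Matrix.trace]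
  refine ⟨∑ i, b.repr ⟨g.linearIsometryEquiv (b i), linear_mem_translGroup hg (b i).2⟩ i, ?_⟩
  push_cast
  refine Finset.sum_congr rfl fun i _ => ?_
  rw [Matrix.diag_apply, LinearMap.toMatrix_apply]
  have h1 : b' i = b i := b.ofZLatticeBasis_apply ℝ L i
  have h2 := b.ofZLatticeBasis_repr_apply ℝ L
    ⟨g.linearIsometryEquiv (b i), linear_mem_translGroup hg (b i).2⟩ i
  rw [h1]
  exact h2

/-! ### Finite rotation groups with integral traces -/

theorem tr_mul_comm (A B : E3 ≃ₗᵢ[ℝ] E3) : tr (A * B) = tr (B * A) := by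
  rw [tr, tr, mat_mul, mat_mul, Matrix.trace_mul_comm]

theorem tr_inv (A : E3 ≃ₗᵢ[ℝ] E3) : tr A⁻¹ = tr A := by
  rw [tr, mat_inv, Matrix.trace_transpose, tr]

theorem tr_one : tr 1 = 3 := by
  rw [tr, mat_one, Matrix.trace_one]; simp

theorem axial_inv (A : E3 ≃ₗᵢ[ℝ] E3) : axial A⁻¹ = -axial A := by
  ext i; rw [axial_apply, mat_inv, PiLp.neg_apply, axial_apply]
  simp

theorem smul_of_fixed {A : E3 ≃ₗᵢ[ℝ] E3} (hA : A ∈ rotations) (h1 : A ≠ 1) {u v : E3}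
    (hu0 : u ≠ 0) (hu : A u = u) (hv : A v = v) : ∃ c : ℝ, v = c • u := by
  refine exists_smul_of_cross_eq_zero hu0 ?_
  by_contra h
  exact h1 (eq_one_of_fixed_of_cross_ne_zero hA hu hv h)

theorem lin_inv_apply_self (A : E3 ≃ₗᵢ[ℝ] E3) (v : E3) : A⁻¹ (A v) = v := A.symm_apply_apply v

theorem lin_apply_inv_self (A : E3 ≃ₗᵢ[ℝ] E3) (v : E3) : A (A⁻¹ v) = v := A.apply_symm_apply v

theorem lin_mul_apply (A B : E3 ≃ₗᵢ[ℝ] E3) (v : E3) : (A * B) v = A (B v) := rfl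

theorem fixed_conj {A B : E3 ≃ₗᵢ[ℝ] E3} {v : E3} (h : (B * A * B⁻¹) v = v) :
    A (B⁻¹ v) = B⁻¹ v := by
  conv_rhs => rw [← h]
  exact (lin_inv_apply_self B _).symm

/-- No line is preserved by the group. -/
def NoInvariantLine (P : Subgroup (E3 ≃ₗᵢ[ℝ] E3)) : Prop :=
  ∀ v : E3, (∀ A ∈ P, A v = v ∨ A v = -v) → v = 0

/-- Otherwise every fourth power is trivial (trace 2 is excluded because the square would have trace
0), so P is a 2-group. The axis of a nontrivial central element would then be an invariant line. -/
theorem exists_tr_eq_zero {P : Subgroup (E3 ≃ₗᵢ[ℝ] E3)} [Finite P] (hR : P ≤ rotations)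
    (hT : ∀ A ∈ P, ∃ n : ℤ, tr A = n) (hI : NoInvariantLine P) : ∃ A ∈ P, tr A = 0 := by
  by_contra hne
  push Not at hne
  have h4 : ∀ A ∈ P, A ^ 4 = 1 := by
    intro A hA
    obtain ⟨n, hn⟩ := hT A hA
    obtain ⟨h1, h2⟩ := tr_le_three (hR hA)
    have h0 := hne _ hA
    have h0' := hne _ (mul_mem hA hA)
    rw [tr_mul_self (hR hA)] at h0'
    rw [hn] at h0 h0' h1 h2
    have h3 : -1 ≤ n := by exact_mod_cast h1
    have h5 : n ≤ 3 := by exact_mod_cast h2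
    interval_cases n
    · have := mul_self_eq_one_of_tr (hR hA) (by rw [hn]; norm_num)
      rw [show 4 = 2 * 2 by rfl, pow_mul, pow_two A, this, one_pow]
    · simp at h0
    · exact fourth_eq_one_of_tr (hR hA) (by rw [hn]; norm_num)
    · norm_num at h0'
    · have h1 : A = 1 := eq_one_of_tr (by rw [hn]; norm_num)
      rw [h1, one_pow]
  have hp : IsPGroup 2 P := fun A => ⟨2, Subtype.ext (h4 A A.2)⟩
  have hnt : Nontrivial P := by
    by_contra h
    rw [not_nontrivial_iff_subsingleton] at h
    have h1 := hI (EuclideanSpace.single 0 1) fun A hA => by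
      have : A = 1 := congrArg Subtype.val (Subsingleton.elim (⟨A, hA⟩ : P) 1)
      left; rw [this]; rfl
    have h2 := congrArg (fun p : E3 => p 0) h1
    simp at h2
  have : Fact (Nat.Prime 2) := ⟨Nat.prime_two⟩
  have hc := hp.center_nontrivial
  obtain ⟨z, hz⟩ := exists_ne (1 : Subgroup.center P)
  have hz1 : (z : P).1 ≠ 1 := fun h => hz (Subtype.ext (Subtype.ext h))
  obtain ⟨u, hu, hzu, hax⟩ := exists_axis (hR (z : P).2) hz1
  refine hu (hI u fun A hA => ?_)
  have hcomm : (z : P).1 * A = A * (z : P).1 :=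
    (congrArg Subtype.val (Subgroup.mem_center_iff.1 z.2 ⟨A, hA⟩)).symm
  have h1 : (z : P).1 (A u) = A u := by
    rw [← lin_mul_apply, hcomm, lin_mul_apply, hzu]
  exact eq_or_eq_neg_of_smul (by rw [LinearIsometryEquiv.norm_map]) (hax _ h1)

/-- A rotation of order 3 and a conjugate with a different axis have axial vectors with inner
product k, |k| < 3. The integral traces n₁, n₂ of r s and r s⁻¹ satisfy k = n₂ - n₁, and only k = ±
1 survives. -/
theorem exists_tr_mul_eq_neg_one {P : Subgroup (E3 ≃ₗᵢ[ℝ] E3)} [Finite P] (hR : P ≤ rotations)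
    (hT : ∀ A ∈ P, ∃ n : ℤ, tr A = n) (hI : NoInvariantLine P) :
    ∃ r ∈ P, ∃ s ∈ P, tr r = 0 ∧ tr s = 0 ∧ tr (r * s) = -1 ∧
      ∀ v, r v = v → s v = v → v = 0 := by
  obtain ⟨r, hr, hr0⟩ := exists_tr_eq_zero hR hT hI
  have hr1 : r ≠ 1 := by rintro rfl; rw [tr_one] at hr0; norm_num at hr0
  have hw := norm_axial_sq (hR hr)
  have hwf := map_axial (hR hr)
  rw [hr0] at hw
  set w := axial r with hwdef
  have hw0 : w ≠ 0 := by intro h; rw [h, norm_zero] at hw; norm_num at hw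
  obtain ⟨g, hg, hgw⟩ : ∃ g ∈ P, ¬ (g w = w ∨ g w = -w) := by
    by_contra hall
    refine hw0 (hI w fun A hA => ?_)
    by_contra hn
    exact hall ⟨A, hA, hn⟩
  set s := g * r * g⁻¹ with hs
  have hsP : s ∈ P := mul_mem (mul_mem hg hr) (inv_mem hg)
  have hs0 : tr s = 0 := by
    rw [hs, tr_mul_comm, ← mul_assoc, inv_mul_cancel, one_mul, hr0]
  have hs1 : s ≠ 1 := by intro h; rw [h, tr_one] at hs0; norm_num at hs0
  have hw' := norm_axial_sq (hR hsP)
  have hwf' := map_axial (hR hsP)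
  rw [hs0] at hw'
  set w' := axial s with hwdef'
  have hnorm : ‖w‖ = ‖w'‖ :=
    (sq_eq_sq₀ (norm_nonneg _) (norm_nonneg _)).1 (hw.trans hw'.symm)
  have hw0' : w' ≠ 0 := by intro h; rw [h, norm_zero] at hw'; norm_num at hw'
  have hN : ¬ (w' = w ∨ w' = -w) := by
    have h1 := fixed_conj hwf'
    have h2 := eq_or_eq_neg_of_smul (u := w) (v := g⁻¹ w')
      (by rw [LinearIsometryEquiv.norm_map, hnorm]) (smul_of_fixed (hR hr) hr1 hw0 hwf h1)
    have h3 : w' = g w ∨ w' = -g w := by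
      rcases h2 with h2 | h2
      · left; rw [← h2, lin_apply_inv_self]
      · right; rw [← map_neg, ← h2, lin_apply_inv_self]
    intro h4
    apply hgw
    rcases h3 with h3 | h3 <;> rcases h4 with h4 | h4
    · left; rw [← h3, h4]
    · right; rw [← h3, h4]
    · right; exact (neg_eq_iff_eq_neg.2 h3).symm.trans (congrArg Neg.neg h4)
    · left; rw [h4] at h3; exact (neg_injective h3).symm
  have hfix : ∀ v, r v = v → s v = v → v = 0 := by
    intro v hv hv'
    by_contra hv0
    obtain ⟨c, hc⟩ := smul_of_fixed (hR hr) hr1 hw0 hwf hv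
    obtain ⟨c', hc'⟩ := smul_of_fixed (hR hsP) hs1 hv0 hv' hwf'
    exact hN (eq_or_eq_neg_of_smul hnorm ⟨c' * c, by rw [hc', hc, smul_smul]⟩)
  have h1 := four_mul_tr_mul (hR hr) (hR hsP) hr0 hs0
  have h2 := four_mul_tr_mul (hR hr) (hR (inv_mem hsP)) hr0 (by rw [tr_inv, hs0])
  rw [axial_inv, inner_neg_right, ← hwdef, ← hwdef'] at h2
  rw [← hwdef, ← hwdef'] at h1
  obtain ⟨n1, hn1⟩ := hT _ (mul_mem hr hsP)
  obtain ⟨n2, hn2⟩ := hT _ (mul_mem hr (inv_mem hsP))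
  rw [hn1] at h1
  rw [hn2] at h2
  have hk : inner ℝ w w' = ((n2 - n1 : ℤ) : ℝ) := by push_cast; linarith
  have hlt : inner ℝ w w' < 3 := by
    have h3 := norm_sub_sq_real w w'
    have h4 : 0 < ‖w - w'‖ := norm_pos_iff.2 (sub_ne_zero.2 fun h => hN (Or.inl h.symm))
    have : 0 < ‖w - w'‖ ^ 2 := by positivity
    linarith
  have hgt : -3 < inner ℝ w w' := by
    have h3 := norm_add_sq_real w w'
    have h4 : 0 < ‖w + w'‖ := norm_pos_iff.2 fun h => hN (Or.inr (eq_neg_of_add_eq_zero_right h))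
    have : 0 < ‖w + w'‖ ^ 2 := by positivity
    linarith
  rw [hk] at h1 h2 hlt hgt
  obtain ⟨m, hm⟩ : ∃ m, m = n2 - n1 := ⟨_, rfl⟩
  rw [← hm] at h1 h2 hlt hgt
  have hlt' : m < 3 := by exact_mod_cast hlt
  have hgt' : -3 < m := by exact_mod_cast hgt
  have h1' : 4 * n1 = m ^ 2 - 2 * m - 3 := by exact_mod_cast h1
  have h2' : 4 * n2 = m ^ 2 - 2 * m * (-1) - 3 := by
    have : (4 : ℝ) * n2 = m ^ 2 - 2 * m * (-1) - 3 := by rw [h2]; ring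
    exact_mod_cast this
  -- 4 n₁ = m² - 2m - 3 forces m odd, and m = ± 1 makes one of the two traces -1.
  obtain h | h : n1 = -1 ∨ n2 = -1 := by
    interval_cases m <;> lia
  · exact ⟨r, hr, s, hsP, hr0, hs0, by rw [hn1, h]; norm_num, hfix⟩
  · refine ⟨r, hr, s⁻¹, inv_mem hsP, hr0, by rw [tr_inv, hs0], by rw [hn2, h]; norm_num,
      fun v hv hv' => hfix v hv ?_⟩
    conv_lhs => rw [← hv']
    exact lin_apply_inv_self s v

/-- An orthonormal frame permuted cyclically by an element of order three and compatible with a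
half-turn. -/
theorem exists_frame {P : Subgroup (E3 ≃ₗᵢ[ℝ] E3)} [Finite P] (hR : P ≤ rotations)
    (hT : ∀ A ∈ P, ∃ n : ℤ, tr A = n) (hI : NoInvariantLine P) :
    ∃ r ∈ P, ∃ H ∈ P, ∃ f : Fin 3 → E3, Orthonormal ℝ f ∧ r ^ 3 = 1 ∧
      H = (r⁻¹ * H * r) * (r⁻¹ * (r⁻¹ * H * r) * r) ∧ (∀ i, r (f i) = f (i + 2)) ∧
      H (f 0) = -f 0 ∧ H (f 1) = -f 1 ∧ H (f 2) = f 2 := by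
  obtain ⟨r, hr, s, hs, hr0, hs0, hrs, hfix⟩ := exists_tr_mul_eq_neg_one hR hT hI
  have hr3 := cube_eq_one_of_tr (hR hr) hr0
  have hs3 := cube_eq_one_of_tr (hR hs) hs0
  have hh := mul_self_eq_one_of_tr (hR (mul_mem hr hs)) hrs
  set h := r * s with hdef
  have hhP : h ∈ P := mul_mem hr hs
  have hh1 : h ≠ 1 := by intro h1; rw [h1, tr_one] at hrs; norm_num at hrs
  have hsh : s = r⁻¹ * h := by rw [hdef]; group
  have hrr : r⁻¹ * r⁻¹ = r := by
    have : r * r * r = 1 := by rw [← hr3, pow_three, mul_assoc]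
    rw [← mul_inv_rev, inv_eq_iff_mul_eq_one, this]
  have hrr' : r * r = r⁻¹ := by rw [← inv_inj, mul_inv_rev, hrr, inv_inv]
  -- As r² = r⁻¹, the product is (r⁻¹ h)³ = s³. So the three conjugates of the half-turn h form a
  -- Klein four-group with the identity.
  have hprod : (r⁻¹ * h * r) * (r * h * r⁻¹) * h = 1 := by
    have h1 : (r⁻¹ * h * r) * (r * h * r⁻¹) * h = r⁻¹ * h * (r * r) * h * r⁻¹ * h := by
      simp only [mul_assoc]
    rw [h1, hrr', ← hs3, hsh, pow_three]
    simp only [mul_assoc]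
  have hinv : h⁻¹ = h := inv_eq_of_mul_eq_one_left hh
  have hh1' : (r⁻¹ * h * r) * (r⁻¹ * h * r) = 1 := by
    have : (r⁻¹ * h * r) * (r⁻¹ * h * r) = r⁻¹ * (h * h) * r := by group
    rw [this, hh]; group
  have hh2' : (r * h * r⁻¹) * (r * h * r⁻¹) = 1 := by
    have : (r * h * r⁻¹) * (r * h * r⁻¹) = r * (h * h) * r⁻¹ := by group
    rw [this, hh]; group
  set h1 := r⁻¹ * h * r with h1def
  set h2 := r * h * r⁻¹ with h2def
  have hinv1 : h1⁻¹ = h1 := inv_eq_of_mul_eq_one_left hh1'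
  have hinv2 : h2⁻¹ = h2 := inv_eq_of_mul_eq_one_left hh2'
  have e12 : h1 * h2 = h := by rw [← hinv]; exact eq_inv_of_mul_eq_one_left hprod
  have e2 : h2 = h1 * h := by rw [← e12, ← mul_assoc, hh1', one_mul]
  have ecomm : h1 * h = h * h1 := by
    rw [← e2, ← hinv2, e2, mul_inv_rev, hinv1, hinv]
  obtain ⟨u, hu0, hhu, -⟩ := exists_axis (hR hhP) hh1
  obtain ⟨e, he, hhe⟩ : ∃ e : E3, ‖e‖ = 1 ∧ h e = e := by
    have := norm_ne_zero_iff.2 hu0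
    exact ⟨‖u‖⁻¹ • u, by rw [norm_smul, norm_inv, norm_norm, inv_mul_cancel₀ this],
      by rw [map_smul, hhu]⟩
  have he0 : e ≠ 0 := by rintro rfl; simp at he
  set f1 := r⁻¹ e with f1def
  have hn1 : ‖f1‖ = ‖e‖ := by rw [f1def, LinearIsometryEquiv.norm_map]
  have rf1 : r f1 = e := lin_apply_inv_self r e
  have rre : r (r e) = f1 := by rw [← lin_mul_apply, hrr']
  -- h commutes with h1, hence preserves its axis up to sign. The plus sign would make e a common
  -- fixed vector of r and s.
  have hf1 : h f1 = -f1 := by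
    have a1 : h1 f1 = f1 := by
      rw [h1def, lin_mul_apply, lin_mul_apply, rf1, hhe]
    have a2 : h1 (h f1) = h f1 := by
      rw [← lin_mul_apply, ecomm, lin_mul_apply, a1]
    have h1ne : h1 ≠ 1 := by
      intro h0
      apply hh1
      rw [show h = r * h1 * r⁻¹ by rw [h1def]; group, h0]; group
    have h1P : h1 ∈ P := mul_mem (mul_mem (inv_mem hr) hhP) hr
    have f1ne : f1 ≠ 0 := by rw [← norm_ne_zero_iff, hn1, he]; exact one_ne_zero
    rcases eq_or_eq_neg_of_smul (u := f1) (v := h f1) (h.norm_map f1).symm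
      (smul_of_fixed (hR h1P) h1ne f1ne a1 a2) with h3 | h3
    · exfalso
      apply he0
      have hre : r e = e := by
        rcases eq_or_eq_neg_of_smul hn1.symm (smul_of_fixed (hR hhP) hh1 he0 hhe h3) with h4 | h4
        · rw [h4] at rf1; exact rf1
        · exfalso
          apply he0
          rw [h4, map_neg] at rf1
          have h5 : r e = -e := neg_eq_iff_eq_neg.1 rf1
          rw [h5, map_neg, h5, neg_neg, h4] at rre
          have h6 : (2 : ℝ) • e = 0 := by rw [two_smul]; exact add_eq_zero_iff_eq_neg.2 rre
          exact (smul_eq_zero.1 h6).resolve_left two_ne_zero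
      refine hfix e hre ?_
      rw [hsh, lin_mul_apply, hhe]
      conv_lhs => rw [← hre]
      exact lin_inv_apply_self r e
    · exact h3
  have o01 : inner ℝ e f1 = 0 := by
    have := h.inner_map_map e f1
    rw [hhe, hf1, inner_neg_right] at this
    linarith
  have o20 : inner ℝ (r e) e = 0 := by
    have := r.inner_map_map e f1
    rwa [rf1, o01] at this
  have o12 : inner ℝ f1 (r e) = 0 := by
    have := r.inner_map_map (r e) e
    rwa [rre, o20] at this
  have hf2 : h (r e) = -r e := by
    have h3 : h (h (r e) + r e) = h (r e) + r e := by
      rw [map_add, ← lin_mul_apply, hh, add_comm]; rfl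
    obtain ⟨c, hc⟩ := smul_of_fixed (hR hhP) hh1 he0 hhe h3
    have h4 : inner ℝ (h (r e) + r e) e = 0 := by
      rw [inner_add_left, o20, add_zero]
      have := h.inner_map_map (r e) e
      rwa [hhe, o20] at this
    rw [hc, real_inner_smul_left, real_inner_self_eq_norm_sq, he, one_pow, mul_one] at h4
    rw [h4, zero_smul] at hc
    exact eq_neg_of_add_eq_zero_left hc
  refine ⟨r, hr, h2, mul_mem (mul_mem hr hhP) (inv_mem hr), ![e, f1, r e], ?_, hr3, ?_, ?_, ?_, ?_,
    ?_⟩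
  · rw [orthonormal_iff_ite]
    have s01 := o01
    have s20 := o20
    have s12 := o12
    rw [real_inner_comm] at s01 s20 s12
    have n0 : inner ℝ e e = (1 : ℝ) := by rw [real_inner_self_eq_norm_sq, he, one_pow]
    have n1 : inner ℝ f1 f1 = (1 : ℝ) := by rw [real_inner_self_eq_norm_sq, hn1, he, one_pow]
    have n2 : inner ℝ (r e) (r e) = (1 : ℝ) := by rw [r.inner_map_map, n0]
    clear_value f1
    clear f1def
    intro i j
    fin_cases i <;> fin_cases j <;> simp [*]
  · have h3 : r⁻¹ * h2 * r = h := by rw [h2def]; group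
    rw [h3, ← h1def, ← ecomm, ← e2]
  · intro i
    fin_cases i
    · rfl
    · exact rf1
    · exact rre
  · change h2 e = -e
    rw [h2def, lin_mul_apply, lin_mul_apply, ← f1def, hf1, map_neg, rf1]
  · change h2 f1 = -f1
    have : r⁻¹ f1 = r e := by rw [f1def, ← lin_mul_apply, hrr]
    rw [h2def, lin_mul_apply, lin_mul_apply, this, hf2, map_neg, rre]
  · change h2 (r e) = r e
    rw [h2def, lin_mul_apply, lin_mul_apply, lin_inv_apply_self, hhe]

/-! ### The tetrahedral rotations in an irreducible space group -/

/-- The central inversion. -/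
noncomputable def negLin : E3 ≃ₗᵢ[ℝ] E3 := LinearIsometryEquiv.neg ℝ

theorem negLin_apply (v : E3) : negLin v = -v := rfl

theorem negLin_mul_negLin : negLin * negLin = 1 := by
  ext v : 1; rw [lin_mul_apply, negLin_apply, negLin_apply, neg_neg]; rfl

theorem negLin_comm (A : E3 ≃ₗᵢ[ℝ] E3) : negLin * A = A * negLin := by
  ext v : 1; rw [lin_mul_apply, lin_mul_apply, negLin_apply, negLin_apply, map_neg]

theorem mat_negLin_mul (A : E3 ≃ₗᵢ[ℝ] E3) : mat (negLin * A) = -mat A := by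
  ext i j; rfl

/-- The rotations that are, up to sign, linear parts of elements of `G`. -/
noncomputable def rotationParts (Γ : Subgroup (E3 ≃ₗᵢ[ℝ] E3)) : Subgroup (E3 ≃ₗᵢ[ℝ] E3) where
  carrier := {A | A ∈ rotations ∧ (A ∈ Γ ∨ negLin * A ∈ Γ)}
  one_mem' := ⟨one_mem _, Or.inl (one_mem _)⟩
  mul_mem' {A B} hA hB := by
    refine ⟨mul_mem hA.1 hB.1, ?_⟩
    rcases hA.2 with ha | ha <;> rcases hB.2 with hb | hb
    · exact Or.inl (mul_mem ha hb)
    · right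
      rw [← mul_assoc, negLin_comm, mul_assoc]
      exact mul_mem ha hb
    · right
      rw [← mul_assoc]
      exact mul_mem ha hb
    · left
      have := mul_mem ha hb
      rwa [negLin_comm A, mul_assoc, ← mul_assoc negLin, negLin_mul_negLin, one_mul] at this
  inv_mem' {A} hA := by
    refine ⟨inv_mem hA.1, ?_⟩
    rcases hA.2 with ha | ha
    · exact Or.inl (inv_mem ha)
    · right
      have := inv_mem ha
      rw [mul_inv_rev, show negLin⁻¹ = negLin from inv_eq_of_mul_eq_one_left negLin_mul_negLin,
        ← negLin_comm] at this
      exact this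

/-- The linear parts contain the rotations of the tetrahedron, and the translations form a
nontrivial discrete group. -/
structure IsTetrahedral (G : Subgroup Isom3) : Prop where
  exists_rho : ∃ α ∈ G, α.linearIsometryEquiv = rho.linearIsometryEquiv
  exists_delta : ∃ β ∈ G, β.linearIsometryEquiv = delta.linearIsometryEquiv
  exists_le_norm : ∃ r : ℝ, 0 < r ∧ ∀ t ∈ translGroup G, t ≠ 0 → r ≤ ‖t‖
  exists_ne_zero : ∃ t ∈ translGroup G, t ≠ 0

/-- The frame is found for the rotations that are linear parts up to sign; afterwards r and H are
shown to be genuine linear parts. -/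
theorem exists_frame_of_isSpaceGroup {G : Subgroup Isom3} (hG : IsSpaceGroup G)
    (hI : IsIrreducibleGroup G) : ∃ f : Fin 3 → E3, Orthonormal ℝ f ∧
      (∃ α ∈ G, ∀ i, α.linearIsometryEquiv (f i) = f (i + 2)) ∧
      ∃ β ∈ G, β.linearIsometryEquiv (f 0) = -f 0 ∧ β.linearIsometryEquiv (f 1) = -f 1 ∧
        β.linearIsometryEquiv (f 2) = f 2 := by
  set Γ := G.map linearHom
  have hfin : Finite (Γ : Set (E3 ≃ₗᵢ[ℝ] E3)) := finite_linear hG hI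
  have hP : Finite (rotationParts Γ) := by
    refine Set.Finite.subset (s := (Γ : Set _) ∪ (fun A => negLin * A) '' (Γ : Set _))
      ((Set.toFinite _).union ((Set.toFinite _).image _)) ?_
    rintro A ⟨-, h | h⟩
    · exact Or.inl h
    · exact Or.inr ⟨_, h, by simp only [← mul_assoc, negLin_mul_negLin, one_mul]⟩
  have hT : ∀ A ∈ rotationParts Γ, ∃ n : ℤ, tr A = n := by
    rintro A ⟨-, ⟨g, hg, rfl⟩ | ⟨g, hg, h⟩⟩
    · exact exists_int_tr hG hI hg
    · obtain ⟨n, hn⟩ := exists_int_tr hG hI hg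
      refine ⟨-n, ?_⟩
      rw [← linearHom_apply, h, tr, mat_negLin_mul, Matrix.trace_neg] at hn
      rw [tr]; push_cast; linarith
  have hN : NoInvariantLine (rotationParts Γ) := by
    intro v hv
    by_contra h0
    refine hI ⟨v, h0, fun g hg => ?_⟩
    have hgΓ : g.linearIsometryEquiv ∈ Γ := ⟨g, hg, rfl⟩
    rcases det_mat g.linearIsometryEquiv with h | h
    · exact hv _ ⟨h, Or.inl hgΓ⟩
    · have h1 : negLin * g.linearIsometryEquiv ∈ rotationParts Γ := by
        refine ⟨?_, Or.inr ?_⟩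
        · rw [mem_rotations, mat_negLin_mul, Matrix.det_neg, h]; norm_num
        · rwa [← mul_assoc, negLin_mul_negLin, one_mul]
      rcases hv _ h1 with h2 | h2
      · right; rw [lin_mul_apply, negLin_apply] at h2; exact neg_eq_iff_eq_neg.1 h2
      · left; rw [lin_mul_apply, negLin_apply] at h2; exact neg_injective h2
  obtain ⟨r, hr, H, hH, f, hf, hr3, hHr, hrf, h0, h1, h2⟩ :=
    exists_frame (fun A (hA : A ∈ rotations ∧ _) => hA.1) hT hN
  have hrΓ : r ∈ Γ := by
    rcases hr.2 with h | h
    · exact h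
    -- Since r has order 3, (-r)⁴ = r.
    · have h4 := pow_mem h 4
      have h5 : (negLin * r) ^ 4 = r := by
        rw [Commute.mul_pow (negLin_comm r), show negLin ^ 4 = 1 by
          rw [show 4 = 2 * 2 by rfl, pow_mul, pow_two negLin, negLin_mul_negLin, one_pow],
          one_mul, pow_succ, hr3, one_mul]
      rwa [h5] at h4
  have hHΓ : H ∈ Γ := by
    rcases hH.2 with h | h
    · exact h
    -- H is the product of two of its conjugates, in which the signs of -H cancel.
    · have h3 := mul_mem (mul_mem (inv_mem hrΓ) h) hrΓ
      have h4 := mul_mem (mul_mem (inv_mem hrΓ) h3) hrΓ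
      have h5 := mul_mem h3 h4
      have e3 : r⁻¹ * (negLin * H) * r = negLin * (r⁻¹ * H * r) := by
        rw [← mul_assoc, ← negLin_comm]; simp only [mul_assoc]
      have e4 : r⁻¹ * (negLin * (r⁻¹ * H * r)) * r = negLin * (r⁻¹ * (r⁻¹ * H * r) * r) := by
        rw [← mul_assoc, ← negLin_comm]; simp only [mul_assoc]
      rw [e3, e4, negLin_comm, mul_assoc, ← mul_assoc negLin, negLin_mul_negLin, one_mul,
        ← hHr] at h5
      exact h5
  obtain ⟨α, hα, rfl⟩ := hrΓ
  obtain ⟨β, hβ, rfl⟩ := hHΓ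
  exact ⟨f, hf, ⟨α, hα, hrf⟩, β, hβ, h0, h1, h2⟩

theorem translGroup_map_conj (G : Subgroup Isom3) (g : Isom3) (t : E3) :
    t ∈ translGroup (G.map (MulAut.conj g).toMonoidHom) ↔
      g.linearIsometryEquiv⁻¹ t ∈ translGroup G := by
  rw [mem_translGroup, mem_translGroup]
  have h : MulAut.conj g (transl (g.linearIsometryEquiv⁻¹ t)) = transl t := by
    rw [MulAut.conj_apply, conj_transl, lin_apply_inv_self]
  rw [← h]
  exact Subgroup.mem_map_iff_mem (MulAut.conj g).injective

theorem exists_isTetrahedral {G : Subgroup Isom3} (hG : IsSpaceGroup G)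
    (hI : IsIrreducibleGroup G) :
    ∃ g : Isom3, IsTetrahedral (G.map (MulAut.conj g).toMonoidHom) := by
  obtain ⟨f, hf, ⟨α, hα, hαf⟩, β, hβ, h0, h1, h2⟩ := exists_frame_of_isSpaceGroup hG hI
  let bas := basisOfOrthonormalOfCardEqFinrank hf (by simp)
  let ob : OrthonormalBasis (Fin 3) ℝ E3 := bas.toOrthonormalBasis (by
    rw [coe_basisOfOrthonormalOfCardEqFinrank]; exact hf)
  have hob : ∀ i, ob i = f i := fun i => by
    rw [Module.Basis.coe_toOrthonormalBasis, coe_basisOfOrthonormalOfCardEqFinrank]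
  let g : Isom3 := ob.repr.toAffineIsometryEquiv
  have hg : g.linearIsometryEquiv = ob.repr := by
    simp [g]
  have hginv : ∀ i, g.linearIsometryEquiv⁻¹ (EuclideanSpace.single i 1) = f i := fun i => by
    rw [hg, ← hob i]; exact ob.repr_symm_single i
  have hgf : ∀ i, g.linearIsometryEquiv (f i) = EuclideanSpace.single i 1 := fun i => by
    rw [← hginv i, lin_apply_inv_self]
  have hlin : ∀ γ : Isom3, ∀ i, (MulAut.conj g γ).linearIsometryEquiv (EuclideanSpace.single i 1) =
      g.linearIsometryEquiv (γ.linearIsometryEquiv (f i)) := fun γ i => by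
    rw [← hginv i]; rfl
  have hext : ∀ A B : E3 ≃ₗᵢ[ℝ] E3, (∀ i, A (EuclideanSpace.single i 1) =
      B (EuclideanSpace.single i 1)) → A = B := fun A B h => by
    apply mat_injective
    ext i j
    rw [mat_apply, mat_apply, h]
  refine ⟨g, ⟨_, ⟨α, hα, rfl⟩, hext _ _ fun i => ?_⟩, ⟨_, ⟨β, hβ, rfl⟩, hext _ _ fun i => ?_⟩, ?_, ?_⟩
  · refine (hlin α i).trans ?_
    rw [hαf, hgf]
    ext j
    rw [rho_linear]
    fin_cases i <;> fin_cases j <;> simp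
  · refine (hlin β i).trans ?_
    fin_cases i
    · simp only [Fin.zero_eta, h0, map_neg, hgf]
      ext j; rw [delta, sgnIso_linear]; fin_cases j <;> simp
    · simp only [Fin.mk_one, h1, map_neg, hgf]
      ext j; rw [delta, sgnIso_linear]; fin_cases j <;> simp
    · simp only [Fin.reduceFinMk, h2, hgf]
      ext j; rw [delta, sgnIso_linear]; fin_cases j <;> simp
  · obtain ⟨r, hr, hmin⟩ := exists_le_norm hG
    refine ⟨r, hr, fun t ht h => ?_⟩
    have := hmin _ ((translGroup_map_conj G g t).1 ht) (by simpa using h)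
    rwa [LinearIsometryEquiv.norm_map] at this
  · have hne : translGroup G ≠ ⊥ := by
      intro h
      have h3 := span_translGroup hG hI
      rw [h] at h3
      simp at h3
    obtain ⟨t, ht0⟩ := AddSubgroup.ne_bot_iff_exists_ne_zero.1 hne
    refine ⟨g.linearIsometryEquiv t, (translGroup_map_conj G g _).2 ?_, ?_⟩
    · rw [lin_inv_apply_self]; exact t.2
    · simpa using ht0

/-! ### Rescaling -/

/-- Conjugation of isometries by the homothety with factor `c` about the origin. -/
noncomputable def scaleConj (c : ℝ) : Isom3 →* Isom3 where
  toFun g := transl (c • g 0) * g.linearIsometryEquiv.toAffineIsometryEquiv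
  map_one' := by
    ext p : 1
    change c • (0 : E3) + p = p
    rw [smul_zero, zero_add]
  map_mul' g h := by
    ext p : 1
    simp only [isom_mul_apply, transl_apply, linear_mul, LinearIsometryEquiv.coe_toAffineIsometryEquiv,
      lin_mul_apply, map_add, map_smul]
    rw [isom_apply g (h 0), smul_add]
    abel

theorem scaleConj_apply (c : ℝ) (g : Isom3) (p : E3) :
    scaleConj c g p = c • g 0 + g.linearIsometryEquiv p := rfl

theorem scaleConj_linear (c : ℝ) (g : Isom3) :
    (scaleConj c g).linearIsometryEquiv = g.linearIsometryEquiv := by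
  ext v : 1
  rw [linear_apply, scaleConj_apply, scaleConj_apply, LinearIsometryEquiv.map_zero]
  abel

theorem scaleConj_zero (c : ℝ) (g : Isom3) : scaleConj c g 0 = c • g 0 := by
  rw [scaleConj_apply, LinearIsometryEquiv.map_zero, add_zero]

theorem scaleConj_transl (c : ℝ) (t : E3) : scaleConj c (transl t) = transl (c • t) := by
  ext p : 1
  rw [scaleConj_apply, transl_linear, transl_apply, transl_apply, add_zero]

theorem scaleConj_sgnIso (c : ℝ) (s : Equiv.Perm (Fin 3)) (e : Fin 3 → ℤˣ) :
    scaleConj c (sgnIso s e 0) = sgnIso s e 0 := by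
  ext p : 1
  rw [scaleConj_apply, sgnIso_zero, smul_zero, zero_add, linear_apply, sgnIso_zero, sub_zero]

theorem scaleConj_injective {c : ℝ} (hc : c ≠ 0) : Function.Injective (scaleConj c) := by
  intro g h hgh
  have h0 := congrArg (fun g : Isom3 => g 0) hgh
  simp only [scaleConj_zero] at h0
  have hl : g.linearIsometryEquiv = h.linearIsometryEquiv := by
    rw [← scaleConj_linear c g, hgh, scaleConj_linear]
  exact linear_ext (smul_right_injective _ hc h0) fun j => by rw [hl]

theorem affinelyEquivalent_scale {c : ℝ} (hc : c ≠ 0) (G : Subgroup Isom3) :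
    AffinelyEquivalent G (G.map (scaleConj c)) := by
  rw [affinelyEquivalent_iff]
  refine ⟨(LinearEquiv.smulOfNeZero ℝ E3 c hc).toAffineEquiv, ?_⟩
  rw [Subgroup.map_map]
  congr 1
  ext g : 1
  change _ = toAffineHom (scaleConj c g)
  rw [affineConj_eq_iff]
  intro p
  change c • g p = scaleConj c g (c • p)
  rw [scaleConj_apply, map_smul, isom_apply g p, smul_add, add_comm]

theorem mem_translGroup_scale {c : ℝ} (hc : c ≠ 0) (G : Subgroup Isom3) (t : E3) :
    c • t ∈ translGroup (G.map (scaleConj c)) ↔ t ∈ translGroup G := by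
  rw [mem_translGroup, mem_translGroup, ← scaleConj_transl]
  exact Subgroup.mem_map_iff_mem (scaleConj_injective hc)

theorem mem_translGroup_scale' {c : ℝ} (hc : c ≠ 0) (G : Subgroup Isom3) (t : E3) :
    t ∈ translGroup (G.map (scaleConj c)) ↔ c⁻¹ • t ∈ translGroup G := by
  rw [← mem_translGroup_scale hc G (c⁻¹ • t), smul_inv_smul₀ hc]

/-! ### The translations of a tetrahedral group -/

theorem IsTetrahedral.rho_mem {G : Subgroup Isom3} (hG : IsTetrahedral G) {t : E3}
    (ht : t ∈ translGroup G) : rho.linearIsometryEquiv t ∈ translGroup G := by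
  obtain ⟨α, hα, h⟩ := hG.exists_rho
  rw [← h]; exact linear_mem_translGroup hα ht

theorem IsTetrahedral.delta_mem {G : Subgroup Isom3} (hG : IsTetrahedral G) {t : E3}
    (ht : t ∈ translGroup G) : delta.linearIsometryEquiv t ∈ translGroup G := by
  obtain ⟨α, hα, h⟩ := hG.exists_delta
  rw [← h]; exact linear_mem_translGroup hα ht

/-- Adding the image of t under the half-turn doubles the last coordinate and kills the others;
`rho` brings any coordinate into last place. -/
theorem IsTetrahedral.single_mem {G : Subgroup Isom3} (hG : IsTetrahedral G) {t : E3}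
    (ht : t ∈ translGroup G) (i : Fin 3) :
    EuclideanSpace.single 2 (2 * t i) ∈ translGroup G := by
  have key : ∀ t ∈ translGroup G, EuclideanSpace.single 2 (2 * t 2) ∈ translGroup G := by
    intro t ht
    convert add_mem ht (hG.delta_mem ht) using 1
    ext j
    rw [PiLp.add_apply, delta, sgnIso_linear]
    fin_cases j <;> simp
    ring
  have h1 := hG.rho_mem ht
  fin_cases i
  · have := key _ h1
    rwa [rho_linear] at this
  · have := key _ (hG.rho_mem h1)
    rwa [rho_linear, rho_linear] at this
  · exact key t ht

theorem rho_linear_single (a : ℝ) (i : Fin 3) :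
    rho.linearIsometryEquiv (EuclideanSpace.single (i + 1) a) = EuclideanSpace.single i a := by
  ext j; rw [rho_linear]; simp

theorem IsTetrahedral.single_mem_iff {G : Subgroup Isom3} (hG : IsTetrahedral G) (a : ℝ)
    (i j : Fin 3) (h : EuclideanSpace.single i a ∈ translGroup G) :
    EuclideanSpace.single j a ∈ translGroup G := by
  have step : ∀ i : Fin 3, EuclideanSpace.single (i + 1) a ∈ translGroup G →
      EuclideanSpace.single i a ∈ translGroup G := fun i hi => by
    rw [← rho_linear_single]; exact hG.rho_mem hi
  have s0 := step 0
  have s1 := step 1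
  have s2 := step 2
  have e1 : (2 : Fin 3) + 1 = 0 := rfl
  have e4 : (1 : Fin 3) + 1 = 2 := rfl
  simp only [zero_add, e1, e4] at s0 s1 s2
  fin_cases i <;> fin_cases j <;> simp at h ⊢ <;> tauto

/-- A group of translation vectors lying between twice the integers and the integers, without
unit vectors. -/
structure IsNormalized (L : AddSubgroup E3) : Prop where
  int : ∀ t ∈ L, ∃ X : Fin 3 → ℤ, t = halfPt (2 * X)
  double : ∀ X : Fin 3 → ℤ, halfPt (4 * X) ∈ L
  unit : ∀ i, halfPt (2 * Pi.single i 1) ∉ L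
  cyclic : ∀ X : Fin 3 → ℤ, halfPt (2 * X) ∈ L → halfPt (2 * fun i => X (i + 1)) ∈ L

theorem IsTetrahedral.scale {G : Subgroup Isom3} (hG : IsTetrahedral G) {c : ℝ} (hc : c ≠ 0) :
    IsTetrahedral (G.map (scaleConj c)) := by
  obtain ⟨⟨α, hα, h1⟩, ⟨β, hβ, h2⟩, ⟨r, hr, hmin⟩, t, ht, ht0⟩ := hG
  refine ⟨⟨_, ⟨α, hα, rfl⟩, by rw [scaleConj_linear, h1]⟩,
    ⟨_, ⟨β, hβ, rfl⟩, by rw [scaleConj_linear, h2]⟩, ⟨|c| * r, by positivity, fun u hu hu0 => ?_⟩,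
    c • t, (mem_translGroup_scale hc G t).2 ht, smul_ne_zero hc ht0⟩
  have h3 := hmin _ ((mem_translGroup_scale' hc G u).1 hu) (smul_ne_zero (inv_ne_zero hc) hu0)
  rw [norm_smul, norm_inv, Real.norm_eq_abs, ← div_eq_inv_mul, le_div_iff₀ (abs_pos.2 hc)] at h3
  linarith

theorem IsTetrahedral.exists_isNormalized {G : Subgroup Isom3} (hG : IsTetrahedral G) :
    ∃ c : ℝ, c ≠ 0 ∧ IsNormalized (translGroup (G.map (scaleConj c))) := by
  let φ : ℝ →+ E3 := AddMonoidHom.mk' (fun a => EuclideanSpace.single 2 a) fun a b => by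
    ext i; fin_cases i <;> simp
  obtain ⟨r, hr, hmin⟩ := hG.exists_le_norm
  obtain ⟨t, ht, ht0⟩ := hG.exists_ne_zero
  -- The translations along the last axis form a discrete, hence cyclic, group. Scaling its
  -- generator to 2 makes all translations integral by `single_mem`.
  obtain ⟨b, hb⟩ := AddSubgroup.cyclic_of_isolated_zero (H := (translGroup G).comap φ) hr (by
    rw [Set.disjoint_left]
    rintro a ha ⟨h1, h2⟩
    have h3 := hmin _ ha (by
      intro h
      have := congrArg (fun p : E3 => p 2) h
      simp [φ] at this
      linarith)
    simp [φ, abs_of_pos h1] at h3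
    linarith)
  have hbmem : ∀ a, EuclideanSpace.single 2 a ∈ translGroup G ↔ ∃ n : ℤ, n * b = a := fun a => by
    have : EuclideanSpace.single 2 a ∈ translGroup G ↔ a ∈ (translGroup G).comap φ := Iff.rfl
    rw [this, hb, AddSubgroup.mem_closure_singleton]
    simp
  have hb0 : b ≠ 0 := by
    rintro rfl
    apply ht0
    ext i
    obtain ⟨n, hn⟩ := (hbmem _).1 (hG.single_mem ht i)
    simp at hn
    exact hn
  have hc : 2 / b ≠ 0 := div_ne_zero two_ne_zero hb0
  have hG' := hG.scale hc
  have hmem : ∀ a, EuclideanSpace.single 2 a ∈ translGroup (G.map (scaleConj (2 / b))) ↔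
      ∃ n : ℤ, a = 2 * n := fun a => by
    rw [mem_translGroup_scale' hc]
    have : (2 / b)⁻¹ • EuclideanSpace.single 2 a = (EuclideanSpace.single 2 (a * b / 2) : E3) := by
      ext i; fin_cases i <;> simp
      field_simp
    rw [this, hbmem]
    refine exists_congr fun n => ?_
    constructor
    · intro h
      have : (a - 2 * n) * b = 0 := by linarith
      rcases mul_eq_zero.1 this with h | h
      · linarith
      · exact absurd h hb0
    · rintro rfl; ring
  refine ⟨2 / b, hc, ?_⟩
  generalize G.map (scaleConj (2 / b)) = G' at hG' hmem
  refine ⟨fun t ht => ?_, fun X => ?_, fun i hi => ?_, fun X hX => ?_⟩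
  · choose X hX using fun i => (hmem _).1 (hG'.single_mem ht i)
    refine ⟨X, ?_⟩
    ext i
    have := hX i
    simp
    linarith
  · have h1 : ∀ i, EuclideanSpace.single i (2 * (X i : ℝ)) ∈ translGroup G' := fun i =>
      hG'.single_mem_iff _ 2 i ((hmem _).2 ⟨X i, rfl⟩)
    convert add_mem (add_mem (h1 0) (h1 1)) (h1 2) using 1
    ext i
    fin_cases i <;> simp <;> ring
  · have h1 : halfPt (2 * Pi.single i 1) = EuclideanSpace.single i 1 := by
      ext j
      by_cases h : j = i
      · subst h; simp
      · simp [h]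
    rw [h1] at hi
    obtain ⟨n, hn⟩ := (hmem 1).1 (hG'.single_mem_iff _ i 2 hi)
    have : (1 : ℤ) = 2 * n := by exact_mod_cast hn
    lia
  · convert hG'.rho_mem hX using 1
    ext i
    rw [rho_linear]
    simp

/-! ### Lattices between twice the integers and the integers -/

section Normalized

variable {L : AddSubgroup E3}

theorem IsNormalized.mem_iff_of_even (hL : IsNormalized L) {X Y : Fin 3 → ℤ}
    (h : ∀ i, (X i - Y i) % 2 = 0) : halfPt (2 * X) ∈ L ↔ halfPt (2 * Y) ∈ L := by
  have h1 : halfPt (2 * X) = halfPt (2 * Y) + halfPt (4 * fun i => (X i - Y i) / 2) := by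
    rw [halfPt_add]
    congr 1
    funext i
    have := h i
    simp
    lia
  rw [h1]
  exact add_mem_cancel_right (hL.double _)

theorem IsNormalized.not_mem_odd (hL : IsNormalized L) {X : Fin 3 → ℤ} (i : Fin 3)
    (h0 : X i % 2 = 1) (h1 : X (i + 1) % 2 = 0) (h2 : X (i + 2) % 2 = 0) :
    halfPt (2 * X) ∉ L := by
  rw [hL.mem_iff_of_even (Y := Pi.single i 1)]
  · exact hL.unit i
  · intro j
    fin_cases i <;> fin_cases j <;> simp at * <;> lia

/-- If the lattice is not face-centred, its points have coordinates of the same parity. -/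
theorem IsNormalized.samePar (hL : IsNormalized L) (h : halfPt (2 * ![0, 1, 1]) ∉ L)
    {X : Fin 3 → ℤ} (hX : halfPt (2 * X) ∈ L) : SamePar X := by
  -- Cyclic invariance rules out every vector with exactly two odd coordinates, and unit vectors are
  -- excluded already; none or three odd ones remain.
  have h0 : ∀ X : Fin 3 → ℤ, X 0 % 2 = 0 → X 1 % 2 = 1 → X 2 % 2 = 1 → halfPt (2 * X) ∉ L := by
    intro X h0 h1 h2
    rwa [hL.mem_iff_of_even (Y := ![0, 1, 1])]
    intro i
    fin_cases i <;> simp <;> lia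
  have hX1 := hL.cyclic X hX
  have hX2 := hL.cyclic _ hX1
  have a0 := fun x y z => h0 X x y z hX
  have a1 := fun x y z => h0 _ x y z hX1
  have a2 := fun x y z => h0 _ x y z hX2
  have b0 := fun x y z => hL.not_mem_odd (X := X) 0 x y z hX
  have b1 := fun x y z => hL.not_mem_odd (X := X) 1 x y z hX
  have b2 := fun x y z => hL.not_mem_odd (X := X) 2 x y z hX
  have e1 : (2 : Fin 3) + 1 = 0 := rfl
  have e2 : (2 : Fin 3) + 2 = 1 := rfl
  have e3 : (1 : Fin 3) + 2 = 0 := rfl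
  have e4 : (1 : Fin 3) + 1 = 2 := rfl
  simp only [zero_add, e1, e2, e3, e4] at a0 a1 a2 b0 b1 b2
  unfold SamePar
  lia

/-- If all coordinates were odd, subtracting (0,1,1) would leave a vector with one odd coordinate.
-/
theorem IsNormalized.even_of_mem (hL : IsNormalized L) (h : halfPt (2 * ![0, 1, 1]) ∈ L)
    {X : Fin 3 → ℤ} (hX : halfPt (2 * X) ∈ L) : (X 0 + X 1 + X 2) % 2 = 0 := by
  have b0 := fun x y z => hL.not_mem_odd (X := X) 0 x y z hX
  have b1 := fun x y z => hL.not_mem_odd (X := X) 1 x y z hX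
  have b2 := fun x y z => hL.not_mem_odd (X := X) 2 x y z hX
  have hX' : halfPt (2 * (X - ![0, 1, 1])) ∈ L := by
    rw [mul_sub, ← halfPt_sub]; exact sub_mem hX h
  have b3 := fun x y z => hL.not_mem_odd 0 x y z hX'
  have e1 : (2 : Fin 3) + 1 = 0 := rfl
  have e2 : (2 : Fin 3) + 2 = 1 := rfl
  have e3 : (1 : Fin 3) + 2 = 0 := rfl
  have e4 : (1 : Fin 3) + 1 = 2 := rfl
  simp only [zero_add, e1, e2, e3, e4] at b0 b1 b2 b3
  simp at b3
  lia

end Normalized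

/-! ### The choice of the origin -/

theorem eq_sgnIso_of_linear {g : Isom3} {s : Equiv.Perm (Fin 3)} {e : Fin 3 → ℤˣ} {t : E3}
    (h : g.linearIsometryEquiv = (sgnIso s e t).linearIsometryEquiv) : g = sgnIso s e (g 0) :=
  linear_ext (sgnIso_zero s e _).symm fun j => by
    rw [h]; ext i; rw [sgnIso_linear, sgnIso_linear]

theorem conj_transl_sgnIso (u t : E3) (s : Equiv.Perm (Fin 3)) (e : Fin 3 → ℤˣ) :
    MulAut.conj (transl u) (sgnIso s e t) =
      sgnIso s e (WithLp.toLp 2 fun i => u i + t i - ((e i : ℤ) : ℝ) * u (s i)) := by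
  rw [MulAut.conj_apply, mul_inv_eq_iff_eq_mul]
  ext p i
  simp [isom_mul_apply, transl_apply, sgnIso_apply]
  ring

theorem translGroup_conj_transl (G : Subgroup Isom3) (u : E3) :
    translGroup (G.map (MulAut.conj (transl u)).toMonoidHom) = translGroup G := by
  ext t
  rw [translGroup_map_conj]
  have : (transl u).linearIsometryEquiv = 1 := by ext v : 1; exact transl_linear u v
  rw [this, inv_one]; rfl

theorem finRotate_three_apply (i : Fin 3) : finRotate 3 i = i + 1 := by
  simp

/-- After a change of origin the rotation `rho` belongs to the group, together with a screw motion
whose axis is parallel to the last coordinate axis and has first coordinate zero. -/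
theorem IsTetrahedral.exists_origin {G : Subgroup Isom3} (hG : IsTetrahedral G) :
    ∃ u : E3, rho ∈ G.map (MulAut.conj (transl u)).toMonoidHom ∧ ∃ b e : ℝ,
      sgnIso 1 ![-1, -1, 1] !₂[0, b, e] ∈ G.map (MulAut.conj (transl u)).toMonoidHom := by
  obtain ⟨α, hα, h1⟩ := hG.exists_rho
  obtain ⟨β, hβ, h2⟩ := hG.exists_delta
  have h1' := eq_sgnIso_of_linear h1
  have h2' := eq_sgnIso_of_linear h2
  generalize α 0 = t at h1'
  generalize β 0 = d at h2'
  subst h1' h2'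
  obtain ⟨s, hs⟩ : ∃ s, s = t 0 + t 1 + t 2 := ⟨_, rfl⟩
  have hcube : sgnIso (finRotate 3) 1 t * (sgnIso (finRotate 3) 1 t * sgnIso (finRotate 3) 1 t) =
      transl !₂[s, s, s] := by
    ext p i
    simp only [isom_mul_apply, transl_apply, sgnIso_apply, finRotate_three_apply]
    fin_cases i <;> simp [hs] <;> ring_nf
  have hsL : !₂[s, s, s] ∈ translGroup G := by
    rw [mem_translGroup, ← hcube]
    exact mul_mem hα (mul_mem hα hα)
  -- Composing with the translation (-s,-s,s), the half-turn image of the cube, makes the coordinate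
  -- sum of the translation part zero, so the element has fixed points.
  have hα' : sgnIso (finRotate 3) 1 !₂[t 0 - s, t 1 - s, t 2 + s] ∈ G := by
    have h3 := mul_mem ((mem_translGroup _ _).1 (hG.delta_mem hsL)) hα
    rw [transl_mul_sgnIso] at h3
    convert h3 using 2
    ext i
    rw [PiLp.add_apply, delta, sgnIso_linear]
    fin_cases i <;> simp <;> ring
  -- The origin moves to a point of the threefold axis; the position `a` along it is chosen to
  -- cancel the first component of the screw motion.
  obtain ⟨a, ha⟩ : ∃ a, a = -(d 0 + -(t 1 - s) * 2 - (t 0 - s) * 2) / 2 := ⟨_, rfl⟩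
  refine ⟨!₂[a - (t 1 - s) - (t 0 - s), a - (t 1 - s), a], ⟨_, hα', ?_⟩,
    d 1 + 2 * (a - (t 1 - s)), d 2, ⟨_, hβ, conj_transl_sgnIso _ _ _ _ |>.trans ?_⟩⟩
  · refine (conj_transl_sgnIso _ _ _ _).trans ?_
    rw [rho]
    congr 1
    ext i
    rw [PiLp.toLp_apply, finRotate_three_apply]
    fin_cases i <;> simp [hs]
    ring
  · congr 1
    ext i
    fin_cases i <;> simp [ha] <;> ring

theorem sgnIso_delta_mul_self (b e : ℝ) :
    sgnIso 1 ![-1, -1, 1] !₂[0, b, e] * sgnIso 1 ![-1, -1, 1] !₂[0, b, e] =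
      transl !₂[0, 0, 2 * e] := by
  ext p i
  simp only [isom_mul_apply, transl_apply, sgnIso_apply]
  fin_cases i <;> simp <;> ring

theorem sgnIso_delta_triple (b e : ℝ) :
    sgnIso 1 ![-1, -1, 1] !₂[0, b, e] * (rho * sgnIso 1 ![-1, -1, 1] !₂[0, b, e] * rho⁻¹) *
      (rho * (rho * sgnIso 1 ![-1, -1, 1] !₂[0, b, e] * rho⁻¹) * rho⁻¹) =
      transl !₂[e - b, b - e, e - b] := by
  rw [rho_conj, rho_conj]
  ext p i
  simp only [isom_mul_apply, transl_apply, sgnIso_apply]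
  have e1 : (2 : Fin 3) + 1 = 0 := rfl
  have e4 : (1 : Fin 3) + 1 = 2 := rfl
  fin_cases i <;> simp [e1, e4] <;> ring

/-- The square of the screw motion and the product of its three conjugates under `rho` are
translations; they make b and e integral, and 2ℤ³ reduces them modulo 2. If the parities differ, the
second translation has all coordinates odd. -/
theorem exists_parity {G : Subgroup Isom3} (hL : IsNormalized (translGroup G)) (hρ : rho ∈ G)
    {b e : ℝ} (h : sgnIso 1 ![-1, -1, 1] !₂[0, b, e] ∈ G) :
    ∃ B E : ℤ, (B = 0 ∨ B = 1) ∧ (E = 0 ∨ E = 1) ∧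
      (B ≠ E → halfPt (2 * ![1, 1, 1]) ∈ translGroup G) ∧
      sgnIso 1 ![-1, -1, 1] (halfPt (2 * ![0, B, E])) ∈ G := by
  have h1 : !₂[0, 0, 2 * e] ∈ translGroup G := by
    rw [mem_translGroup, ← sgnIso_delta_mul_self]; exact mul_mem h h
  have h2 : !₂[e - b, b - e, e - b] ∈ translGroup G := by
    rw [mem_translGroup, ← sgnIso_delta_triple]
    have h3 := mul_mem (mul_mem hρ h) (inv_mem hρ)
    exact mul_mem (mul_mem h h3) (mul_mem (mul_mem hρ h3) (inv_mem hρ))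
  obtain ⟨X, hX⟩ := hL.int _ h1
  obtain ⟨Y, hY⟩ := hL.int _ h2
  have x0 := congrArg (fun p : E3 => p 0) hX
  have x1 := congrArg (fun p : E3 => p 1) hX
  have x2 := congrArg (fun p : E3 => p 2) hX
  have y0 := congrArg (fun p : E3 => p 0) hY
  have y1 := congrArg (fun p : E3 => p 1) hY
  have y2 := congrArg (fun p : E3 => p 2) hY
  simp at x0 x1 x2 y0 y1 y2
  have hX0 : X 0 = 0 := by exact_mod_cast x0.symm
  have hX1 : X 1 = 0 := by exact_mod_cast x1.symm
  have hX2 : X 2 % 2 = 0 := by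
    by_contra hne
    exact hL.not_mem_odd (X := X) 2 (by lia) (by simp [hX0]) (by
      have e2 : (2 : Fin 3) + 2 = 1 := rfl
      simp [e2, hX1]) (hX ▸ h1)
  obtain ⟨E, hE⟩ : ∃ E, X 2 = 2 * E := ⟨X 2 / 2, by lia⟩
  rw [hE] at x2
  push_cast at x2
  have he : e = E := by linarith
  have hb : b = ((E - Y 0 : ℤ) : ℝ) := by push_cast; linarith
  have y01 : Y 1 = -Y 0 := by
    have : (Y 1 : ℝ) = -Y 0 := by linarith
    exact_mod_cast this
  have y02 : Y 2 = Y 0 := by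
    have : (Y 2 : ℝ) = Y 0 := by linarith
    exact_mod_cast this
  refine ⟨(E - Y 0) % 2, E % 2, Int.emod_two_eq_zero_or_one _, Int.emod_two_eq_zero_or_one _,
    fun hne => ?_, ?_⟩
  · rw [hL.mem_iff_of_even (Y := Y), ← hY]
    · exact h2
    · intro i
      fin_cases i <;> simp <;> lia
  · have h3 := mul_mem ((mem_translGroup _ _).1
      (hL.double ![0, -((E - Y 0) / 2), -(E / 2)])) h
    rw [transl_mul_sgnIso] at h3
    convert h3 using 2
    have p1 : (((E - Y 0) % 2 : ℤ) : ℝ) = b - 2 * (((E - Y 0) / 2 : ℤ) : ℝ) := by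
      rw [hb, Int.emod_def]; push_cast; ring
    have p2 : ((E % 2 : ℤ) : ℝ) = e - 2 * ((E / 2 : ℤ) : ℝ) := by
      rw [he, Int.emod_def]; push_cast; ring
    ext i
    fin_cases i
    · simp
    · simp only [halfPt_apply, PiLp.add_apply]
      simp
      rw [p1]; ring
    · simp only [halfPt_apply, PiLp.add_apply]
      simp
      rw [p2]; ring

theorem rho_conj_diag (a : ℝ) : MulAut.conj (transl !₂[a, a, a]) rho = rho := by
  rw [rho, conj_transl_sgnIso]
  congr 1
  ext i
  rw [PiLp.toLp_apply, finRotate_three_apply]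
  fin_cases i <;> simp

/-- After a change of origin the group contains `rho`, and either `delta` or, unless the lattice is
face-centred, `screw`. -/
theorem exists_delta_or_screw {G : Subgroup Isom3} (hL : IsNormalized (translGroup G))
    (hρ : rho ∈ G) {b e : ℝ} (h : sgnIso 1 ![-1, -1, 1] !₂[0, b, e] ∈ G) :
    ∃ u : E3, rho ∈ G.map (MulAut.conj (transl u)).toMonoidHom ∧
      (delta ∈ G.map (MulAut.conj (transl u)).toMonoidHom ∨
        halfPt (2 * ![0, 1, 1]) ∉ translGroup G ∧
          screw ∈ G.map (MulAut.conj (transl u)).toMonoidHom) := by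
  obtain ⟨B, E, hB, hE, hBE, hmem⟩ := exists_parity hL hρ h
  have hdelta : delta = sgnIso 1 ![-1, -1, 1] (halfPt 0) := by
    rw [delta]; congr 1; ext i; simp
  -- The remaining freedom: compose with a lattice translation D and move the origin by `a` along
  -- the diagonal, which keeps `rho`.
  have key : ∀ (a : ℝ) (D T : Fin 3 → ℤ), halfPt (2 * D) ∈ translGroup G →
      (∀ i, (T i : ℝ) / 2 = a + ((2 * ![0, B, E] : Fin 3 → ℤ) i : ℝ) / 2 + D i -
        ((![-1, -1, 1] : Fin 3 → ℤ) i : ℝ) * a) →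
      rho ∈ G.map (MulAut.conj (transl !₂[a, a, a])).toMonoidHom ∧
        sgnIso 1 ![-1, -1, 1] (halfPt T) ∈
          G.map (MulAut.conj (transl !₂[a, a, a])).toMonoidHom := by
    intro a D T hD hT
    refine ⟨⟨rho, hρ, rho_conj_diag a⟩, _, mul_mem hD hmem, ?_⟩
    rw [transl_mul_sgnIso]
    refine (conj_transl_sgnIso _ _ _ _).trans ?_
    congr 1
    ext i
    have := hT i
    rw [halfPt_apply, this]
    fin_cases i <;> simp <;> ring
  have h0 : halfPt (2 * 0) ∈ translGroup G := by
    have : halfPt (2 * 0) = 0 := by ext i; simp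
    rw [this]; exact zero_mem _
  rcases hB with rfl | rfl <;> rcases hE with rfl | rfl
  · obtain ⟨k1, k2⟩ := key 0 0 0 h0 (by intro i; fin_cases i <;> simp)
    exact ⟨_, k1, Or.inl (by rwa [hdelta])⟩
  -- In the body-centred lattice the translation by (1,1,1) with the shift -1/2 adds 1 to the last
  -- component only; here the resulting 2 is a lattice translation.
  · obtain ⟨k1, k2⟩ := key (-1 / 2) ![1, 1, 1] ![0, 0, 4] (hBE (by decide))
      (by intro i; fin_cases i <;> simp <;> norm_num)
    refine ⟨_, k1, Or.inl ?_⟩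
    have h3 : transl (halfPt (4 * ![0, 0, -1])) ∈
        G.map (MulAut.conj (transl !₂[-1 / 2, -1 / 2, -1 / 2])).toMonoidHom := by
      rw [← mem_translGroup, translGroup_conj_transl]; exact hL.double _
    have h4 := mul_mem h3 k2
    rw [transl_mul_sgnIso, halfPt_add] at h4
    rw [hdelta]
    convert h4 using 3
    decide
  · obtain ⟨k1, k2⟩ := key (-1 / 2) ![1, 1, 1] ![0, 2, 2] (hBE (by decide))
      (by intro i; fin_cases i <;> simp <;> norm_num)
    refine ⟨_, k1, Or.inr ⟨fun hF => ?_, by rwa [screw]⟩⟩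
    have := hL.even_of_mem hF (hBE (by decide))
    simp at this
  · by_cases hF : halfPt (2 * ![0, 1, 1]) ∈ translGroup G
    · obtain ⟨k1, k2⟩ := key 0 (-![0, 1, 1]) 0 (by
        have : halfPt (2 * -![0, 1, 1]) = -halfPt (2 * ![0, 1, 1]) := by
          ext i; fin_cases i <;> simp
        rw [this]; exact neg_mem hF) (by intro i; fin_cases i <;> simp)
      exact ⟨_, k1, Or.inl (by rwa [hdelta])⟩
    · obtain ⟨k1, k2⟩ := key 0 0 ![0, 2, 2] h0 (by intro i; fin_cases i <;> simp)
      exact ⟨_, k1, Or.inr ⟨hF, by rwa [screw]⟩⟩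

/-! ### Every irreducible space group is a full group or a quarter group -/

theorem sgnIso_eq_one {s : Equiv.Perm (Fin 3)} {e : Fin 3 → ℤˣ} {t : E3} (h : sgnIso s e t = 1) :
    s = 1 ∧ e = 1 := by
  have hl : ∀ (v : E3) i, ((e i : ℤ) : ℝ) * v (s i) = v i := fun v i => by
    rw [← sgnIso_linear s e t, h]; rfl
  have hs : ∀ i, s i = i := fun i => by
    by_contra hne
    have := hl (EuclideanSpace.single i 1) i
    simp [hne] at this
  refine ⟨Equiv.ext hs, funext fun i => ?_⟩
  have := hl (EuclideanSpace.single i 1) i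
  rw [hs] at this
  simp at this
  exact_mod_cast this

theorem even_of_sgnIso_cube {s : Equiv.Perm (Fin 3)} {e : Fin 3 → ℤˣ} {t : E3}
    (h : sgnIso s e t ^ 3 = 1) : Equiv.Perm.sign s = 1 ∧ (∏ i, e i) = 1 := by
  rw [pow_three, sgnIso_mul, sgnIso_mul] at h
  obtain ⟨h1, h2⟩ := sgnIso_eq_one h
  have key : ∀ (s : Equiv.Perm (Fin 3)) (e : Fin 3 → ℤˣ), s * s * s = 1 →
      (∀ i, e i * (e (s i) * e (s (s i))) = 1) → Equiv.Perm.sign s = 1 ∧ (∏ i, e i) = 1 := by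
    decide +kernel
  exact key s e h1 fun i => congrFun h2 i

theorem exists_sgnIso_of_isNormalized {G : Subgroup Isom3} (hL : IsNormalized (translGroup G))
    {g : Isom3} (hg : g ∈ G) : ∃ s e, g = sgnIso s e (g 0) := by
  refine exists_sgnIso_of_double g fun j => ?_
  have h1 : EuclideanSpace.single j (2 : ℝ) = halfPt (4 * Pi.single j 1) := by
    ext i
    by_cases h : i = j
    · subst h; norm_num
    · simp [h]
  have h2 := linear_mem_translGroup hg (hL.double (Pi.single j 1))
  rw [← h1] at h2
  obtain ⟨X, hX⟩ := hL.int _ h2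
  rw [hX]
  refine exists_double_of_norm ?_
  rw [← hX, LinearIsometryEquiv.norm_map, PiLp.norm_single, Real.norm_ofNat]

/-- A group containing an odd subgroup `T` of `N` and whose elements act by signed permutations and
whose translations lie in `N` is contained in `N` if `N` is the normalizer of `T`. -/
theorem le_of_oddSubgroup_le {G N T : Subgroup Isom3} (hT : oddSubgroup N = T)
    (hN : Subgroup.normalizer (oddSubgroup N : Set Isom3) = N) (hTG : T ≤ G)
    (hsgn : ∀ g ∈ G, ∃ s e, g = sgnIso s e (g 0))
    (hrep : ∀ s e, Equiv.Perm.sign s = 1 → (∏ i, e i) = 1 → ∃ t, sgnIso s e t ∈ T)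
    (htr : ∀ t ∈ translGroup G, transl t ∈ N) : G ≤ N := by
  have hTN : T ≤ N := by
    rw [← hT]
    exact (Subgroup.closure_le _).2 fun g hg => hg.1
  -- An element of order 3 in G has an even linear part, so it differs from an element of `T` by a
  -- translation of G and lies in N. Thus both groups have the same odd subgroup, which G
  -- normalizes.
  have hodd : oddSubgroup G = oddSubgroup N := by
    apply le_antisymm
    · refine Subgroup.closure_mono ?_
      rintro g ⟨hg, ho⟩
      refine ⟨?_, ho⟩
      obtain ⟨s, e, hse⟩ := hsgn g hg
      have h3 := orderOf_dvd_iff_pow_eq_one.1 ho.dvd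
      rw [hse] at h3
      obtain ⟨hs, he⟩ := even_of_sgnIso_cube h3
      obtain ⟨t, ht⟩ := hrep s e hs he
      have hfac : transl (g 0 - t) * sgnIso s e t = g := by
        rw [transl_mul_sgnIso, sub_add_cancel]; exact hse.symm
      have h4 : transl (g 0 - t) ∈ G := by
        rw [← hfac] at hg
        exact (Subgroup.mul_mem_cancel_right _ (hTG ht)).1 hg
      rw [← hfac]
      exact mul_mem (htr _ h4) (hTN ht)
    · refine Subgroup.closure_mono ?_
      rintro g ⟨hg, ho⟩
      refine ⟨hTG ?_, ho⟩
      rw [← hT]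
      exact Subgroup.subset_closure ⟨hg, ho⟩
  have := le_normalizer_oddSubgroup G
  rwa [hodd, hN] at this

theorem halfPt_zero : halfPt 0 = 0 := by ext i; simp

theorem sgnIso_mem_fullGroup_bot {s : Equiv.Perm (Fin 3)} {e : Fin 3 → ℤˣ}
    (hs : Equiv.Perm.sign s = 1) (he : (∏ i, e i) = 1) : sgnIso s e 0 ∈ fullGroup ⊥ :=
  (mem_fullGroup_bot_iff_exists _).2 ⟨s, e, 0, hs, he, by unfold SamePar; decide, by decide,
    by rw [halfPt_zero]⟩

theorem sgnIso_mem_quarterGroup_bot {s : Equiv.Perm (Fin 3)} {e : Fin 3 → ℤˣ}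
    (hs : Equiv.Perm.sign s = 1) (he : (∏ i, e i) = 1) :
    sgnIso s e (halfPt (shift s e)) ∈ quarterGroup ⊥ :=
  (mem_quarterGroup_bot_iff_exists _).2 ⟨s, e, 0, hs, he, by simp, by rw [zero_add]⟩

theorem transl_halfPt_mem_bccSymm {X : Fin 3 → ℤ} (hX : SamePar X) :
    transl (halfPt X) ∈ bccSymm := by
  rw [transl_eq_sgnIso]; exact sgnIso_mem_bccSymm _ _ hX

theorem samePar_two_mul (X : Fin 3 → ℤ) : SamePar (2 * X) := by
  unfold SamePar; simp

theorem exists_eq_fullGroup {G : Subgroup Isom3} (h : fullGroup ⊥ ≤ G) (h' : G ≤ bccSymm) :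
    ∃ H, G = fullGroup H := by
  rw [fullGroup_eq_liftGroup] at h
  obtain ⟨H, rfl⟩ := exists_eq_liftGroup signedHom h h'
  exact ⟨H, (fullGroup_eq_liftGroup H).symm⟩

theorem exists_eq_quarterGroup {G : Subgroup Isom3} (h : quarterGroup ⊥ ≤ G)
    (h' : G ≤ markedSymm) : ∃ K, G = quarterGroup K := by
  rw [quarterGroup_eq_liftGroup] at h
  obtain ⟨K, rfl⟩ := exists_eq_liftGroup permHom h h'
  exact ⟨K, (quarterGroup_eq_liftGroup K).symm⟩

theorem exists_eq_fullGroup_of_faceCentred {G : Subgroup Isom3}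
    (hL : IsNormalized (translGroup G)) (hρ : rho ∈ G) (hδ : delta ∈ G)
    (hF : halfPt (2 * ![0, 1, 1]) ∈ translGroup G) : ∃ H, G = fullGroup H := by
  have h2 := hL.cyclic _ hF
  have hT : fullGroup ⊥ ≤ G := by
    refine fullGroup_bot_le hρ hδ ?_
    rw [← mem_translGroup]
    convert h2 using 2
    decide
  refine exists_eq_fullGroup hT (le_of_oddSubgroup_le oddSubgroup_bccSymm
    normalizer_oddSubgroup_bccSymm hT (fun g hg => exists_sgnIso_of_isNormalized hL hg)
    (fun s e hs he => ⟨0, sgnIso_mem_fullGroup_bot hs he⟩) fun t ht => ?_)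
  obtain ⟨X, rfl⟩ := hL.int t ht
  exact transl_halfPt_mem_bccSymm (samePar_two_mul X)

/-- Halving turns 2ℤ³ into ℤ³ and vectors with coordinates of equal parity into bcc vectors, so the
primitive and the body-centred case also lie between T₁ and N₁. -/
theorem exists_scale_eq_fullGroup {G : Subgroup Isom3} (hL : IsNormalized (translGroup G))
    (hρ : rho ∈ G) (hδ : delta ∈ G) (hF : halfPt (2 * ![0, 1, 1]) ∉ translGroup G) :
    ∃ H, G.map (scaleConj (1 / 2)) = fullGroup H := by
  have hc : (1 / 2 : ℝ) ≠ 0 := by norm_num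
  have hsc : ∀ X : Fin 3 → ℤ, (1 / 2 : ℝ) • halfPt (2 * X) = halfPt X := fun X => by
    ext i; simp; ring
  have hT : fullGroup ⊥ ≤ G.map (scaleConj (1 / 2)) := by
    refine fullGroup_bot_le ⟨rho, hρ, scaleConj_sgnIso _ _ _⟩ ⟨delta, hδ, scaleConj_sgnIso _ _ _⟩ ?_
    rw [← mem_translGroup, ← hsc, mem_translGroup_scale hc]
    convert hL.double ![1, 1, 0] using 2
    decide
  refine exists_eq_fullGroup hT (le_of_oddSubgroup_le oddSubgroup_bccSymm
    normalizer_oddSubgroup_bccSymm hT ?_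
    (fun s e hs he => ⟨0, sgnIso_mem_fullGroup_bot hs he⟩) fun t ht => ?_)
  · rintro _ ⟨g, hg, rfl⟩
    obtain ⟨s, e, hse⟩ := exists_sgnIso_of_isNormalized hL hg
    exact ⟨s, e, eq_sgnIso_of_linear (t := g 0) (by rw [scaleConj_linear, ← hse])⟩
  · rw [mem_translGroup_scale' hc] at ht
    obtain ⟨X, hX⟩ := hL.int _ ht
    have h1 : t = halfPt X := by
      rw [← hsc, ← hX, smul_inv_smul₀ hc]
    rw [h1]
    rw [hX] at ht
    exact transl_halfPt_mem_bccSymm (hL.samePar hF ht)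

theorem exists_eq_quarterGroup_of_screw {G : Subgroup Isom3}
    (hL : IsNormalized (translGroup G)) (hρ : rho ∈ G) (hσ : screw ∈ G)
    (hF : halfPt (2 * ![0, 1, 1]) ∉ translGroup G) : ∃ K, G = quarterGroup K := by
  have hT := quarterGroup_bot_le hρ hσ
  refine exists_eq_quarterGroup hT (le_of_oddSubgroup_le oddSubgroup_markedSymm
    normalizer_oddSubgroup_markedSymm hT (fun g hg => exists_sgnIso_of_isNormalized hL hg)
    (fun s e hs he => ⟨_, sgnIso_mem_quarterGroup_bot hs he⟩) fun t ht => ?_)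
  obtain ⟨X, rfl⟩ := hL.int t ht
  have h1 := hL.samePar hF ht
  rw [transl_mem_markedSymm_iff (samePar_two_mul X)]
  unfold SamePar at h1
  unfold MarkedTransl
  simp
  lia

theorem exists_affinelyEquivalent {G : Subgroup Isom3} (hG : IsSpaceGroup G)
    (hI : IsIrreducibleGroup G) :
    (∃ H, AffinelyEquivalent G (fullGroup H)) ∨ ∃ K, AffinelyEquivalent G (quarterGroup K) := by
  have hconj : ∀ (G : Subgroup Isom3) g, AffinelyEquivalent G (G.map (MulAut.conj g).toMonoidHom) :=
    fun G g => affinelyEquivalent_of_conj g rfl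
  obtain ⟨g, hg⟩ := exists_isTetrahedral hG hI
  have q1 := hconj G g
  obtain ⟨c, hc, hL⟩ := hg.exists_isNormalized
  have q2 := q1.trans (affinelyEquivalent_scale hc _)
  have hg' := hg.scale hc
  generalize (G.map (MulAut.conj g).toMonoidHom).map (scaleConj c) = G₂ at hL q2 hg'
  obtain ⟨u, hρ, b, e, hbe⟩ := hg'.exists_origin
  have q3 := q2.trans (hconj G₂ (transl u))
  rw [← translGroup_conj_transl G₂ u] at hL
  generalize G₂.map (MulAut.conj (transl u)).toMonoidHom = G₃ at hρ hbe q3 hL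
  obtain ⟨u', hρ', h⟩ := exists_delta_or_screw hL hρ hbe
  have q4 := q3.trans (hconj G₃ (transl u'))
  rw [← translGroup_conj_transl G₃ u'] at hL h
  generalize G₃.map (MulAut.conj (transl u')).toMonoidHom = G₄ at hρ' h q4 hL
  rcases h with h | ⟨hF, h⟩
  · left
    by_cases hF : halfPt (2 * ![0, 1, 1]) ∈ translGroup G₄
    · obtain ⟨H, rfl⟩ := exists_eq_fullGroup_of_faceCentred hL hρ' h hF
      exact ⟨H, q4⟩
    · obtain ⟨H, hH⟩ := exists_scale_eq_fullGroup hL hρ' h hF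
      refine ⟨H, ?_⟩
      rw [← hH]
      exact q4.trans (affinelyEquivalent_scale (by norm_num) _)
  · right
    obtain ⟨K, rfl⟩ := exists_eq_quarterGroup_of_screw hL hρ' h hF
    exact ⟨K, q4⟩

/-! ### Counting the subgroups of the dihedral group and of its product with `±1` -/

/-- The number `c + 4 e + 8 s` stands for the permutation `k ↦ (-1) ^ e k + c` with the sign
`(-1) ^ s`; this is the multiplication. -/
def mulIdx (a b : ℕ) : ℕ :=
  (a % 4 + if a / 4 % 2 = 0 then b % 4 else 4 - b % 4) % 4 +
    4 * ((a / 4 + b / 4) % 2) + 8 * ((a / 8 + b / 8) % 2)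

def invIdx (a : ℕ) : ℕ :=
  (if a / 4 % 2 = 0 then (4 - a % 4) % 4 else a % 4) + 4 * (a / 4 % 2) + 8 * (a / 8)

/-- A numbering of the elements of a group by the natural numbers below `N`, compatible with
`mulIdx`. -/
structure GroupNumbering (Γ : Type*) [Group Γ] (N : ℕ) where
  elt : ℕ → Γ
  pos : 0 < N
  elt_zero : elt 0 = 1
  mul_lt : ∀ a < N, ∀ b < N, mulIdx a b < N
  elt_mul : ∀ a < N, ∀ b < N, elt a * elt b = elt (mulIdx a b)
  inv_lt : ∀ a < N, invIdx a < N
  elt_inv : ∀ a < N, (elt a)⁻¹ = elt (invIdx a)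
  inj : ∀ a < N, ∀ b < N, elt a = elt b → a = b
  surj : ∀ x, ∃ a < N, elt a = x

/-- The elements of the set of numbers below `N` encoded by the binary digits of `m`. -/
def decodeSet (N m : ℕ) : List ℕ := (List.range N).filter fun a => m.testBit a

/-- The number whose binary digits encode the set of entries of a list. -/
def encodeSet (l : List ℕ) : ℕ := l.foldr (fun a m => 2 ^ a ||| m) 0

theorem mem_decodeSet {N m a : ℕ} : a ∈ decodeSet N m ↔ a < N ∧ m.testBit a = true := by
  simp [decodeSet]

theorem testBit_encodeSet (l : List ℕ) (a : ℕ) : (encodeSet l).testBit a = true ↔ a ∈ l := by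
  induction l with
  | nil => simp [encodeSet]
  | cons b l ih =>
    change (2 ^ b ||| encodeSet l).testBit a = true ↔ _
    rw [Nat.testBit_or, Bool.or_eq_true, ih, Nat.testBit_two_pow, decide_eq_true_iff,
      List.mem_cons, eq_comm]

theorem encodeSet_lt {l : List ℕ} {N : ℕ} (h : ∀ a ∈ l, a < N) : encodeSet l < 2 ^ N := by
  refine Nat.lt_pow_two_of_testBit _ fun i hi => ?_
  rw [Bool.eq_false_iff]
  intro h1
  exact absurd (h i ((testBit_encodeSet l i).1 h1)) (not_lt.2 hi)

/-- The products of pairs of elements. -/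
def squareSet (N m : ℕ) : ℕ :=
  encodeSet ((decodeSet N m).flatMap fun a => (decodeSet N m).map (mulIdx a))

/-- The products of up to eight factors from the set encoded by `m` and the element `a`. -/
def closeSet (N m a : ℕ) : ℕ :=
  squareSet N (squareSet N (squareSet N (2 ^ a ||| m)))

def conjSet (N g m : ℕ) : ℕ :=
  encodeSet ((decodeSet N m).map fun a => mulIdx (mulIdx g a) (invIdx g))

namespace GroupNumbering

variable {Γ : Type*} [Group Γ] {N : ℕ} (ν : GroupNumbering Γ N)

/-- The set encoded by `m` consists of the elements of `H`. -/
def Encodes (m : ℕ) (H : Subgroup Γ) : Prop :=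
  m < 2 ^ N ∧ ∀ a < N, m.testBit a = true ↔ ν.elt a ∈ H

variable {ν}

theorem Encodes.unique {m m' : ℕ} {H : Subgroup Γ} (h : ν.Encodes m H) (h' : ν.Encodes m' H) :
    m = m' := by
  refine Nat.eq_of_testBit_eq fun i => ?_
  by_cases hi : i < N
  · rw [Bool.eq_iff_iff, h.2 i hi, h'.2 i hi]
  · have hle : 2 ^ N ≤ 2 ^ i := Nat.pow_le_pow_right two_pos (not_lt.1 hi)
    rw [Nat.testBit_lt_two_pow (h.1.trans_le hle), Nat.testBit_lt_two_pow (h'.1.trans_le hle)]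

theorem Encodes.eq {m : ℕ} {H H' : Subgroup Γ} (h : ν.Encodes m H) (h' : ν.Encodes m H') :
    H = H' := by
  ext x
  obtain ⟨a, ha, rfl⟩ := ν.surj x
  rw [← h.2 a ha, h'.2 a ha]

theorem Encodes.conj {m : ℕ} {H : Subgroup Γ} (h : ν.Encodes m H) {g : ℕ} (hg : g < N) :
    ν.Encodes (conjSet N g m) (H.map (MulAut.conj (ν.elt g)).toMonoidHom) := by
  have hlt : ∀ a < N, mulIdx (mulIdx g a) (invIdx g) < N := fun a ha =>
    ν.mul_lt _ (ν.mul_lt g hg a ha) _ (ν.inv_lt g hg)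
  have helt : ∀ a < N, ν.elt (mulIdx (mulIdx g a) (invIdx g)) =
      ν.elt g * ν.elt a * (ν.elt g)⁻¹ := fun a ha => by
    rw [← ν.elt_mul _ (ν.mul_lt g hg a ha) _ (ν.inv_lt g hg), ← ν.elt_mul g hg a ha,
      ν.elt_inv g hg]
  constructor
  · apply encodeSet_lt
    simp only [List.mem_map, mem_decodeSet]
    rintro _ ⟨a, ⟨ha, -⟩, rfl⟩
    exact hlt a ha
  · intro b hb
    rw [conjSet, testBit_encodeSet]
    simp only [List.mem_map, mem_decodeSet]
    constructor
    · rintro ⟨a, ⟨ha, hma⟩, rfl⟩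
      exact ⟨ν.elt a, (h.2 a ha).1 hma, (helt a ha).symm⟩
    · rintro ⟨x, hx, hxb⟩
      obtain ⟨a, ha, rfl⟩ := ν.surj x
      exact ⟨a, ⟨ha, (h.2 a ha).2 hx⟩, ν.inj _ (hlt a ha) _ hb ((helt a ha).trans hxb)⟩

theorem squareSet_le {m : ℕ} {H : Subgroup Γ} (h : ∀ a < N, m.testBit a = true → ν.elt a ∈ H) :
    ∀ a < N, (squareSet N m).testBit a = true → ν.elt a ∈ H := by
  intro c hc hm
  rw [squareSet, testBit_encodeSet, List.mem_flatMap] at hm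
  obtain ⟨a, ha, hm⟩ := hm
  obtain ⟨b, hb, rfl⟩ := List.mem_map.1 hm
  rw [mem_decodeSet] at ha hb
  rw [← ν.elt_mul a ha.1 b hb.1]
  exact mul_mem (h a ha.1 ha.2) (h b hb.1 hb.2)

theorem closeSet_le {m a : ℕ} {H : Subgroup Γ}
    (h : ∀ a < N, m.testBit a = true → ν.elt a ∈ H) (ha : ν.elt a ∈ H) :
    ∀ b < N, (closeSet N m a).testBit b = true → ν.elt b ∈ H := by
  refine squareSet_le (squareSet_le (squareSet_le fun b hb hm => ?_))
  rw [Nat.testBit_or, Bool.or_eq_true, Nat.testBit_two_pow, decide_eq_true_iff] at hm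
  rcases hm with rfl | hm
  · exact ha
  · exact h b hb hm

/-- A list of sets which contains the trivial subgroup and is closed under the adjunction of
elements contains every subgroup. -/
theorem exists_encodes {l : List ℕ} (h1 : 1 ∈ l) (hlt : ∀ m ∈ l, m < 2 ^ N)
    (hclose : ∀ m ∈ l, ∀ a < N, m.testBit a = true ∨ closeSet N m a ∈ l ∧ m < closeSet N m a)
    (H : Subgroup Γ) : ∃ m ∈ l, ν.Encodes m H := by
  have hne : {m | m ∈ l ∧ ∀ a < N, m.testBit a = true → ν.elt a ∈ H}.Nonempty := by
    refine ⟨1, h1, fun a _ ha => ?_⟩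
    rw [Nat.testBit_one_eq_true_iff_self_eq_zero.1 ha, ν.elt_zero]
    exact one_mem H
  have hfin : {m | m ∈ l ∧ ∀ a < N, m.testBit a = true → ν.elt a ∈ H}.Finite :=
    (List.finite_toSet l).subset fun m hm => hm.1
  -- The largest listed code inside H is H itself: adjoining a missing element of H would give a
  -- larger listed code inside H.
  obtain ⟨m, ⟨hml, hmH⟩, hmax⟩ := hfin.exists_maximal hne
  refine ⟨m, hml, hlt m hml, fun a ha => ⟨hmH a ha, fun haH => ?_⟩⟩
  rcases hclose m hml a ha with h | ⟨h2, h3⟩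
  · exact h
  · exact absurd (hmax ⟨h2, closeSet_le hmH haH⟩ h3.le) (not_le.2 h3)

theorem exists_subgroup {m : ℕ} (hlt : m < 2 ^ N) (h0 : m.testBit 0 = true)
    (hinv : ∀ a < N, m.testBit a = true → m.testBit (invIdx a) = true)
    (hmul : ∀ a < N, m.testBit a = true → ∀ b < N, m.testBit b = true →
      m.testBit (mulIdx a b) = true) : ∃ H, ν.Encodes m H := by
  let H : Subgroup Γ :=
    { carrier := {x | ∃ a < N, m.testBit a = true ∧ ν.elt a = x}
      one_mem' := ⟨0, ν.pos, h0, ν.elt_zero⟩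
      mul_mem' := by
        rintro _ _ ⟨a, ha, hma, rfl⟩ ⟨b, hb, hmb, rfl⟩
        exact ⟨_, ν.mul_lt a ha b hb, hmul a ha hma b hb hmb, (ν.elt_mul a ha b hb).symm⟩
      inv_mem' := by
        rintro _ ⟨a, ha, hma, rfl⟩
        exact ⟨_, ν.inv_lt a ha, hinv a ha hma, (ν.elt_inv a ha).symm⟩ }
  refine ⟨H, hlt, fun a ha => ⟨fun h => ⟨a, ha, h, rfl⟩, ?_⟩⟩
  rintro ⟨b, hb, hmb, hab⟩
  rwa [← ν.inj b hb a ha hab]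

/-- Counting the conjugacy classes of subgroups by a list `l` of all subgroups and a list `r` of
representatives. -/
theorem card_subgroupConjClass {l r : List ℕ} (h1 : 1 ∈ l) (hlt : ∀ m ∈ l, m < 2 ^ N)
    (hclose : ∀ m ∈ l, ∀ a < N, m.testBit a = true ∨ closeSet N m a ∈ l ∧ m < closeSet N m a)
    (hrep : ∀ m ∈ l, ∃ m' ∈ r, ∃ g < N, conjSet N g m = m')
    (hne : ∀ m ∈ r, ∀ m' ∈ r, ∀ g < N, conjSet N g m = m' → m = m')
    (hr : ∀ m ∈ r, m < 2 ^ N ∧ m.testBit 0 = true)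
    (hinv : ∀ m ∈ r, ∀ a < N, m.testBit a = true → m.testBit (invIdx a) = true)
    (hmul : ∀ m ∈ r, ∀ a < N, m.testBit a = true → ∀ b < N, m.testBit b = true →
      m.testBit (mulIdx a b) = true) (hnd : r.Nodup) (ν : GroupNumbering Γ N) :
    Nat.card (SubgroupConjClass Γ) = r.length := by
  choose S hS using fun m : {m // m ∈ r} =>
    exists_subgroup (ν := ν) (hr m m.2).1 (hr m m.2).2 (hinv m m.2) (hmul m m.2)
  have hbij : Function.Bijective fun m : {m // m ∈ r} => subgroupConjClass (S m) := by
    constructor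
    · intro m m' h
      obtain ⟨γ, hγ⟩ := Quotient.exact h
      obtain ⟨g, hg, rfl⟩ := ν.surj γ
      have h2 := (hS m).conj hg
      rw [hγ] at h2
      exact Subtype.ext (hne m m.2 m' m'.2 g hg (h2.unique (hS m')))
    · intro q
      obtain ⟨H, rfl⟩ := Quotient.exists_rep q
      obtain ⟨m, hm, hmH⟩ := exists_encodes (ν := ν) h1 hlt hclose H
      obtain ⟨m', hm', g, hg, hgm⟩ := hrep m hm
      refine ⟨⟨m', hm'⟩, ?_⟩
      have h2 := hmH.conj hg
      rw [hgm] at h2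
      refine (Quotient.sound ?_).symm
      exact ⟨ν.elt g, h2.eq (hS ⟨m', hm'⟩)⟩
  rw [← Nat.card_eq_of_bijective _ hbij]
  have : Nat.card {m // m ∈ r} = r.toFinset.card := by
    rw [← Nat.card_eq_finsetCard]
    simp
  rw [this, List.toFinset_card_of_nodup hnd]

end GroupNumbering

/-- The signed permutation with a given number. -/
def signedElt (n : ℕ) : SignedPerm :=
  (dihPerm (if n / 4 % 2 = 0 then 1 else -1) (n : ZMod 4), if n / 8 % 2 = 0 then 1 else -1)

noncomputable def numberingG16 : GroupNumbering G16 16 where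
  elt n := ⟨signedElt n, (mem_G16_iff _).2 ((mem_dihedralPerms_iff _).2 ⟨_, _, rfl⟩)⟩
  pos := by decide
  elt_zero := Subtype.ext (by
    change signedElt 0 = 1
    decide +kernel)
  mul_lt := by decide +kernel
  elt_mul := by
    have : ∀ a < 16, ∀ b < 16, signedElt a * signedElt b = signedElt (mulIdx a b) := by
      decide +kernel
    exact fun a ha b hb => Subtype.ext (this a ha b hb)
  inv_lt := by decide +kernel
  elt_inv := by
    have : ∀ a < 16, (signedElt a)⁻¹ = signedElt (invIdx a) := by decide +kernel
    exact fun a ha => Subtype.ext (this a ha)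
  inj := by
    have : ∀ a < 16, ∀ b < 16, signedElt a = signedElt b → a = b := by decide +kernel
    exact fun a ha b hb h => this a ha b hb (congrArg Subtype.val h)
  surj := by
    have : ∀ (E : ℤˣ) (c : ZMod 4) (s : ℤˣ), ∃ a < 16, signedElt a = (dihPerm E c, s) := by
      decide +kernel
    rintro ⟨⟨π, s⟩, h⟩
    obtain ⟨E, c, rfl⟩ := (mem_dihedralPerms_iff _).1 ((mem_G16_iff _).1 h)
    obtain ⟨a, ha, h1⟩ := this E c s
    exact ⟨a, ha, Subtype.ext h1⟩

noncomputable def numberingG8 : GroupNumbering G8 8 where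
  elt n := ⟨(signedElt n).1, by
    rw [G8_eq]; exact (mem_dihedralPerms_iff _).2 ⟨_, _, rfl⟩⟩
  pos := by decide
  elt_zero := Subtype.ext (by
    change (signedElt 0).1 = 1
    decide +kernel)
  mul_lt := by decide +kernel
  elt_mul := by
    have : ∀ a < 8, ∀ b < 8, (signedElt a).1 * (signedElt b).1 = (signedElt (mulIdx a b)).1 := by
      decide +kernel
    exact fun a ha b hb => Subtype.ext (this a ha b hb)
  inv_lt := by decide +kernel
  elt_inv := by
    have : ∀ a < 8, (signedElt a).1⁻¹ = (signedElt (invIdx a)).1 := by decide +kernel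
    exact fun a ha => Subtype.ext (this a ha)
  inj := by
    have : ∀ a < 8, ∀ b < 8, (signedElt a).1 = (signedElt b).1 → a = b := by decide +kernel
    exact fun a ha b hb h => this a ha b hb (congrArg Subtype.val h)
  surj := by
    have : ∀ (E : ℤˣ) (c : ZMod 4), ∃ a < 8, (signedElt a).1 = dihPerm E c := by
      decide +kernel
    rintro ⟨π, h⟩
    rw [G8_eq] at h
    obtain ⟨E, c, rfl⟩ := (mem_dihedralPerms_iff _).1 h
    obtain ⟨a, ha, h1⟩ := this E c
    exact ⟨a, ha, Subtype.ext h1⟩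

/-- The list `l` encodes all 35 subgroups, `r` one from each conjugacy class; the bits 8 to 15 stand
for the negative elements. -/
theorem card_subgroupConjClass_G16 : Nat.card (SubgroupConjClass G16) = 27 :=
  GroupNumbering.card_subgroupConjClass (N := 16)
    (l := [1, 5, 15, 17, 33, 65, 85, 129, 165, 255, 257, 1025, 1285, 2565, 3855, 4097, 4369, 5185,
      8193, 8481, 9345, 16385, 16705, 17425, 20485, 21845, 23205, 32769, 33153, 33825, 40965, 42405,
      43605, 61455, 65535])
    (r := [1, 5, 15, 17, 33, 85, 165, 255, 257, 1025, 1285, 2565, 3855, 4097, 4369, 5185, 8193,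
      8481, 9345, 20485, 21845, 23205, 40965, 42405, 43605, 61455, 65535])
    (by decide) (by decide +kernel) (by decide +kernel) (by decide +kernel) (by decide +kernel)
    (by decide +kernel) (by decide +kernel) (by decide +kernel) (by decide +kernel) numberingG16

theorem card_subgroupConjClass_G8 : Nat.card (SubgroupConjClass G8) = 8 :=
  GroupNumbering.card_subgroupConjClass (N := 8) (l := [1, 5, 15, 17, 33, 65, 85, 129, 165, 255])
    (r := [1, 5, 15, 17, 33, 85, 165, 255])
    (by decide) (by decide +kernel) (by decide +kernel) (by decide +kernel) (by decide +kernel)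
    (by decide +kernel) (by decide +kernel) (by decide +kernel) (by decide +kernel) numberingG8

/-! ### Orders and isomorphisms from numberings -/

theorem GroupNumbering.card {Γ : Type*} [Group Γ] {N : ℕ} (ν : GroupNumbering Γ N) : Nat.card Γ = N := by
  have hbij : Function.Bijective fun i : Fin N => ν.elt i := by
    constructor
    · intro i j h
      exact Fin.ext (ν.inj i i.2 j j.2 h)
    · intro x
      obtain ⟨a, ha, h⟩ := ν.surj x
      exact ⟨⟨a, ha⟩, h⟩
  rw [← Nat.card_eq_of_bijective _ hbij, Nat.card_fin]

theorem GroupNumbering.nonempty_mulEquiv {Γ Δ : Type*} [Group Γ] [Group Δ] {N : ℕ}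
    (ν : GroupNumbering Γ N) (μ : GroupNumbering Δ N) : Nonempty (Γ ≃* Δ) := by
  choose idx hidx hidx' using ν.surj
  have hmul : ∀ x y, μ.elt (idx (x * y)) = μ.elt (idx x) * μ.elt (idx y) := by
    intro x y
    rw [μ.elt_mul _ (hidx x) _ (hidx y)]
    congr 1
    apply ν.inj _ (hidx _) _ (ν.mul_lt _ (hidx x) _ (hidx y))
    rw [hidx', ← ν.elt_mul _ (hidx x) _ (hidx y), hidx', hidx']
  refine ⟨MulEquiv.ofBijective (MonoidHom.mk' (fun x => μ.elt (idx x)) hmul) ⟨?_, ?_⟩⟩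
  · intro x y h
    rw [← hidx' x, ← hidx' y, μ.inj _ (hidx x) _ (hidx y) h]
  · intro z
    obtain ⟨a, ha, rfl⟩ := μ.surj z
    refine ⟨ν.elt a, ?_⟩
    change μ.elt (idx (ν.elt a)) = _
    rw [ν.inj _ (hidx _) _ ha (hidx' (ν.elt a))]

/-- The element of the abstract dihedral group with a given number. -/
def dihedralElt (n : ℕ) : DihedralGroup 4 :=
  -- The convention `r c * sr 0 = sr (-c)` accounts for the minus sign.
  if n / 4 % 2 = 0 then DihedralGroup.r n else DihedralGroup.sr (-n)

def numberingDihedral : GroupNumbering (DihedralGroup 4) 8 where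
  elt := dihedralElt
  pos := by decide
  elt_zero := by decide +kernel
  mul_lt := by decide +kernel
  elt_mul := by decide +kernel
  inv_lt := by decide +kernel
  elt_inv := by decide +kernel
  inj := by decide +kernel
  surj := by decide +kernel

theorem nonempty_G8_mulEquiv : Nonempty (G8 ≃* DihedralGroup 4) :=
  numberingG8.nonempty_mulEquiv numberingDihedral

/-! ### The correspondence -/

/-- The type of an irreducible space group. -/
def typeOf (G : Subgroup Isom3) (h : IsSpaceGroup G ∧ IsIrreducibleGroup G) :
    IrreducibleSpaceGroupType :=
  Quotient.mk _ ⟨G, h⟩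

theorem typeOf_eq_iff {G G' : Subgroup Isom3} {h : IsSpaceGroup G ∧ IsIrreducibleGroup G}
    {h' : IsSpaceGroup G' ∧ IsIrreducibleGroup G'} :
    typeOf G h = typeOf G' h' ↔ AffinelyEquivalent G G' :=
  Quotient.eq

def fullType : SubgroupConjClass G16 → IrreducibleSpaceGroupType :=
  Quotient.lift (fun H => typeOf (fullGroup H) (fullGroup_isIrreducibleSpaceGroup H))
    fun H H' h => typeOf_eq_iff.2 ((fullGroup_affinelyEquivalent_iff H H').2 h)

def quarterType : SubgroupConjClass G8 → IrreducibleSpaceGroupType :=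
  Quotient.lift (fun K => typeOf (quarterGroup K) (quarterGroup_isIrreducibleSpaceGroup K))
    fun K K' h => typeOf_eq_iff.2 ((quarterGroup_affinelyEquivalent_iff K K').2 h)

theorem fullType_injective : Function.Injective fullType := by
  rintro ⟨H⟩ ⟨H'⟩ h
  exact Quotient.sound ((fullGroup_affinelyEquivalent_iff H H').1 (typeOf_eq_iff.1 h))

theorem quarterType_injective : Function.Injective quarterType := by
  rintro ⟨K⟩ ⟨K'⟩ h
  exact Quotient.sound ((quarterGroup_affinelyEquivalent_iff K K').1 (typeOf_eq_iff.1 h))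

theorem fullType_ne_quarterType (x : SubgroupConjClass G16) (y : SubgroupConjClass G8) :
    fullType x ≠ quarterType y := by
  obtain ⟨H⟩ := x
  obtain ⟨K⟩ := y
  exact fun h => not_affinelyEquivalent_full_quarter H K (typeOf_eq_iff.1 h)

theorem bijective_sumElim_fullType_quarterType :
    Function.Bijective (Sum.elim fullType quarterType) := by
  refine ⟨fullType_injective.sumElim quarterType_injective fullType_ne_quarterType, ?_⟩
  rintro ⟨⟨G, hG, hI⟩⟩
  rcases exists_affinelyEquivalent hG hI with ⟨H, h⟩ | ⟨K, h⟩
  · exact ⟨Sum.inl (subgroupConjClass H), (typeOf_eq_iff (h := ⟨hG, hI⟩).2 h).symm⟩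
  · exact ⟨Sum.inr (subgroupConjClass K), (typeOf_eq_iff (h := ⟨hG, hI⟩).2 h).symm⟩

theorem mainTheorem4 :
    -- every symmetry of the lattice induces exactly one signed permutation of the four cosets
    (∀ g ∈ bccSymm, ∃! σ : SignedPerm, InducesSigned g σ) ∧
    -- the symmetries of the marked lattice preserve both classes of Delaunay tetrahedra
    (∀ g ∈ markedSymm, ∀ σ : SignedPerm, InducesSigned g σ → σ.2 = 1) ∧
    -- `G₁₆` has order 16 and is the product of `{1, -1}` with the positive permutations;
    -- these form the dihedral group of order 8, which is also `G₈`
    Nat.card G16 = 16 ∧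
    G16 = dihedralPerms.prod ⊤ ∧
    G8 = dihedralPerms ∧
    Nonempty (G8 ≃* DihedralGroup 4) ∧
    -- `bccSymm = N(T₁)` and `G₁₆ = N(T₁)/T₁`, where `T₁` is the odd subgroup of `bccSymm`
    Subgroup.normalizer (oddSubgroup bccSymm : Set Isom3) = bccSymm ∧
    (∀ g : Isom3, g ∈ oddSubgroup bccSymm ↔ g ∈ bccSymm ∧ InducesSigned g 1) ∧
    -- `markedSymm = N(T₂)` and `G₈ = N(T₂)/T₂`, where `T₂` is the odd subgroup of `markedSymm`
    Subgroup.normalizer (oddSubgroup markedSymm : Set Isom3) = markedSymm ∧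
    (∀ g : Isom3, g ∈ oddSubgroup markedSymm ↔ g ∈ markedSymm ∧ InducesPerm g 1) ∧
    -- there are 27 + 8 = 35 classes
    Nat.card (SubgroupConjClass G16) = 27 ∧
    Nat.card (SubgroupConjClass G8) = 8 ∧
    Nat.card IrreducibleSpaceGroupType = 35 ∧
    -- the correspondence
    ∃ Φ : SubgroupConjClass G16 ⊕ SubgroupConjClass G8 ≃ IrreducibleSpaceGroupType,
      (∀ H : Subgroup G16,
        ∃ h : IsSpaceGroup (fullGroup H) ∧ IsIrreducibleGroup (fullGroup H),
          Φ (Sum.inl (subgroupConjClass H)) = Quotient.mk _ ⟨fullGroup H, h⟩) ∧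
      (∀ K : Subgroup G8,
        ∃ h : IsSpaceGroup (quarterGroup K) ∧ IsIrreducibleGroup (quarterGroup K),
          Φ (Sum.inr (subgroupConjClass K)) = Quotient.mk _ ⟨quarterGroup K, h⟩) := by
  have h27 := card_subgroupConjClass_G16
  have h8 := card_subgroupConjClass_G8
  have h35 : Nat.card IrreducibleSpaceGroupType = 35 := by
    have : Finite (SubgroupConjClass G16) := Nat.finite_of_card_ne_zero (by rw [h27]; decide)
    have : Finite (SubgroupConjClass G8) := Nat.finite_of_card_ne_zero (by rw [h8]; decide)
    rw [← Nat.card_eq_of_bijective _ bijective_sumElim_fullType_quarterType, Nat.card_sum, h27, h8]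
  refine ⟨bccSymm_existsUnique, fun _ hg _ h => markedSymm_sign hg h, numberingG16.card, G16_eq, G8_eq,
    nonempty_G8_mulEquiv, normalizer_oddSubgroup_bccSymm, ?_, normalizer_oddSubgroup_markedSymm,
    ?_, h27, h8, h35, Equiv.ofBijective _ bijective_sumElim_fullType_quarterType,
    fun H => ⟨fullGroup_isIrreducibleSpaceGroup H, rfl⟩,
    fun K => ⟨quarterGroup_isIrreducibleSpaceGroup K, rfl⟩⟩
  · intro g
    rw [oddSubgroup_bccSymm]
    exact mem_fullGroup_bot_iff g
  · intro g
    rw [oddSubgroup_markedSymm]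
    exact mem_quarterGroup_bot_iff g
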